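/- **Setting.** Let $V$ be a simple vertex operator algebra over $\mathbb{C}$ such that (i) $V_{(n)}=0$ for $n<0$, $V_{(0)}=\mathbb{C}\mathbf{1}$, and $V$ is isomorphic, as a $V$-module, to its contragredient module $V'$; (ii) every $\mathbb{N}$-gradable weak $V$-module is completely reducible; (iii) $\dim V/C_2(V)<\infty$, where $C_2(V)$ is spanned by the vectors $u_{-2}v$, $u,v\in V$. Let $\mathcal{A}$ be the set of isomorphism classes of irreducible $V$-modules, and for $a\in\mathcal{A}$ let $a'$ be the class of the contragredient modules of the members of $a$; then $a''=a$. Fix representatives $W^a$ of the classes $a\in\mathcal{A}$ and, for each $a$, an identification of $W^{a'}$ with the contragredient module $(W^a)'$, i.e. a nondegenerate invariant pairing $\langle\cdot,\cdot\rangle_a: W^{a'}\times W^a\to\mathbb{C}$ (such choices exist; no symmetry of the pairings is required). Let $h_a$ be the lowest weight of $W^a$, so that $W^a=\coprod_{n\in h_a+\mathbb{N}}W^a_{(n)}$ and $W^a_{(h_a)}\neq 0$. For $a_1,a_2,a_3\in\mathcal{A}$ let $\mathcal{V}_{a_1a_2}^{a_3}$ be the space of intertwining operators of type ${W^{a_3}\choose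 W^{a_1}W^{a_2}}$, and let $$\mathcal{V}=\coprod_{a_1,a_2,a_3\in\mathcal{A}}\mathcal{V}_{a_1a_2}^{a_3}.$$ For $\mathcal{Y}\in\mathcal{V}_{a_1a_2}^{a_3}$ put $\Delta(\mathcal{Y})=h_{a_3}-h_{a_1}-h_{a_2}$, and define $\sigma_{12}(\mathcal{Y})=e^{\pi i\Delta(\mathcal{Y})}\Omega_{-1}(\mathcal{Y})$ and $\sigma_{23}(\mathcal{Y})=e^{\pi i h_{a_1}}A_{-1}(\mathcal{Y})$, that is, for $w_j\in W^{a_j}$ ($j=1,2$) and $w_3'\in W^{a_3'}$, $$\sigma_{12}(\mathcal{Y})(w_2,x)w_1=e^{\pi i\Delta(\mathcal{Y})}\,e^{xL(-1)}\mathcal{Y}(w_1,e^{-\pi i}x)w_2,$$ $$\langle\sigma_{23}(\mathcal{Y})(w_1,x)w_3',w_2\rangle_{a_2}=e^{\pi i h_{a_1}}\,\bigl\langle \mathcal{Y}\bigl(e^{xL(1)}(e^{-\pi i}x^{-2})^{L(0)}w_1,x^{-1}\bigr)w_2,\,w_3'\bigr\rangle_{a_3'},$$ where $(e^{-\pi i}x)^s=e^{-\pi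 i s}x^s$ for $s\in\mathbb{C}$ and $(e^{-\pi i}x^{-2})^{L(0)}w=e^{-\pi i\mu}x^{-2\mu}w$ if $L(0)w=\mu w$. **Proposition 1.1.** The formulas above define linear maps $\sigma_{12}:\mathcal{V}_{a_1a_2}^{a_3}\to\mathcal{V}_{a_2a_1}^{a_3}$ and $\sigma_{23}:\mathcal{V}_{a_1a_2}^{a_3}\to\mathcal{V}_{a_1a_3'}^{a_2'}$ for all $a_1,a_2,a_3\in\mathcal{A}$, and these generate a left action of the symmetric group $S_3$ on $\mathcal{V}$: there is exactly one linear representation of $S_3$ on $\mathcal{V}$ in which $(12)$ acts as $\sigma_{12}$ and $(23)$ acts as $\sigma_{23}$. -/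

import Mathlib

universe u

/-- The Jacobi identity for `I(w₁, x) = ∑ₙ I n w₁ x^{-n-1}` with respect to vertex operators
`Yⱼ(v, x) = ∑ₘ (actⱼ m v) x^{-m-1}`: the equality of the coefficients of
`x₀^{-l-1} x₁^{-m-1} x₂^{-n-1}` in
`x₀⁻¹ δ((x₁-x₂)/x₀) Y₃(v,x₁) I(w₁,x₂) w₂ - x₀⁻¹ δ((x₂-x₁)/(-x₀)) I(w₁,x₂) Y₂(v,x₁) w₂
  = x₂⁻¹ δ((x₁-x₀)/x₂) I(Y₁(v,x₀)w₁,x₂) w₂`.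
The index set `Γ` of the coefficients of `I` is `ℤ` (algebras, modules) or `ℂ` (intertwining
operators). Both sums are finite whenever the operators are lower truncated. -/
def JacobiIdentity {Γ V M₁ M₂ M₃ : Type*} [Ring Γ]
    [AddCommGroup V] [Module ℂ V] [AddCommGroup M₁] [Module ℂ M₁]
    [AddCommGroup M₂] [Module ℂ M₂] [AddCommGroup M₃] [Module ℂ M₃]
    (act₁ : ℤ → V →ₗ[ℂ] M₁ →ₗ[ℂ] M₁) (act₂ : ℤ → V →ₗ[ℂ] M₂ →ₗ[ℂ] M₂)
    (act₃ : ℤ → V →ₗ[ℂ] M₃ →ₗ[ℂ] M₃) (I : Γ → M₁ →ₗ[ℂ] M₂ →ₗ[ℂ] M₃) : Prop :=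
  ∀ (v : V) (w₁ : M₁) (w₂ : M₂) (l m : ℤ) (n : Γ),
    (∑ᶠ i : ℕ, ((-1) ^ i * Ring.choose l i : ℤ) •
        (act₃ (m + l - i) v (I (n + i) w₁ w₂)
          - (l.negOnePow : ℤ) • I (n + l - i) w₁ (act₂ (m + i) v w₂)))
      = ∑ᶠ i : ℕ, (Ring.choose m i : ℤ) • I (m + n - i) (act₁ (l + i) v w₁) w₂

/-- A vertex operator algebra structure on `V`: `Y n u v` is `u_n v`, where
`Y(u, x) = ∑ₙ u_n x^{-n-1}`, and `L(n) = ω_{n+1}`. The homogeneous subspace `V_(n)`, `n ∈ ℤ`,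
is the eigenspace of `L(0)` with eigenvalue `n`; eigenspaces are independent, so
`iSup_weight` says that `V` is the direct sum of the `V_(n)`. -/
structure VOA (V : Type u) [AddCommGroup V] [Module ℂ V] where
  Y : ℤ → V →ₗ[ℂ] V →ₗ[ℂ] V
  vacuum : V
  conformal : V
  centralCharge : ℂ
  truncation : ∀ u v : V, ∃ N : ℤ, ∀ n, N ≤ n → Y n u v = 0
  vacuum_mode : ∀ (n : ℤ) (v : V), Y n vacuum v = if n = -1 then v else 0
  creation_nonneg : ∀ (v : V) (n : ℤ), 0 ≤ n → Y n v vacuum = 0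
  creation : ∀ v : V, Y (-1) v vacuum = v
  jacobi : JacobiIdentity Y Y Y Y
  virasoro : ∀ (m n : ℤ) (v : V),
    Y (m + 1) conformal (Y (n + 1) conformal v) - Y (n + 1) conformal (Y (m + 1) conformal v)
      = ((m : ℂ) - n) • Y (m + n + 1) conformal v
        + (if m + n = 0 then ((m : ℂ) ^ 3 - m) / 12 * centralCharge else 0) • v
  derivative : ∀ (u v : V) (n : ℤ), Y n (Y 0 conformal u) v = -(n : ℂ) • Y (n - 1) u v
  iSup_weight : ⨆ n : ℤ, Module.End.eigenspace (Y 1 conformal) (n : ℂ) = ⊤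
  finite_weight : ∀ n : ℤ,
    FiniteDimensional ℂ (Module.End.eigenspace (Y 1 conformal) (n : ℂ))
  bounded_weight : ∃ N : ℤ, ∀ n : ℤ, n < N → Module.End.eigenspace (Y 1 conformal) (n : ℂ) = ⊥
  vacuum_mem : vacuum ∈ Module.End.eigenspace (Y 1 conformal) 0
  conformal_mem : conformal ∈ Module.End.eigenspace (Y 1 conformal) 2

/-- A weak module: all axioms of a module except those on the grading. -/
structure WeakModule {V : Type u} [AddCommGroup V] [Module ℂ V] (X : VOA V) where
  carrier : Type u
  [addCommGroup : AddCommGroup carrier]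
  [module : Module ℂ carrier]
  /-- `mode n v w = v_n w`, where `Y_W(v, x) = ∑ₙ v_n x^{-n-1}`. -/
  mode : ℤ → V →ₗ[ℂ] carrier →ₗ[ℂ] carrier
  truncation : ∀ (v : V) (w : carrier), ∃ N : ℤ, ∀ n, N ≤ n → mode n v w = 0
  vacuum_mode : ∀ (n : ℤ) (w : carrier), mode n X.vacuum w = if n = -1 then w else 0
  jacobi : JacobiIdentity X.Y mode mode mode
  derivative : ∀ (v : V) (w : carrier) (n : ℤ),
    mode n (X.Y 0 X.conformal v) w = -(n : ℂ) • mode (n - 1) v w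

namespace WeakModule

variable {V : Type u} [AddCommGroup V] [Module ℂ V] {X : VOA V}

instance : CoeSort (WeakModule X) (Type u) := ⟨WeakModule.carrier⟩

instance (M : WeakModule X) : AddCommGroup M := M.addCommGroup

instance (M : WeakModule X) : Module ℂ M := M.module

/-- The Virasoro operator `L(n)` on a weak module. -/
def L (M : WeakModule X) (n : ℤ) : M →ₗ[ℂ] M := M.mode (n + 1) X.conformal

/-- The homogeneous subspace `W_(μ)`: the eigenspace of `L(0)` with eigenvalue `μ`. -/
def weight (M : WeakModule X) (μ : ℂ) : Submodule ℂ M := Module.End.eigenspace (M.L 0) μ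

/-- The subspace `S` is a (weak) submodule. -/
def IsSubmodule (M : WeakModule X) (S : Submodule ℂ M) : Prop :=
  ∀ (n : ℤ) (v : V), ∀ w ∈ S, M.mode n v w ∈ S

/-- `M` is nonzero and has no submodules other than `0` and `M`. -/
def IsIrreducible (M : WeakModule X) : Prop :=
  Nontrivial M ∧ ∀ S : Submodule ℂ M, M.IsSubmodule S → S = ⊥ ∨ S = ⊤

/-- `M` is the sum of its irreducible submodules. -/
def IsCompletelyReducible (M : WeakModule X) : Prop :=
  sSup {S : Submodule ℂ M | M.IsSubmodule S ∧ S ≠ ⊥ ∧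
    ∀ T ≤ S, M.IsSubmodule T → T = ⊥ ∨ T = S} = ⊤

/-- An isomorphism of `V`-modules. -/
def Isomorphic (M N : WeakModule X) : Prop :=
  ∃ f : M ≃ₗ[ℂ] N, ∀ (n : ℤ) (v : V) (w : M), f (M.mode n v w) = N.mode n v (f w)

/-- `h` is the lowest weight of `M`: `M_(h) ≠ 0`, and all weights of `M` lie in `h + ℕ`. -/
def IsLowestWeight (M : WeakModule X) (h : ℂ) : Prop :=
  M.weight h ≠ ⊥ ∧ ∀ μ, M.weight μ ≠ ⊥ → ∃ k : ℕ, μ = h + k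

/-- The lowest weight; every irreducible module has exactly one. -/
noncomputable def lowestWeight (M : WeakModule X) : ℂ := Classical.epsilon M.IsLowestWeight

/-- The graded dual `∐ (M_(μ))^*` inside the full dual; the summand `(M_(μ))^*` consists of the
functionals that vanish on all other homogeneous subspaces. -/
def gradedDual (M : WeakModule X) : Submodule ℂ (Module.Dual ℂ M) :=
  ⨆ μ : ℂ, (⨆ ν : ℂ, ⨆ _ : ν ≠ μ, M.weight ν).dualAnnihilator

end WeakModule

namespace VOA

variable {V : Type u} [AddCommGroup V] [Module ℂ V]

/-- `V` as a module over itself. -/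
def adjoint (X : VOA V) : WeakModule X where
  carrier := V
  mode := X.Y
  truncation := X.truncation
  vacuum_mode := X.vacuum_mode
  jacobi := X.jacobi
  derivative := X.derivative

/-- The homogeneous subspace `V_(n)`. -/
def weight (X : VOA V) (n : ℤ) : Submodule ℂ V :=
  Module.End.eigenspace (X.Y 1 X.conformal) (n : ℂ)

/-- The subspace `C₂(V)` spanned by the vectors `u_{-2} v`. -/
def C₂ (X : VOA V) : Submodule ℂ V :=
  Submodule.span ℂ (Set.range fun p : V × V => X.Y (-2) p.1 p.2)

end VOA

namespace WeakModule

variable {V : Type u} [AddCommGroup V] [Module ℂ V] {X : VOA V}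

/-- `M` is `ℕ`-gradable: `M = ∐_{k ∈ ℕ} G k` with `v_n (G k) ⊆ G (k + wt v - n - 1)` for
homogeneous `v`, where `G j = 0` for `j < 0`. -/
def IsNGradable (M : WeakModule X) : Prop :=
  ∃ G : ℕ → Submodule ℂ M, DirectSum.IsInternal G ∧
    ∀ (d : ℤ), ∀ v ∈ X.weight d, ∀ (n : ℤ) (k : ℕ), ∀ w ∈ G k,
      M.mode n v w = 0 ∨ ∃ j : ℕ, (j : ℤ) = k + d - n - 1 ∧ M.mode n v w ∈ G j

/-- `β` identifies `N` with the contragredient module of `M`: it is a linear bijection from `N`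
onto the graded dual of `M`, and with `⟨w', w⟩ = β w' w`,
`⟨Y_N(v, x) w', w⟩ = ⟨w', Y_M(e^{x L(1)} (-x^{-2})^{L(0)} v, x^{-1}) w⟩`.
The last equality is written through the coefficients of `x^{-n-1}`, for homogeneous `v`. -/
def IsContragredient (N M : WeakModule X) (β : N →ₗ[ℂ] Module.Dual ℂ M) : Prop :=
  Function.Injective β ∧ LinearMap.range β = M.gradedDual ∧
    ∀ (d : ℤ), ∀ v ∈ X.weight d, ∀ (n : ℤ) (w' : N) (w : M),
      β (N.mode n v w') w
        = ∑ᶠ k : ℕ, ((k.factorial : ℂ)⁻¹ * ((d.negOnePow : ℤ) : ℂ)) *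
            β w' (M.mode (2 * d - k - n - 2) ((X.Y 2 X.conformal ^ k) v) w)

end WeakModule

/-- The standing assumptions on `V`. The self-duality of `V` is an isomorphism of `V` with its
contragredient module. -/
structure VOA.StandingAssumptions {V : Type u} [AddCommGroup V] [Module ℂ V] (X : VOA V) :
    Prop where
  simple : X.adjoint.IsIrreducible
  nonneg_weight : ∀ n : ℤ, n < 0 → X.weight n = ⊥
  weight_zero : X.weight 0 = Submodule.span ℂ {X.vacuum}
  selfDual : ∃ β : X.adjoint →ₗ[ℂ] Module.Dual ℂ X.adjoint,
    WeakModule.IsContragredient X.adjoint X.adjoint β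
  completelyReducible : ∀ M : WeakModule X, M.IsNGradable → M.IsCompletelyReducible
  c₂Cofinite : FiniteDimensional ℂ (V ⧸ X.C₂)

/-- An irreducible module: `W = ∐_{μ ∈ ℂ} W_(μ)` with finite-dimensional homogeneous subspaces,
which vanish when the real part of `μ` is sufficiently small. -/
structure IrreducibleModule {V : Type u} [AddCommGroup V] [Module ℂ V] (X : VOA V) extends
    WeakModule X where
  iSup_weight : ⨆ μ : ℂ, toWeakModule.weight μ = ⊤
  finite_weight : ∀ μ : ℂ, FiniteDimensional ℂ (toWeakModule.weight μ)
  bounded_weight : ∃ N : ℝ, ∀ μ : ℂ, μ.re < N → toWeakModule.weight μ = ⊥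
  irreducible : toWeakModule.IsIrreducible

/-- Isomorphism of irreducible modules, as an equivalence relation. -/
instance IrreducibleModule.isoSetoid {V : Type u} [AddCommGroup V] [Module ℂ V] (X : VOA V) :
    Setoid (IrreducibleModule X) where
  r M N := M.toWeakModule.Isomorphic N.toWeakModule
  iseqv :=
    { refl := fun _ => ⟨LinearEquiv.refl ℂ _, fun _ _ _ => rfl⟩
      symm := fun ⟨f, hf⟩ => ⟨f.symm, fun n v w => by
        rw [LinearEquiv.symm_apply_eq, hf, LinearEquiv.apply_symm_apply]⟩
      trans := fun ⟨f, hf⟩ ⟨g, hg⟩ => ⟨f.trans g, fun n v w => by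
        simp only [LinearEquiv.trans_apply, hf, hg]⟩ }

/-- The set `𝒜` of equivalence classes of irreducible modules. -/
def IrrClass {V : Type u} [AddCommGroup V] [Module ℂ V] (X : VOA V) : Type (u + 1) :=
  Quotient (IrreducibleModule.isoSetoid X)

section Intertwining

variable {V : Type u} [AddCommGroup V] [Module ℂ V] {X : VOA V}

/-- The axioms of an intertwining operator of type `(M₃; M₁ M₂)`, where
`𝒴(w₁, x) w₂ = ∑_{n ∈ ℂ} (𝒴 n w₁ w₂) x^{-n-1}`: lower truncation, Jacobi identity,
`L(-1)`-derivative property. -/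
structure IsIntertwining (M₁ M₂ M₃ : WeakModule X) (𝒴 : ℂ → M₁ →ₗ[ℂ] M₂ →ₗ[ℂ] M₃) : Prop where
  truncation : ∀ (w₁ : M₁) (w₂ : M₂), ∃ N : ℝ, ∀ n : ℂ, N ≤ n.re → 𝒴 n w₁ w₂ = 0
  jacobi : JacobiIdentity M₁.mode M₂.mode M₃.mode 𝒴
  derivative : ∀ (n : ℂ) (w₁ : M₁) (w₂ : M₂), 𝒴 n (M₁.L (-1) w₁) w₂ = -n • 𝒴 (n - 1) w₁ w₂

theorem IsIntertwining.finite_left {M₁ M₂ M₃ : WeakModule X}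
    {𝒴 : ℂ → M₁ →ₗ[ℂ] M₂ →ₗ[ℂ] M₃} (h : IsIntertwining M₁ M₂ M₃ 𝒴)
    (v : V) (w₁ : M₁) (w₂ : M₂) (l m : ℤ) (n : ℂ) :
    (Function.support fun i : ℕ => ((-1) ^ i * Ring.choose l i : ℤ) •
        (M₃.mode (m + l - i) v (𝒴 (n + i) w₁ w₂)
          - (l.negOnePow : ℤ) • 𝒴 (n + l - i) w₁ (M₂.mode (m + i) v w₂))).Finite := by
  obtain ⟨N, hN⟩ := h.truncation w₁ w₂
  obtain ⟨K, hK⟩ := M₂.truncation v w₂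
  obtain ⟨p, hp⟩ := exists_nat_ge (N - n.re)
  refine (Set.finite_lt_nat (max p (K - m).toNat)).subset fun i hi => ?_
  by_contra hlt
  simp only [Set.mem_ofPred_eq, not_lt, max_le_iff] at hlt
  have h₁ : 𝒴 (n + i) w₁ w₂ = 0 := hN _ (by
    have : (p : ℝ) ≤ i := by exact_mod_cast hlt.1
    simp only [Complex.add_re, Complex.natCast_re]
    linarith)
  have h₂ : M₂.mode (m + i) v w₂ = 0 := hK _ (by omega)
  exact hi (by simp [h₁, h₂])

theorem IsIntertwining.finite_right {M₁ M₂ M₃ : WeakModule X}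
    (𝒴 : ℂ → M₁ →ₗ[ℂ] M₂ →ₗ[ℂ] M₃)
    (v : V) (w₁ : M₁) (w₂ : M₂) (l m : ℤ) (n : ℂ) :
    (Function.support fun i : ℕ =>
      (Ring.choose m i : ℤ) • 𝒴 (m + n - i) (M₁.mode (l + i) v w₁) w₂).Finite := by
  obtain ⟨K, hK⟩ := M₁.truncation v w₁
  refine (Set.finite_lt_nat (K - l).toNat).subset fun i hi => ?_
  by_contra hlt
  simp only [Set.mem_ofPred_eq, not_lt] at hlt
  have h₂ : M₁.mode (l + i) v w₁ = 0 := hK _ (by omega)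
  exact hi (by simp [h₂])

/-- The vector space of intertwining operators of type `(M₃; M₁ M₂)`. -/
def intertwiningSpace (M₁ M₂ M₃ : WeakModule X) :
    Submodule ℂ (ℂ → M₁ →ₗ[ℂ] M₂ →ₗ[ℂ] M₃) where
  carrier := {𝒴 | IsIntertwining M₁ M₂ M₃ 𝒴}
  zero_mem' := ⟨fun _ _ => ⟨0, fun _ _ => rfl⟩, fun _ _ _ _ _ _ => by simp, fun _ _ _ => by simp⟩
  add_mem' := by
    intro 𝒴 𝒵 h𝒴 h𝒵
    refine ⟨fun w₁ w₂ => ?_, fun v w₁ w₂ l m n => ?_, fun n w₁ w₂ => ?_⟩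
    · obtain ⟨N, hN⟩ := h𝒴.truncation w₁ w₂
      obtain ⟨K, hK⟩ := h𝒵.truncation w₁ w₂
      refine ⟨max N K, fun n hn => ?_⟩
      simp [hN n ((le_max_left _ _).trans hn), hK n ((le_max_right _ _).trans hn)]
    · have h : _ + _ = _ + _ :=
        congrArg₂ (· + ·) (h𝒴.jacobi v w₁ w₂ l m n) (h𝒵.jacobi v w₁ w₂ l m n)
      rw [← finsum_add_distrib (h𝒴.finite_left v w₁ w₂ l m n) (h𝒵.finite_left v w₁ w₂ l m n),
        ← finsum_add_distrib (IsIntertwining.finite_right 𝒴 v w₁ w₂ l m n)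
          (IsIntertwining.finite_right 𝒵 v w₁ w₂ l m n)] at h
      convert h using 3 with i i
      · rw [← smul_add]
        congr 1
        simp only [Pi.add_apply, LinearMap.add_apply, map_add, smul_add]
        abel
      · simp only [Pi.add_apply, LinearMap.add_apply, smul_add]
    · simp [h𝒴.derivative, h𝒵.derivative]
  smul_mem' := by
    intro c 𝒴 h𝒴
    refine ⟨fun w₁ w₂ => ?_, fun v w₁ w₂ l m n => ?_, fun n w₁ w₂ => ?_⟩
    · obtain ⟨N, hN⟩ := h𝒴.truncation w₁ w₂
      exact ⟨N, fun n hn => by simp [hN n hn]⟩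
    · have h : c • _ = c • _ := congrArg (c • ·) (h𝒴.jacobi v w₁ w₂ l m n)
      rw [smul_finsum, smul_finsum] at h
      convert h using 3 with i i
      · simp only [Pi.smul_apply, LinearMap.smul_apply, map_smul]
        rw [smul_comm c, smul_sub c, smul_comm c (l.negOnePow : ℤ)]
      · simp only [Pi.smul_apply, LinearMap.smul_apply]
        rw [smul_comm c]
    · simp only [Pi.smul_apply, LinearMap.smul_apply, h𝒴.derivative]
      rw [smul_comm]

/-- The coefficient of `x^{-n-1}` in
`Ω_r(𝒴)(w₂, x) w₁ = e^{x L(-1)} 𝒴(w₁, e^{(2r+1)πi} x) w₂`. -/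
noncomputable def skewOp {M₁ M₂ M₃ : WeakModule X} (r : ℤ) (𝒴 : ℂ → M₁ →ₗ[ℂ] M₂ →ₗ[ℂ] M₃)
    (n : ℂ) (w₂ : M₂) (w₁ : M₁) : M₃ :=
  ∑ᶠ k : ℕ, ((k.factorial : ℂ)⁻¹ *
      Complex.exp ((2 * r + 1) * Real.pi * Complex.I * (-(n + k) - 1))) •
    (M₃.L (-1) ^ k) (𝒴 (n + k) w₁ w₂)

/-- For `w₁` of weight `μ` and a functional `f` on `M₃`: the coefficient of `x^{-n-1}` in the
functional `A_r(𝒴)(w₁, x) f` on `M₂`, which is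
`w₂ ↦ f (𝒴(e^{x L(1)} e^{(2r+1)πi L(0)} x^{-2 L(0)} w₁, x^{-1}) w₂)`. -/
noncomputable def contragredientOp {M₁ M₂ M₃ : WeakModule X} (r : ℤ)
    (𝒴 : ℂ → M₁ →ₗ[ℂ] M₂ →ₗ[ℂ] M₃) (μ n : ℂ) (w₁ : M₁) (f : Module.Dual ℂ M₃) :
    Module.Dual ℂ M₂ :=
  ∑ᶠ k : ℕ, ((k.factorial : ℂ)⁻¹ * Complex.exp ((2 * r + 1) * Real.pi * Complex.I * μ)) •
    (f ∘ₗ 𝒴 (2 * μ - k - n - 2) ((M₁.L 1 ^ k) w₁))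

end Intertwining

/-- A choice of representatives `W^a`, `a ∈ 𝒜`, together with identifications of `W^{a'}` with
the contragredient module of `W^a`, where `a'` is the class of that contragredient module.
The identification is a nondegenerate invariant pairing `⟨·, ·⟩_a : W^{a'} × W^a → ℂ`;
no symmetry `⟨w', w⟩_a = ⟨w, w'⟩_{a'}` is required.
(`pairing a b` with `a' = b` is `⟨·, ·⟩_a`; the second index makes `⟨·, ·⟩_{a'}` a pairing of
`W^a` with `W^{a'}`.) -/
structure Representatives {V : Type u} [AddCommGroup V] [Module ℂ V] (X : VOA V) where
  W : IrrClass X → IrreducibleModule X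
  class_W : ∀ a, Quotient.mk (IrreducibleModule.isoSetoid X) (W a) = a
  dual : IrrClass X → IrrClass X
  dual_dual : ∀ a, dual (dual a) = a
  pairing : ∀ a b, dual a = b →
    (W b).toWeakModule →ₗ[ℂ] Module.Dual ℂ (W a).toWeakModule
  isContragredient : ∀ a b (h : dual a = b),
    WeakModule.IsContragredient (W b).toWeakModule (W a).toWeakModule (pairing a b h)

namespace Representatives

variable {V : Type u} [AddCommGroup V] [Module ℂ V] {X : VOA V} (C : Representatives X)

/-- The lowest weight `h_a` of `W^a`. -/
noncomputable def h (a : IrrClass X) : ℂ := (C.W a).lowestWeight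

/-- The space `𝒱_{a₁ a₂}^{a₃}` of intertwining operators of type `(W^{a₃}; W^{a₁} W^{a₂})`. -/
abbrev space (a₁ a₂ a₃ : IrrClass X) :=
  intertwiningSpace (C.W a₁).toWeakModule (C.W a₂).toWeakModule (C.W a₃).toWeakModule

/-- The direct sum `𝒱` of the spaces `𝒱_{a₁ a₂}^{a₃}`. -/
abbrev total : Type (u + 1) :=
  DirectSum (IrrClass X × IrrClass X × IrrClass X) fun t => C.space t.1 t.2.1 t.2.2

open Classical in
/-- The inclusion of a summand. -/
noncomputable def incl (a₁ a₂ a₃ : IrrClass X) : C.space a₁ a₂ a₃ →ₗ[ℂ] C.total :=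
  DirectSum.lof ℂ (IrrClass X × IrrClass X × IrrClass X)
    (fun t => C.space t.1 t.2.1 t.2.2) (a₁, a₂, a₃)

/-- `𝒵 = σ₁₂(𝒴) = e^{πi Δ(𝒴)} Ω_{-1}(𝒴)`, where `Δ(𝒴) = h_{a₃} - h_{a₁} - h_{a₂}`. -/
def IsSigma₁₂ {a₁ a₂ a₃ : IrrClass X} (𝒴 : C.space a₁ a₂ a₃) (𝒵 : C.space a₂ a₁ a₃) : Prop :=
  ∀ (n : ℂ) (w₂ : (C.W a₂).toWeakModule) (w₁ : (C.W a₁).toWeakModule),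
    𝒵.1 n w₂ w₁
      = Complex.exp (Real.pi * Complex.I * (C.h a₃ - C.h a₁ - C.h a₂)) • skewOp (-1) 𝒴.1 n w₂ w₁

/-- `𝒵 = σ₂₃(𝒴) = e^{πi h_{a₁}} A_{-1}(𝒴)`. Here `w₃' ∈ W^{a₃'}` is read as the functional
`⟨·, w₃'⟩_{a₃'}` on `W^{a₃}`, and vectors of `W^{a₂'}` are read as functionals on `W^{a₂}`. -/
def IsSigma₂₃ {a₁ a₂ a₃ : IrrClass X} (𝒴 : C.space a₁ a₂ a₃)
    (𝒵 : C.space a₁ (C.dual a₃) (C.dual a₂)) : Prop :=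
  ∀ (μ : ℂ), ∀ w₁ ∈ (C.W a₁).weight μ, ∀ (n : ℂ) (w₃' : (C.W (C.dual a₃)).toWeakModule),
    C.pairing a₂ (C.dual a₂) rfl (𝒵.1 n w₁ w₃')
      = Complex.exp (Real.pi * Complex.I * C.h a₁) •
          contragredientOp (-1) 𝒴.1 μ n w₁
            ((C.pairing (C.dual a₃) a₃ (C.dual_dual a₃)).flip w₃')

end Representatives

/-! An intertwining operator `𝒴` of type (W^{a₃}; W^{a₁} W^{a₂}) is encoded by the trilinear form
F(w₁, w₂, w₃) = ⟨𝒴(w₁, 1) w₂, w₃⟩, where w₃ runs over W^{b₃} with b₃' = a₃. On homogeneous vectors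
only one coefficient of `𝒴` can pair nontrivially with w₃, so F determines `𝒴` (`IsForm.eq`).

On each irreducible module put s = e^{πi(L(0) - h)}, h the lowest weight, and E = e^{L(1)}. All
weights lie in h + ℤ, hence s² = 1. Since L(1) lowers weights by one, s L(1) s = -L(1), hence (sE)²
= (Es)² = 1. In terms of forms the two maps become substitutions: σ₁₂: G(w₂, w₁, w₃) = F(s w₁, s w₂,
sE w₃) (`IsForm.skew`), σ₂₃: G(w₁, w₃, w₂) = F(Es w₁, w₂, w₃) (`IsForm.transpose`). The first uses
that L(1) is adjoint to L(-1) and that contragredient modules have the same lowest weight. The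
normalizing factors e^{πiΔ} and e^{πi h} are what turns the remaining phases into s. The involution
and braid relations are then formal consequences of the identities for s and E. Because w₃ always
sits in the second slot of the pairing of W^{b₃'} with W^{b₃}, no symmetry of the pairings enters.

The main work is that both maps produce intertwining operators. For σ₁₂
(`IsIntertwining.skew_jacobi`) and for the opposite operators behind σ₂₃
(`IsIntertwining.opposite_jacobi`) one moves e^{xL(-1)}, respectively e^{xL(1)}, past a mode of v by
the conjugation formula `divPow_mul_eq_sum`; the resulting binomial sums collapse by
`sum_antidiagonal_cchoose`. Transposing the opposite operators gives functionals in the graded dual,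
which the pairing identifies with the contragredient module (`exists_transpose`).

Representatives exist because the graded dual of an irreducible module, with transposed opposite
vertex operators, is again irreducible, and finite-dimensional weight spaces make the double dual
isomorphic to the original module (`exists_representatives`). Uniqueness of the representation holds
because the two transpositions generate S₃ and the defining formulas determine their actions on
every summand. -/

open Finset

/-! ### Finitely supported sums over ℕ and their regrouping. -/

section FinsumAux

variable {M : Type*} [AddCommGroup M]

theorem finsum_eq_sum_range {f : ℕ → M} {B : ℕ} (h : ∀ i, B ≤ i → f i = 0) :
    ∑ᶠ i, f i = ∑ i ∈ range B, f i := by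
  refine finsum_eq_finsetSum_of_support_subset f fun i hi => ?_
  rw [mem_coe, mem_range]
  by_contra hlt
  exact hi (h i (not_lt.mp hlt))

theorem finite_support_of_eventually_zero {f : ℕ → M} {B : ℕ} (h : ∀ i, B ≤ i → f i = 0) :
    f.HasFiniteSupport := by
  refine (Set.finite_lt_nat B).subset fun i hi => ?_
  by_contra hlt
  exact hi (h i (not_lt.mp hlt))

theorem finsum_finsum_eq_sum_range {f : ℕ → ℕ → M} {B : ℕ}
    (h : ∀ i j, B ≤ i ∨ B ≤ j → f i j = 0) :
    ∑ᶠ i, ∑ᶠ j, f i j = ∑ i ∈ range B, ∑ j ∈ range B, f i j := by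
  have h₁ : ∀ i, ∑ᶠ j, f i j = ∑ j ∈ range B, f i j := fun i =>
    finsum_eq_sum_range fun j hj => h i j (Or.inr hj)
  simp_rw [h₁]
  exact finsum_eq_sum_range fun i hi => sum_eq_zero fun j _ => h i j (Or.inl hi)

theorem finsum_finsum_comm {f : ℕ → ℕ → M} {B : ℕ}
    (h : ∀ i j, B ≤ i ∨ B ≤ j → f i j = 0) :
    ∑ᶠ i, ∑ᶠ j, f i j = ∑ᶠ j, ∑ᶠ i, f i j := by
  rw [finsum_finsum_eq_sum_range h, sum_comm,
    finsum_finsum_eq_sum_range (f := fun j i => f i j) (B := B) fun j i hji => h i j hji.symm]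

theorem finsum_finsum_antidiagonal {f : ℕ → ℕ → M} {B : ℕ}
    (h : ∀ i j, B ≤ i + j → f i j = 0) :
    ∑ᶠ i, ∑ᶠ j, f i j = ∑ᶠ N, ∑ p ∈ antidiagonal N, f p.1 p.2 := by
  rw [finsum_finsum_eq_sum_range (B := B) fun i j hij => h i j (by omega),
    finsum_eq_sum_range (B := B) fun N hN => sum_eq_zero fun p hp => h _ _ (by
      rw [HasAntidiagonal.mem_antidiagonal] at hp; omega),
    ← sum_product', sum_sigma']
  symm
  refine sum_of_injOn (fun x : (_ : ℕ) × (ℕ × ℕ) => x.2) ?_ ?_ ?_ ?_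
  · rintro ⟨N, p⟩ hp ⟨N', p'⟩ hp' heq
    simp only [coe_sigma, Set.mem_sigma_iff, mem_coe, HasAntidiagonal.mem_antidiagonal]
      at hp hp' heq
    subst heq
    obtain rfl : N = N' := by omega
    rfl
  · rintro ⟨N, p⟩ hp
    simp only [coe_sigma, Set.mem_sigma_iff, mem_coe, HasAntidiagonal.mem_antidiagonal,
      mem_range] at hp
    simp only [mem_coe, mem_product, mem_range]
    omega
  · rintro ⟨i, j⟩ _ hn
    refine h i j (not_lt.mp fun hlt => hn ⟨⟨i + j, i, j⟩, ?_, rfl⟩)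
    simp [hlt]
  · rintro ⟨N, p⟩ _
    rfl

theorem sum_range_sum_range_antidiagonal {f : ℕ → ℕ → M} {B : ℕ}
    (h : ∀ i j, B ≤ i + j → f i j = 0) :
    ∑ i ∈ range B, ∑ j ∈ range B, f i j = ∑ N ∈ range B, ∑ p ∈ antidiagonal N, f p.1 p.2 := by
  rw [← finsum_finsum_eq_sum_range (B := B) fun i j hij => h i j (by omega),
    finsum_finsum_antidiagonal h,
    finsum_eq_sum_range (B := B) fun N hN => sum_eq_zero fun p hp => h _ _ (by
      rw [HasAntidiagonal.mem_antidiagonal] at hp; omega)]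

/-- Truncation bounds depend on the vectors involved. When an outer index takes finitely many
relevant values, the maximum of the individual bounds serves all of them. -/
theorem exists_forall_lt_bound {P : ℕ → ℕ → Prop} (h : ∀ i, ∃ B, ∀ k, B ≤ k → P i k) (I : ℕ) :
    ∃ B, ∀ i, i < I → ∀ k, B ≤ k → P i k := by
  choose b hb using h
  refine ⟨(range I).sup b, fun i hi k hk => hb i k ?_⟩
  exact (le_sup (f := b) (mem_range.mpr hi)).trans hk

end FinsumAux

/-! ### Binomial identities. -/

/-- The generalized binomial coefficient of an integer, as a complex number. -/
noncomputable def cchoose (m : ℤ) (i : ℕ) : ℂ := ((Ring.choose m i : ℤ) : ℂ)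

theorem cchoose_zero_right (m : ℤ) : cchoose m 0 = 1 := by simp [cchoose]

theorem cchoose_zero_succ (i : ℕ) : cchoose 0 (i + 1) = 0 := by
  simp [cchoose, Ring.choose_zero_succ]

theorem cchoose_succ_succ (m : ℤ) (i : ℕ) :
    cchoose (m + 1) (i + 1) = cchoose m i + cchoose m (i + 1) := by
  simp [cchoose, Ring.choose_succ_succ]

theorem succ_mul_cchoose_succ (m : ℤ) (i : ℕ) :
    ((i : ℂ) + 1) * cchoose m (i + 1) = ((m : ℂ) - i) * cchoose m i := by
  have h := Ring.choose_smul_choose m (Nat.le_succ i)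
  have h₁ : Nat.succ i - i = 1 := by omega
  rw [h₁, Ring.choose_one_right, Nat.choose_succ_self_right, nsmul_eq_mul] at h
  have h₂ := congrArg (Int.cast : ℤ → ℂ) h
  push_cast at h₂
  rw [cchoose, cchoose, h₂]
  ring

/-- On i + j = N, upper negation turns C(X - i, j) into (-1)^j C(N - 1 - X, j), whose upper entry no
longer depends on i. Vandermonde sums the products, and a second upper negation removes the sign
(-1)^N. -/
theorem sum_antidiagonal_cchoose (m X : ℤ) (N : ℕ) :
    ∑ p ∈ antidiagonal N, (-1) ^ p.1 * cchoose m p.1 * cchoose (X - p.1) p.2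
      = cchoose (X - m) N := by
  have h : ∀ p ∈ antidiagonal N, (-1 : ℂ) ^ p.1 * cchoose m p.1 * cchoose (X - p.1) p.2
      = (-1) ^ N * (((Ring.choose m p.1 * Ring.choose (N - 1 - X : ℤ) p.2 : ℤ)) : ℂ) := by
    intro p hp
    rw [HasAntidiagonal.mem_antidiagonal] at hp
    have h₁ := Ring.choose_neg (-(X - p.1) : ℤ) p.2
    rw [neg_neg] at h₁
    have h₂ : (-(X - p.1) + p.2 - 1 : ℤ) = N - 1 - X := by rw [← hp]; push_cast; ring
    rw [h₂] at h₁
    rw [cchoose, cchoose, h₁, ← hp, pow_add]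
    simp only [Units.smul_def, smul_eq_mul, Int.coe_negOnePow_natCast]
    push_cast
    ring
  rw [sum_congr rfl h, ← mul_sum, ← Int.cast_sum, ← Ring.add_choose_eq N (Commute.all _ _)]
  have h₁ := Ring.choose_neg (-(X - m) : ℤ) N
  rw [neg_neg] at h₁
  rw [cchoose, h₁, show (-(X - m) + N - 1 : ℤ) = m + (N - 1 - X) by ring]
  simp only [Units.smul_def, smul_eq_mul, Int.coe_negOnePow_natCast]
  push_cast
  ring

/-- The product rule for generating functions, coefficientwise: on the antidiagonal n + 1 the factor
n + 1 splits as p.1 + p.2, and each half is shifted by one. It drives the recursions for divided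
powers. -/
theorem sum_antidiagonal_leibniz {E : Type*} [AddCommGroup E] [Module ℂ E] (f : ℕ → ℕ → E)
    (n : ℕ) :
    ((n : ℂ) + 1) • ∑ p ∈ antidiagonal (n + 1), f p.1 p.2
      = ∑ p ∈ antidiagonal n,
        (((p.1 : ℂ) + 1) • f (p.1 + 1) p.2 + ((p.2 : ℂ) + 1) • f p.1 (p.2 + 1)) := by
  have h : ((n : ℂ) + 1) • ∑ p ∈ antidiagonal (n + 1), f p.1 p.2
      = ∑ p ∈ antidiagonal (n + 1), (p.1 : ℂ) • f p.1 p.2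
        + ∑ p ∈ antidiagonal (n + 1), (p.2 : ℂ) • f p.1 p.2 := by
    rw [smul_sum, ← sum_add_distrib]
    refine sum_congr rfl fun p hp => ?_
    rw [HasAntidiagonal.mem_antidiagonal] at hp
    rw [← add_smul]
    congr 1
    exact_mod_cast hp.symm
  rw [h, Nat.sum_antidiagonal_succ (f := fun p : ℕ × ℕ => (p.1 : ℂ) • f p.1 p.2),
    Nat.sum_antidiagonal_succ' (f := fun p : ℕ × ℕ => (p.2 : ℂ) • f p.1 p.2), sum_add_distrib]
  simp

/-! ### Divided powers and conjugation by exponentials. -/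

/-- The divided power `a ^ k / k!`. -/
noncomputable def divPow {M : Type*} [AddCommGroup M] [Module ℂ M] (a : Module.End ℂ M) (k : ℕ) :
    Module.End ℂ M := (k.factorial : ℂ)⁻¹ • a ^ k

section DivPow

variable {M : Type*} [AddCommGroup M] [Module ℂ M]

theorem divPow_zero (a : Module.End ℂ M) : divPow a 0 = 1 := by simp [divPow]

theorem divPow_one (a : Module.End ℂ M) : divPow a 1 = a := by simp [divPow]

theorem divPow_apply (a : Module.End ℂ M) (k : ℕ) (w : M) :
    divPow a k w = (k.factorial : ℂ)⁻¹ • (a ^ k) w := rfl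

theorem succ_smul_divPow_succ (a : Module.End ℂ M) (k : ℕ) :
    ((k : ℂ) + 1) • divPow a (k + 1) = divPow a k * a := by
  rw [divPow, divPow, smul_smul, pow_succ, smul_mul_assoc, Nat.factorial_succ]
  congr 1
  have : ((k : ℂ) + 1) ≠ 0 := Nat.cast_add_one_ne_zero k
  push_cast
  rw [mul_inv, mul_inv_cancel_left₀ this]

theorem succ_smul_divPow_succ' (a : Module.End ℂ M) (k : ℕ) :
    ((k : ℂ) + 1) • divPow a (k + 1) = a * divPow a k := by
  rw [succ_smul_divPow_succ, divPow, smul_mul_assoc, mul_smul_comm, ← pow_succ, ← pow_succ']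

theorem divPow_mul (a : Module.End ℂ M) (j k : ℕ) :
    divPow a j * divPow a k = ((j + k).choose j : ℂ) • divPow a (j + k) := by
  rw [divPow, divPow, divPow, smul_mul_smul_comm, ← pow_add, smul_smul]
  congr 1
  have h : ((j + k).choose j : ℂ) * (j.factorial * k.factorial) = (j + k).factorial := by
    have h₀ := Nat.choose_mul_factorial_mul_factorial (Nat.le_add_right j k)
    rw [Nat.add_sub_cancel_left] at h₀
    rw [← mul_assoc]
    exact_mod_cast h₀
  have h₁ : ((j + k).factorial : ℂ) ≠ 0 := by exact_mod_cast Nat.factorial_ne_zero _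
  have h₂ : (j.factorial : ℂ) ≠ 0 := by exact_mod_cast Nat.factorial_ne_zero _
  have h₃ : (k.factorial : ℂ) ≠ 0 := by exact_mod_cast Nat.factorial_ne_zero _
  field_simp
  rw [← h]
  ring

/-- The hypothesis says that b_r = ad(a)^r(b₀)/r!, so this is the coefficient of x^p in e^{xa} b₀ =
(e^{xa} b₀ e^{-xa}) e^{xa}. It is applied to a = L(-1) and a = L(1), with b₀ a mode of a vector of
V. -/
theorem divPow_mul_eq_sum (a : Module.End ℂ M) (b : ℕ → Module.End ℂ M)
    (hb : ∀ r : ℕ, ((r : ℂ) + 1) • b (r + 1) = a * b r - b r * a) (p : ℕ) :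
    divPow a p * b 0 = ∑ q ∈ antidiagonal p, b q.1 * divPow a q.2 := by
  induction p with
  | zero => simp [divPow_zero]
  | succ p ih =>
    have hp : ((p : ℂ) + 1) ≠ 0 := Nat.cast_add_one_ne_zero p
    refine (smul_right_injective _ hp) ?_
    change ((p : ℂ) + 1) • _ = ((p : ℂ) + 1) • _
    rw [← smul_mul_assoc, succ_smul_divPow_succ', mul_assoc, ih,
      sum_antidiagonal_leibniz fun r j => b r * divPow a j, mul_sum]
    refine sum_congr rfl fun q _ => ?_
    rw [← smul_mul_assoc, hb, ← mul_smul_comm, succ_smul_divPow_succ']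
    noncomm_ring

/-- `∑_{j+k=N} (-1)^j a^j/j! a^k/k! = 0` unless `N = 0`. -/
theorem sum_antidiagonal_neg_one_pow_divPow (a : Module.End ℂ M) (N : ℕ) :
    ∑ p ∈ antidiagonal N, (-1 : ℂ) ^ p.1 • (divPow a p.1 * divPow a p.2)
      = if N = 0 then 1 else 0 := by
  have h : ∀ p ∈ antidiagonal N, (-1 : ℂ) ^ p.1 • (divPow a p.1 * divPow a p.2)
      = (((-1 : ℤ) ^ p.1 * N.choose p.1 : ℤ) : ℂ) • divPow a N := by
    intro p hp
    rw [HasAntidiagonal.mem_antidiagonal] at hp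
    rw [divPow_mul, smul_smul, hp]
    push_cast
    rfl
  rw [sum_congr rfl h, ← sum_smul, ← Int.cast_sum,
    Nat.sum_antidiagonal_eq_sum_range_succ (f := fun i _ => (-1 : ℤ) ^ i * (N.choose i : ℤ)),
    Int.alternating_sum_range_choose]
  split_ifs with hN
  · subst hN; simp [divPow_zero]
  · simp

end DivPow

/-! ### Consequences of the Jacobi identity: commutators, weights, local nilpotency of L(1). -/

section Basics

variable {V : Type u} [AddCommGroup V] [Module ℂ V] {X : VOA V}

theorem IsIntertwining.exists_bound {M₁ M₂ M₃ : WeakModule X} {𝒴 : ℂ → M₁ →ₗ[ℂ] M₂ →ₗ[ℂ] M₃}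
    (h : IsIntertwining M₁ M₂ M₃ 𝒴) (n : ℂ) (w₁ : M₁) (w₂ : M₂) :
    ∃ B : ℕ, ∀ i : ℕ, B ≤ i → 𝒴 (n + i) w₁ w₂ = 0 := by
  obtain ⟨N, hN⟩ := h.truncation w₁ w₂
  obtain ⟨p, hp⟩ := exists_nat_ge (N - n.re)
  refine ⟨p, fun i hi => hN _ ?_⟩
  have : (p : ℝ) ≤ i := by exact_mod_cast hi
  simp only [Complex.add_re, Complex.natCast_re]
  linarith

theorem WeakModule.exists_bound (M : WeakModule X) (l : ℤ) (v : V) (w : M) :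
    ∃ B : ℕ, ∀ i : ℕ, B ≤ i → M.mode (l + i) v w = 0 := by
  obtain ⟨N, hN⟩ := M.truncation v w
  exact ⟨(N - l).toNat, fun i hi => hN _ (by omega)⟩

/-- Each half of the left side is finitely supported, the first by truncation of `𝒴` and the second
by truncation of the action on `M₂`, so the sum of differences may be split. The three sums can then
be transformed separately. -/
theorem IsIntertwining.jacobi_complex {M₁ M₂ M₃ : WeakModule X}
    {𝒴 : ℂ → M₁ →ₗ[ℂ] M₂ →ₗ[ℂ] M₃} (h : IsIntertwining M₁ M₂ M₃ 𝒴)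
    (v : V) (w₁ : M₁) (w₂ : M₂) (l m : ℤ) (n : ℂ) :
    (∑ᶠ i : ℕ, ((-1) ^ i * cchoose l i) • M₃.mode (m + l - i) v (𝒴 (n + i) w₁ w₂))
      - ((l.negOnePow : ℤ) : ℂ) •
        (∑ᶠ i : ℕ, ((-1) ^ i * cchoose l i) • 𝒴 (n + l - i) w₁ (M₂.mode (m + i) v w₂))
      = ∑ᶠ i : ℕ, cchoose m i • 𝒴 (m + n - i) (M₁.mode (l + i) v w₁) w₂ := by
  have hJ := h.jacobi v w₁ w₂ l m n
  obtain ⟨B₁, hB₁⟩ := h.exists_bound n w₁ w₂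
  obtain ⟨B₂, hB₂⟩ := M₂.exists_bound m v w₂
  rw [smul_finsum, ← finsum_sub_distrib
    (finite_support_of_eventually_zero (B := B₁) fun i hi => by simp [hB₁ i hi])
    (finite_support_of_eventually_zero (B := B₂) fun i hi => by simp [hB₂ i hi])]
  refine (finsum_congr fun i => ?_).trans (hJ.trans (finsum_congr fun i => ?_))
  · rw [smul_comm, ← smul_sub, ← Int.cast_smul_eq_zsmul ℂ,
      ← Int.cast_smul_eq_zsmul ℂ (l.negOnePow : ℤ), cchoose]
    push_cast
    rfl
  · rw [← Int.cast_smul_eq_zsmul ℂ]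
    rfl

/-- The case l = 0: only the term i = 0 survives on the left. -/
theorem IsIntertwining.commutator {M₁ M₂ M₃ : WeakModule X}
    {𝒴 : ℂ → M₁ →ₗ[ℂ] M₂ →ₗ[ℂ] M₃} (h : IsIntertwining M₁ M₂ M₃ 𝒴)
    (v : V) (w₁ : M₁) (w₂ : M₂) (m : ℤ) (n : ℂ) :
    M₃.mode m v (𝒴 n w₁ w₂) - 𝒴 n w₁ (M₂.mode m v w₂)
      = ∑ᶠ i : ℕ, cchoose m i • 𝒴 (m + n - i) (M₁.mode i v w₁) w₂ := by
  have hJ := h.jacobi_complex v w₁ w₂ 0 m n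
  have hz : ∀ i : ℕ, 1 ≤ i → cchoose 0 i = 0 := fun i hi => by
    obtain ⟨j, rfl⟩ := Nat.exists_eq_add_of_le' hi
    exact cchoose_zero_succ j
  rw [finsum_eq_sum_range (B := 1) (fun i hi => by simp [hz i hi]),
    finsum_eq_sum_range (B := 1) (fun i hi => by simp [hz i hi])] at hJ
  simpa [cchoose_zero_right] using hJ

open Classical in
/-- The vertex operator of a weak module with its coefficients indexed by `ℂ`. -/
noncomputable def WeakModule.extMode (M : WeakModule X) (n : ℂ) : V →ₗ[ℂ] M →ₗ[ℂ] M :=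
  if h : ∃ m : ℤ, (m : ℂ) = n then M.mode h.choose else 0

theorem WeakModule.extMode_intCast (M : WeakModule X) (m : ℤ) : M.extMode m = M.mode m := by
  have h : ∃ m' : ℤ, (m' : ℂ) = m := ⟨m, rfl⟩
  rw [WeakModule.extMode, dif_pos h, Int.cast_injective h.choose_spec]

theorem WeakModule.extMode_of_eq (M : WeakModule X) {n : ℂ} {m : ℤ} (h : n = m) :
    M.extMode n = M.mode m := by rw [h, M.extMode_intCast]

theorem WeakModule.extMode_of_ne (M : WeakModule X) {n : ℂ} (h : ∀ m : ℤ, (m : ℂ) ≠ n) :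
    M.extMode n = 0 := by
  rw [WeakModule.extMode, dif_neg (by rintro ⟨m, hm⟩; exact h m hm)]

theorem WeakModule.truncation_extMode (M : WeakModule X) (v : V) (w : M) :
    ∃ N : ℝ, ∀ n : ℂ, N ≤ n.re → M.extMode n v w = 0 := by
  obtain ⟨N, hN⟩ := M.truncation v w
  refine ⟨N, fun n hn => ?_⟩
  by_cases h : ∃ m : ℤ, (m : ℂ) = n
  · obtain ⟨m, rfl⟩ := h
    rw [M.extMode_intCast]
    refine hN m ?_
    simpa using hn
  · push Not at h
    rw [M.extMode_of_ne h]
    rfl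

/-- All indices occurring in one instance of the identity differ from n by integers. Hence either
all of them are integers, and the module axiom applies, or every term is zero. -/
theorem WeakModule.jacobi_extMode (M : WeakModule X) :
    JacobiIdentity X.Y M.mode M.mode M.extMode := by
  intro v w₁ w₂ l m n
  by_cases h : ∃ n' : ℤ, (n' : ℂ) = n
  · obtain ⟨n, rfl⟩ := h
    have hJ := M.jacobi v w₁ w₂ l m n
    simp only [Int.cast_id] at hJ
    refine (finsum_congr fun i => ?_).trans (hJ.trans (finsum_congr fun i => ?_))
    · rw [M.extMode_of_eq (m := n + i) (by push_cast; ring),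
        M.extMode_of_eq (m := n + l - i) (by push_cast; ring)]
    · rw [M.extMode_of_eq (m := m + n - i) (by push_cast; ring)]
  · have hne : ∀ p q : ℤ, n + q ≠ p := by
      intro p q hpq
      exact h ⟨p - q, by push_cast; rw [← hpq]; ring⟩
    have h₀ : ∀ (n' : ℂ) (q : ℤ), n' = n + q → M.extMode n' = 0 := fun n' q hq =>
      M.extMode_of_ne fun p hp => hne p q (by rw [← hq, hp])
    rw [finsum_eq_zero_of_forall_eq_zero fun i => ?_,
      finsum_eq_zero_of_forall_eq_zero fun i => ?_]
    · rw [h₀ _ (m - i) (by push_cast; ring)]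
      simp
    · rw [h₀ _ i (by push_cast; ring), h₀ _ (l - i) (by push_cast; ring)]
      simp

theorem WeakModule.derivative_extMode (M : WeakModule X) (n : ℂ) (v : V) (w : M) :
    M.extMode n (X.Y 0 X.conformal v) w = -n • M.extMode (n - 1) v w := by
  by_cases h : ∃ m : ℤ, (m : ℂ) = n
  · obtain ⟨m, rfl⟩ := h
    rw [M.extMode_intCast, M.extMode_of_eq (m := m - 1) (by push_cast; ring), M.derivative]
  · push Not at h
    rw [M.extMode_of_ne h, M.extMode_of_ne (n := n - 1) fun m hm =>
      h (m + 1) (by push_cast; rw [hm]; ring)]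
    simp

/-- This makes the vertex operator of a module an intertwining operator of type (M; V M), so that
facts about commutators, weights and opposite operators need to be proved only once. -/
theorem WeakModule.isIntertwining_extMode (M : WeakModule X) :
    IsIntertwining X.adjoint M M M.extMode where
  truncation := M.truncation_extMode
  jacobi := M.jacobi_extMode
  derivative := M.derivative_extMode

/-- `L(1) ω = 0`. -/
theorem VOA.L_one_conformal (X : VOA V) : X.Y 2 X.conformal X.conformal = 0 := by
  -- Evaluate [L(1), L(-2)] = 3 L(-1) on the vacuum: L(-2)𝟏 = ω, while L(1) and L(-1) kill 𝟏, and
  -- the central term is absent.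
  have h := X.virasoro 1 (-2) X.vacuum
  norm_num at h
  rw [X.creation, X.creation_nonneg _ 2 (by norm_num), X.creation_nonneg _ 0 (by norm_num)] at h
  simpa using h

theorem WeakModule.L_neg_one_eq (M : WeakModule X) : M.L (-1) = M.mode 0 X.conformal := rfl

theorem WeakModule.L_zero_eq (M : WeakModule X) : M.L 0 = M.mode 1 X.conformal := rfl

theorem WeakModule.L_one_eq (M : WeakModule X) : M.L 1 = M.mode 2 X.conformal := rfl

theorem WeakModule.mem_weight {M : WeakModule X} {μ : ℂ} {w : M} :
    w ∈ M.weight μ ↔ M.L 0 w = μ • w := Module.End.mem_eigenspace_iff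

theorem VOA.mem_weight {d : ℤ} {v : V} :
    v ∈ X.weight d ↔ X.Y 1 X.conformal v = (d : ℂ) • v := Module.End.mem_eigenspace_iff

section Commutators

variable {M₁ M₂ M₃ : WeakModule X} {𝒴 : ℂ → M₁ →ₗ[ℂ] M₂ →ₗ[ℂ] M₃}

theorem cchoose_natCast (m i : ℕ) : cchoose (m : ℤ) i = m.choose i := by
  rw [cchoose, Ring.choose_natCast]
  simp

theorem IsIntertwining.commutator_nat (h : IsIntertwining M₁ M₂ M₃ 𝒴)
    (v : V) (w₁ : M₁) (w₂ : M₂) (m : ℕ) (n : ℂ) :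
    M₃.mode m v (𝒴 n w₁ w₂) - 𝒴 n w₁ (M₂.mode m v w₂)
      = ∑ i ∈ range (m + 1), (m.choose i : ℂ) • 𝒴 (m + n - i) (M₁.mode i v w₁) w₂ := by
  rw [h.commutator, finsum_eq_sum_range (B := m + 1)]
  · simp [cchoose_natCast]
  · intro i hi
    rw [cchoose_natCast, Nat.choose_eq_zero_of_lt (by omega)]
    simp

/-- `[L(-1), 𝒴(w₁, x)] = d/dx 𝒴(w₁, x)`. -/
theorem IsIntertwining.L_neg_one_commutator (h : IsIntertwining M₁ M₂ M₃ 𝒴)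
    (w₁ : M₁) (w₂ : M₂) (n : ℂ) :
    𝒴 n w₁ (M₂.L (-1) w₂) = M₃.L (-1) (𝒴 n w₁ w₂) + n • 𝒴 (n - 1) w₁ w₂ := by
  have hc := h.commutator_nat X.conformal w₁ w₂ 0 n
  have hd := h.derivative n w₁ w₂
  rw [M₁.L_neg_one_eq] at hd
  simp [hd] at hc
  rw [M₂.L_neg_one_eq, M₃.L_neg_one_eq]
  rw [sub_eq_iff_eq_add] at hc
  rw [hc]
  abel

/-- Homogeneity of the coefficients of an intertwining operator. -/
theorem IsIntertwining.mem_weight (h : IsIntertwining M₁ M₂ M₃ 𝒴) {μ ν : ℂ}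
    {w₁ : M₁} {w₂ : M₂} (h₁ : w₁ ∈ M₁.weight μ) (h₂ : w₂ ∈ M₂.weight ν) (n : ℂ) :
    𝒴 n w₁ w₂ ∈ M₃.weight (μ + ν - n - 1) := by
  rw [WeakModule.mem_weight] at *
  have hc := h.commutator_nat X.conformal w₁ w₂ 1 n
  have hd := h.derivative (1 + n) w₁ w₂
  rw [M₁.L_neg_one_eq] at hd
  rw [WeakModule.L_zero_eq] at *
  simp [sum_range_succ, hd, h₁, h₂] at hc
  rw [sub_eq_iff_eq_add] at hc
  rw [hc, ← add_smul, ← add_smul]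
  congr 1
  ring

end Commutators

theorem WeakModule.mode_mem_weight (M : WeakModule X) {d : ℤ} {v : V} (hv : v ∈ X.weight d)
    {μ : ℂ} {w : M} (hw : w ∈ M.weight μ) (n : ℤ) :
    M.mode n v w ∈ M.weight (d + μ - n - 1) := by
  have h := M.isIntertwining_extMode.mem_weight (w₁ := v) (μ := d) hv hw n
  rwa [M.extMode_intCast] at h

theorem VOA.conformal_mem_weight (X : VOA V) : X.conformal ∈ X.weight 2 := by
  have h := X.conformal_mem
  rw [Module.End.mem_eigenspace_iff] at h
  rw [VOA.mem_weight, h]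
  norm_num

theorem WeakModule.L_one_mem_weight (M : WeakModule X) {μ : ℂ} {w : M} (hw : w ∈ M.weight μ) :
    M.L 1 w ∈ M.weight (μ - 1) := by
  have h := M.mode_mem_weight X.conformal_mem_weight hw 2
  rw [M.L_one_eq]
  convert h using 2
  push_cast
  ring

theorem WeakModule.L_neg_one_mem_weight (M : WeakModule X) {μ : ℂ} {w : M}
    (hw : w ∈ M.weight μ) : M.L (-1) w ∈ M.weight (μ + 1) := by
  have h := M.mode_mem_weight X.conformal_mem_weight hw 0
  rw [M.L_neg_one_eq]
  convert h using 2
  push_cast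
  ring

theorem WeakModule.L_one_pow_mem_weight (M : WeakModule X) {μ : ℂ} {w : M}
    (hw : w ∈ M.weight μ) (k : ℕ) : (M.L 1 ^ k) w ∈ M.weight (μ - k) := by
  induction k with
  | zero => simpa using hw
  | succ k ih =>
    rw [pow_succ', Module.End.mul_apply]
    have h := M.L_one_mem_weight ih
    rwa [show μ - (k : ℂ) - 1 = μ - ((k + 1 : ℕ) : ℂ) by push_cast; ring] at h

theorem VOA.L_one_pow_mem_weight (X : VOA V) {d : ℤ} {v : V} (hv : v ∈ X.weight d) (k : ℕ) :
    (X.Y 2 X.conformal ^ k) v ∈ X.weight (d - k) := by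
  have h := X.adjoint.L_one_pow_mem_weight (μ := d) (w := v) hv k
  rw [WeakModule.mem_weight] at h
  rw [VOA.mem_weight]
  push_cast
  exact h

/-- `[L(1), v_n] = (L(1)v)_n + (2 wt v - n - 2) v_{n+1}`. -/
theorem WeakModule.L_one_commutator (M : WeakModule X) {d : ℤ} {v : V} (hv : v ∈ X.weight d)
    (n : ℤ) (w : M) :
    M.L 1 (M.mode n v w) - M.mode n v (M.L 1 w)
      = M.mode n (X.Y 2 X.conformal v) w + (2 * d - n - 2 : ℂ) • M.mode (n + 1) v w := by
  have h : M.mode (2 : ℕ) X.conformal (M.extMode n v w)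
        - M.extMode n v (M.mode (2 : ℕ) X.conformal w)
      = ∑ i ∈ range (2 + 1), ((2 : ℕ).choose i : ℂ) •
        M.extMode ((2 : ℕ) + n - i) (X.Y i X.conformal v) w :=
    M.isIntertwining_extMode.commutator_nat X.conformal v w 2 n
  rw [VOA.mem_weight] at hv
  have h0 := M.derivative v w (n + 2)
  have e0 : M.extMode ((2 : ℂ) + n) = M.mode (n + 2) := M.extMode_of_eq (by push_cast; ring)
  have e1 : M.extMode ((2 : ℂ) + n - 1) = M.mode (n + 1) := M.extMode_of_eq (by push_cast; ring)
  simp [sum_range_succ, e0, e1, M.extMode_intCast, hv, h0] at h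
  rw [M.L_one_eq, h, show n + 2 - 1 = n + 1 by ring, smul_smul, ← add_smul, add_comm]
  congr 2
  ring

/-- `[L(-1), v_n] = -n v_{n-1}`. -/
theorem WeakModule.L_neg_one_commutator (M : WeakModule X) (v : V) (n : ℤ) (w : M) :
    M.L (-1) (M.mode n v w) - M.mode n v (M.L (-1) w) = -(n : ℂ) • M.mode (n - 1) v w := by
  have h : M.extMode n v (M.L (-1) w)
      = M.L (-1) (M.extMode n v w) + (n : ℂ) • M.extMode (n - 1) v w :=
    M.isIntertwining_extMode.L_neg_one_commutator v w n
  rw [M.extMode_intCast, M.extMode_of_eq (m := n - 1) (by push_cast; ring)] at h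
  rw [h]
  simp

/-- `[L(1), L(-1)] = 2 L(0)`. -/
theorem WeakModule.L_one_L_neg_one (M : WeakModule X) (w : M) :
    M.L 1 (M.L (-1) w) = M.L (-1) (M.L 1 w) + (2 : ℂ) • M.L 0 w := by
  have h := M.L_one_commutator X.conformal_mem_weight 0 w
  rw [X.L_one_conformal] at h
  simp only [map_zero, LinearMap.zero_apply, zero_add] at h
  rw [M.L_neg_one_eq, sub_eq_iff_eq_add'.mp h, M.L_zero_eq]
  norm_num

/-- A linear map on a graded module may be prescribed on the homogeneous subspaces. -/
theorem WeakModule.exists_linearMap (M : WeakModule X) (hM : ⨆ μ, M.weight μ = ⊤)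
    {E : Type*} [AddCommGroup E] [Module ℂ E] (D : ℂ → M →ₗ[ℂ] E) :
    ∃ f : M →ₗ[ℂ] E, ∀ μ, ∀ w ∈ M.weight μ, f w = D μ w := by
  classical
  have hI : DirectSum.IsInternal M.weight :=
    DirectSum.isInternal_submodule_of_iSupIndep_of_iSup_eq_top
      (Module.End.eigenspaces_iSupIndep _) hM
  let e := LinearEquiv.ofBijective (DirectSum.coeLinearMap M.weight) hI
  refine ⟨(DirectSum.toModule ℂ ℂ E fun μ => (D μ).comp (M.weight μ).subtype).comp
    e.symm.toLinearMap, fun μ w hw => ?_⟩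
  have h : e.symm w = DirectSum.lof ℂ ℂ (fun μ => M.weight μ) μ ⟨w, hw⟩ := by
    rw [LinearEquiv.symm_apply_eq]
    change _ = DirectSum.coeLinearMap M.weight _
    rw [DirectSum.coeLinearMap_lof]
  simp [h]

theorem WeakModule.induction_weight {M : WeakModule X} (hM : ⨆ μ, M.weight μ = ⊤)
    {p : M → Prop} (w : M) (h : ∀ μ, ∀ w ∈ M.weight μ, p w) (h0 : p 0)
    (hadd : ∀ x y, p x → p y → p (x + y)) : p w :=
  Submodule.iSup_induction M.weight (motive := p) (hM ▸ Submodule.mem_top) h h0 hadd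

theorem VOA.induction_weight (X : VOA V)
    {p : V → Prop} (v : V) (h : ∀ d : ℤ, ∀ v ∈ X.weight d, p v) (h0 : p 0)
    (hadd : ∀ x y, p x → p y → p (x + y)) : p v :=
  Submodule.iSup_induction X.weight (motive := p) (X.iSup_weight ▸ Submodule.mem_top) h h0 hadd

theorem VOA.adjoint_iSup_weight (X : VOA V) : ⨆ μ, X.adjoint.weight μ = ⊤ := by
  rw [eq_top_iff]
  refine X.iSup_weight.symm.le.trans (iSup_le fun n => ?_)
  exact le_iSup X.adjoint.weight (n : ℂ)

/-- `L(1)` acts locally nilpotently. -/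
def WeakModule.LOneNilpotent (M : WeakModule X) : Prop :=
  ∀ w : M, ∃ K : ℕ, ∀ k, K ≤ k → (M.L 1 ^ k) w = 0

theorem VOA.adjoint_LOneNilpotent (X : VOA V) : X.adjoint.LOneNilpotent := by
  intro v
  refine X.induction_weight
    (p := fun v => ∃ K : ℕ, ∀ k, K ≤ k → (X.Y 2 X.conformal ^ k) v = 0) v ?_ ?_ ?_
  · intro d v hv
    obtain ⟨N, hN⟩ := X.bounded_weight
    refine ⟨(d - N).toNat + 1, fun k hk => ?_⟩
    have h := X.L_one_pow_mem_weight hv k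
    have h₀ : X.weight (d - k) = ⊥ := hN _ (by omega)
    rw [h₀, Submodule.mem_bot] at h
    exact h
  · exact ⟨0, fun k _ => map_zero _⟩
  · rintro x y ⟨K, hK⟩ ⟨K', hK'⟩
    exact ⟨max K K', fun k hk => by
      rw [map_add, hK k (le_of_max_le_left hk), hK' k (le_of_max_le_right hk), add_zero]⟩

theorem WeakModule.LOneNilpotent_of_bounded {M : WeakModule X} (hM : ⨆ μ, M.weight μ = ⊤)
    (hb : ∃ N : ℝ, ∀ μ : ℂ, μ.re < N → M.weight μ = ⊥) : M.LOneNilpotent := by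
  intro w
  refine WeakModule.induction_weight hM
    (p := fun w => ∃ K : ℕ, ∀ k, K ≤ k → (M.L 1 ^ k) w = 0) w ?_ ?_ ?_
  · intro μ w hw
    obtain ⟨N, hN⟩ := hb
    obtain ⟨K, hK⟩ := exists_nat_gt (μ.re - N)
    refine ⟨K, fun k hk => ?_⟩
    have h := M.L_one_pow_mem_weight hw k
    have hk' : (K : ℝ) ≤ k := by exact_mod_cast hk
    rw [hN _ (by simp only [Complex.sub_re, Complex.natCast_re]; linarith),
      Submodule.mem_bot] at h
    exact h
  · exact ⟨0, fun k _ => map_zero _⟩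
  · rintro x y ⟨K, hK⟩ ⟨K', hK'⟩
    exact ⟨max K K', fun k hk => by
      rw [map_add, hK k (le_of_max_le_left hk), hK' k (le_of_max_le_right hk), add_zero]⟩

end Basics

/-! ### Sums over triples, and the phases of the skew operator. -/

theorem sum_antidiagonal_assoc {M : Type*} [AddCommMonoid M] (f : ℕ → ℕ → ℕ → M) (N : ℕ) :
    ∑ p ∈ antidiagonal N, ∑ q ∈ antidiagonal p.2, f p.1 q.1 q.2
      = ∑ p ∈ antidiagonal N, ∑ q ∈ antidiagonal p.1, f q.1 q.2 p.2 := by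
  rw [sum_sigma', sum_sigma']
  refine sum_nbij' (fun x => ⟨(x.1.1 + x.2.1, x.2.2), (x.1.1, x.2.1)⟩)
    (fun x => ⟨(x.2.1, x.2.2 + x.1.2), (x.2.2, x.1.2)⟩) ?_ ?_ ?_ ?_ ?_
  · rintro ⟨⟨a, b⟩, ⟨c, d⟩⟩ h
    simp only [mem_sigma, HasAntidiagonal.mem_antidiagonal] at h ⊢
    obtain ⟨h₁, h₂⟩ := h
    refine ⟨?_, trivial⟩
    omega
  · rintro ⟨⟨a, b⟩, ⟨c, d⟩⟩ h
    simp only [mem_sigma, HasAntidiagonal.mem_antidiagonal] at h ⊢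
    obtain ⟨h₁, h₂⟩ := h
    refine ⟨?_, trivial⟩
    omega
  · rintro ⟨⟨a, b⟩, ⟨c, d⟩⟩ h
    simp only [mem_sigma, HasAntidiagonal.mem_antidiagonal] at h
    obtain ⟨h₁, h₂⟩ := h
    subst h₂
    rfl
  · rintro ⟨⟨a, b⟩, ⟨c, d⟩⟩ h
    simp only [mem_sigma, HasAntidiagonal.mem_antidiagonal] at h
    obtain ⟨h₁, h₂⟩ := h
    subst h₂
    rfl
  · rintro ⟨⟨a, b⟩, ⟨c, d⟩⟩ _
    rfl

/-- `e^{πi(n+1)}`, the value of `(e^{-πi})^{-n-1}`. -/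
noncomputable def skewPhase (n : ℂ) : ℂ := Complex.exp (Real.pi * Complex.I * (n + 1))

theorem exp_pi_mul_I_mul_int (m : ℤ) :
    Complex.exp (Real.pi * Complex.I * m) = ((m.negOnePow : ℤ) : ℂ) := by
  rw [mul_comm, Complex.exp_int_mul, Complex.exp_pi_mul_I, Int.cast_negOnePow]

theorem negOnePow_natCast_complex (k : ℕ) : ((((k : ℤ).negOnePow : ℤˣ) : ℤ) : ℂ) = (-1) ^ k := by
  rw [Int.coe_negOnePow_natCast]
  push_cast
  rfl

theorem skewPhase_add_int (n : ℂ) (m : ℤ) :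
    skewPhase (n + m) = ((m.negOnePow : ℤ) : ℂ) * skewPhase n := by
  rw [skewPhase, skewPhase, ← exp_pi_mul_I_mul_int, ← Complex.exp_add]
  congr 1
  ring

theorem skewPhase_add_nat (n : ℂ) (k : ℕ) : skewPhase (n + k) = (-1) ^ k * skewPhase n := by
  have h := skewPhase_add_int n k
  rwa [negOnePow_natCast_complex, Int.cast_natCast] at h

theorem negOnePow_mul_self_complex (m : ℤ) :
    ((m.negOnePow : ℤ) : ℂ) * ((m.negOnePow : ℤ) : ℂ) = 1 := by
  rw [← Int.cast_mul, ← Units.val_mul, ← Int.negOnePow_add, Int.negOnePow_even _ ⟨m, rfl⟩]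
  simp

theorem negOnePow_sub_nat_complex (m : ℤ) (i : ℕ) :
    (((m - i).negOnePow : ℤ) : ℂ) = (m.negOnePow : ℤ) * (-1) ^ i := by
  rw [Int.negOnePow_sub, Units.val_mul, Int.cast_mul, negOnePow_natCast_complex]

/-! ### Skew-symmetry: Ω_{-1} preserves intertwining operators. -/

section Skew

variable {V : Type u} [AddCommGroup V] [Module ℂ V] {X : VOA V}

theorem jacobiIdentity_of_complex {Γ V M₁ M₂ M₃ : Type*} [Ring Γ]
    [AddCommGroup V] [Module ℂ V] [AddCommGroup M₁] [Module ℂ M₁]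
    [AddCommGroup M₂] [Module ℂ M₂] [AddCommGroup M₃] [Module ℂ M₃]
    {act₁ : ℤ → V →ₗ[ℂ] M₁ →ₗ[ℂ] M₁} {act₂ : ℤ → V →ₗ[ℂ] M₂ →ₗ[ℂ] M₂}
    {act₃ : ℤ → V →ₗ[ℂ] M₃ →ₗ[ℂ] M₃} {I : Γ → M₁ →ₗ[ℂ] M₂ →ₗ[ℂ] M₃}
    (h₁ : ∀ (n : Γ) (w₁ : M₁) (w₂ : M₂), ∃ B : ℕ, ∀ i : ℕ, B ≤ i → I (n + i) w₁ w₂ = 0)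
    (h₂ : ∀ (m : ℤ) (v : V) (w₂ : M₂), ∃ B : ℕ, ∀ i : ℕ, B ≤ i → act₂ (m + i) v w₂ = 0)
    (hJ : ∀ (v : V) (w₁ : M₁) (w₂ : M₂) (l m : ℤ) (n : Γ),
      (∑ᶠ i : ℕ, ((-1) ^ i * cchoose l i) • act₃ (m + l - i) v (I (n + i) w₁ w₂))
      - ((l.negOnePow : ℤ) : ℂ) •
        (∑ᶠ i : ℕ, ((-1) ^ i * cchoose l i) • I (n + l - i) w₁ (act₂ (m + i) v w₂))
      = ∑ᶠ i : ℕ, cchoose m i • I (m + n - i) (act₁ (l + i) v w₁) w₂) :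
    JacobiIdentity act₁ act₂ act₃ I := by
  intro v w₁ w₂ l m n
  have h := hJ v w₁ w₂ l m n
  obtain ⟨B₁, hB₁⟩ := h₁ n w₁ w₂
  obtain ⟨B₂, hB₂⟩ := h₂ m v w₂
  rw [smul_finsum, ← finsum_sub_distrib
    (finite_support_of_eventually_zero (B := B₁) fun i hi => by simp [hB₁ i hi])
    (finite_support_of_eventually_zero (B := B₂) fun i hi => by simp [hB₂ i hi])] at h
  refine (finsum_congr fun i => ?_).trans (h.trans (finsum_congr fun i => ?_))
  · rw [smul_comm ((l.negOnePow : ℤ) : ℂ), ← smul_sub, ← Int.cast_smul_eq_zsmul ℂ,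
      ← Int.cast_smul_eq_zsmul ℂ (l.negOnePow : ℤ), cchoose]
    push_cast
    rfl
  · rw [← Int.cast_smul_eq_zsmul ℂ]
    rfl

theorem exists_bound_of_truncation {M₁ M₂ M₃ : Type*} [AddCommGroup M₁] [Module ℂ M₁]
    [AddCommGroup M₂] [Module ℂ M₂] [AddCommGroup M₃] [Module ℂ M₃]
    {𝒴 : ℂ → M₁ →ₗ[ℂ] M₂ →ₗ[ℂ] M₃} {w₁ : M₁} {w₂ : M₂}
    (h : ∃ N : ℝ, ∀ n : ℂ, N ≤ n.re → 𝒴 n w₁ w₂ = 0) (n : ℂ) :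
    ∃ B : ℕ, ∀ i : ℕ, B ≤ i → 𝒴 (n + i) w₁ w₂ = 0 := by
  obtain ⟨N, hN⟩ := h
  obtain ⟨p, hp⟩ := exists_nat_ge (N - n.re)
  refine ⟨p, fun i hi => hN _ ?_⟩
  have : (p : ℝ) ≤ i := by exact_mod_cast hi
  simp only [Complex.add_re, Complex.natCast_re]
  linarith

/-- Translation covariance e^{yL(-1)} Y(v, x) e^{-yL(-1)} = Y(v, x + y) in coefficients: iterating
[L(-1), v_q] = -q v_{q-1} produces the binomials with alternating signs. -/
theorem WeakModule.divPow_L_neg_one_mul_mode (M : WeakModule X) (v : V) (q : ℤ) (p : ℕ) :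
    divPow (M.L (-1)) p * M.mode q v
      = ∑ r ∈ antidiagonal p,
        ((-1) ^ r.1 * cchoose q r.1) • (M.mode (q - r.1) v * divPow (M.L (-1)) r.2) := by
  have h := divPow_mul_eq_sum (M.L (-1))
    (fun r => ((-1) ^ r * cchoose q r) • (M.mode (q - r) v : Module.End ℂ M)) ?_ p
  · simpa [cchoose_zero_right] using h
  · intro r
    ext w
    have hc := M.L_neg_one_commutator v (q - r) w
    simp only [LinearMap.smul_apply, LinearMap.sub_apply, Module.End.mul_apply, map_smul,
      ← smul_sub, hc]
    rw [smul_smul, smul_smul, show q - ((r + 1 : ℕ) : ℤ) = q - r - 1 by push_cast; ring]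
    congr 1
    have hs := succ_mul_cchoose_succ q r
    push_cast
    rw [pow_succ]
    linear_combination (-(-1 : ℂ) ^ r) * hs

/-- Moving the powers of L(-1) to the right of the modes creates a second binomial factor with upper
entry m + l - i; summed against C(m, i) it collapses to C(l, ·), since (m + l) - m = l. This is how
l and m change places under skew-symmetry. -/
theorem WeakModule.sum_divPow_L_neg_one_mode (M : WeakModule X) (v : V) (l m : ℤ) (N : ℕ) :
    ∑ p ∈ antidiagonal N, ((-1) ^ (p.1 + p.2) * cchoose m p.1) •
        (divPow (M.L (-1)) p.2 * M.mode (m + l - p.1) v)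
      = ∑ p ∈ antidiagonal N, ((-1) ^ p.2 * cchoose l p.1) •
        (M.mode (m + l - p.1) v * divPow (M.L (-1)) p.2) := by
  have h₁ : ∀ p ∈ antidiagonal N, ((-1) ^ (p.1 + p.2) * cchoose m p.1) •
        (divPow (M.L (-1)) p.2 * M.mode (m + l - p.1) v)
      = ∑ r ∈ antidiagonal p.2, ((-1) ^ r.2 * ((-1) ^ p.1 * cchoose m p.1
          * cchoose (m + l - p.1) r.1)) •
        (M.mode (m + l - (p.1 + r.1 : ℕ)) v * divPow (M.L (-1)) r.2) := by
    intro p _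
    rw [M.divPow_L_neg_one_mul_mode, smul_sum]
    refine sum_congr rfl fun r hr => ?_
    rw [HasAntidiagonal.mem_antidiagonal] at hr
    rw [smul_smul, show m + l - (p.1 : ℤ) - r.1 = m + l - (p.1 + r.1 : ℕ) by push_cast; ring,
      ← hr]
    congr 1
    have : (-1 : ℂ) ^ r.1 * (-1) ^ r.1 = 1 := by rw [← mul_pow]; simp
    rw [pow_add, pow_add]
    linear_combination ((-1) ^ r.2 * ((-1) ^ p.1 * cchoose m p.1
          * cchoose (m + l - p.1) r.1)) * this
  rw [sum_congr rfl h₁, sum_antidiagonal_assoc fun a b c => ((-1) ^ c * ((-1) ^ a * cchoose m a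
          * cchoose (m + l - a) b)) • (M.mode (m + l - (a + b : ℕ)) v * divPow (M.L (-1)) c)]
  refine sum_congr rfl fun p _ => ?_
  have h₂ : ∀ q ∈ antidiagonal p.1, ((-1) ^ p.2 * ((-1) ^ q.1 * cchoose m q.1
          * cchoose (m + l - q.1) q.2)) • (M.mode (m + l - (q.1 + q.2 : ℕ)) v
            * divPow (M.L (-1)) p.2)
      = ((-1) ^ p.2 * ((-1) ^ q.1 * cchoose m q.1 * cchoose (m + l - q.1) q.2)) •
          (M.mode (m + l - p.1) v * divPow (M.L (-1)) p.2) := by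
    intro q hq
    rw [HasAntidiagonal.mem_antidiagonal] at hq
    rw [hq]
  rw [sum_congr rfl h₂, ← sum_smul, ← mul_sum, sum_antidiagonal_cchoose,
    show m + l - m = l by ring]

variable {M₁ M₂ M₃ : WeakModule X} {𝒴 : ℂ → M₁ →ₗ[ℂ] M₂ →ₗ[ℂ] M₃}

theorem skewOp_eq_finsum (𝒴 : ℂ → M₁ →ₗ[ℂ] M₂ →ₗ[ℂ] M₃) (n : ℂ) (w₂ : M₂) (w₁ : M₁) :
    skewOp (-1) 𝒴 n w₂ w₁
      = ∑ᶠ k : ℕ, (skewPhase n * (-1) ^ k) • divPow (M₃.L (-1)) k (𝒴 (n + k) w₁ w₂) := by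
  refine finsum_congr fun k => ?_
  rw [divPow_apply, smul_smul]
  congr 1
  rw [mul_comm (skewPhase n), ← skewPhase_add_nat, mul_comm, skewPhase]
  congr 2
  push_cast
  ring

theorem skewOp_eq_sum {n : ℂ} {w₂ : M₂} {w₁ : M₁} {B : ℕ}
    (hB : ∀ k : ℕ, B ≤ k → 𝒴 (n + k) w₁ w₂ = 0) :
    skewOp (-1) 𝒴 n w₂ w₁
      = ∑ k ∈ range B, (skewPhase n * (-1) ^ k) • divPow (M₃.L (-1)) k (𝒴 (n + k) w₁ w₂) := by
  rw [skewOp_eq_finsum]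
  exact finsum_eq_sum_range fun k hk => by rw [hB k hk, map_zero, smul_zero]

theorem IsIntertwining.exists_bound₂ (h : IsIntertwining M₁ M₂ M₃ 𝒴) (n n' : ℂ)
    (w₁ w₁' : M₁) (w₂ w₂' : M₂) :
    ∃ B : ℕ, ∀ i : ℕ, B ≤ i → 𝒴 (n + i) w₁ w₂ = 0 ∧ 𝒴 (n' + i) w₁' w₂' = 0 := by
  obtain ⟨B, hB⟩ := h.exists_bound n w₁ w₂
  obtain ⟨B', hB'⟩ := h.exists_bound n' w₁' w₂'
  exact ⟨max B B', fun i hi => ⟨hB i (le_of_max_le_left hi), hB' i (le_of_max_le_right hi)⟩⟩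

/-- The coefficients of `Ω_{-1}(𝒴)` as bilinear maps. -/
noncomputable def IsIntertwining.skew (h : IsIntertwining M₁ M₂ M₃ 𝒴) (n : ℂ) :
    M₂ →ₗ[ℂ] M₁ →ₗ[ℂ] M₃ :=
  LinearMap.mk₂ ℂ (fun w₂ w₁ => skewOp (-1) 𝒴 n w₂ w₁)
    (fun w₂ w₂' w₁ => by
      obtain ⟨B, hB⟩ := h.exists_bound₂ n n w₁ w₁ w₂ w₂'
      rw [skewOp_eq_sum (B := B) fun k hk => (hB k hk).1,
        skewOp_eq_sum (B := B) fun k hk => (hB k hk).2,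
        skewOp_eq_sum (B := B) fun k hk => by rw [map_add, (hB k hk).1, (hB k hk).2, add_zero],
        ← sum_add_distrib]
      exact sum_congr rfl fun k _ => by rw [map_add, map_add, smul_add])
    (fun c w₂ w₁ => by
      obtain ⟨B, hB⟩ := h.exists_bound n w₁ w₂
      rw [skewOp_eq_sum hB, skewOp_eq_sum (B := B) fun k hk => by
        rw [map_smul, hB k hk, smul_zero], smul_sum]
      exact sum_congr rfl fun k _ => by rw [map_smul, map_smul, smul_comm])
    (fun w₂ w₁ w₁' => by
      obtain ⟨B, hB⟩ := h.exists_bound₂ n n w₁ w₁' w₂ w₂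
      rw [skewOp_eq_sum (B := B) fun k hk => (hB k hk).1,
        skewOp_eq_sum (B := B) fun k hk => (hB k hk).2,
        skewOp_eq_sum (B := B) fun k hk => by
          rw [map_add, LinearMap.add_apply, (hB k hk).1, (hB k hk).2, add_zero],
        ← sum_add_distrib]
      exact sum_congr rfl fun k _ => by rw [map_add, LinearMap.add_apply, map_add, smul_add])
    (fun c w₂ w₁ => by
      obtain ⟨B, hB⟩ := h.exists_bound n w₁ w₂
      rw [skewOp_eq_sum hB, skewOp_eq_sum (B := B) fun k hk => by
        rw [map_smul, LinearMap.smul_apply, hB k hk, smul_zero], smul_sum]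
      exact sum_congr rfl fun k _ => by
        rw [map_smul, LinearMap.smul_apply, map_smul, smul_comm])

theorem IsIntertwining.skew_apply (h : IsIntertwining M₁ M₂ M₃ 𝒴) (n : ℂ) (w₂ : M₂) (w₁ : M₁) :
    h.skew n w₂ w₁ = skewOp (-1) 𝒴 n w₂ w₁ := rfl

theorem IsIntertwining.skew_truncation (h : IsIntertwining M₁ M₂ M₃ 𝒴) (w₂ : M₂) (w₁ : M₁) :
    ∃ N : ℝ, ∀ n : ℂ, N ≤ n.re → h.skew n w₂ w₁ = 0 := by
  obtain ⟨N, hN⟩ := h.truncation w₁ w₂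
  refine ⟨N, fun n hn => ?_⟩
  rw [h.skew_apply, skewOp_eq_sum (B := 0) fun k _ => hN _ ?_]
  · simp
  · simp only [Complex.add_re, Complex.natCast_re]
    have : (0 : ℝ) ≤ k := Nat.cast_nonneg k
    linarith

theorem IsIntertwining.skew_derivative (h : IsIntertwining M₁ M₂ M₃ 𝒴) (n : ℂ) (w₂ : M₂)
    (w₁ : M₁) : h.skew n (M₂.L (-1) w₂) w₁ = -n • h.skew (n - 1) w₂ w₁ := by
  obtain ⟨B₁, hB₁⟩ := h.exists_bound₂ n (n - 1) w₁ w₁ (M₂.L (-1) w₂) w₂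
  obtain ⟨B₂, hB₂⟩ := h.exists_bound n w₁ w₂
  have hB : ∀ k : ℕ, max B₁ B₂ ≤ k → 𝒴 (n + k) w₁ (M₂.L (-1) w₂) = 0 ∧
      𝒴 (n - 1 + k) w₁ w₂ = 0 ∧ 𝒴 (n + k) w₁ w₂ = 0 := fun k hk =>
    ⟨(hB₁ k (le_of_max_le_left hk)).1, (hB₁ k (le_of_max_le_left hk)).2,
      hB₂ k (le_of_max_le_right hk)⟩
  set B := max B₁ B₂
  rw [h.skew_apply, h.skew_apply, skewOp_eq_sum (B := B + 1) fun k hk => (hB k (by omega)).1,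
    skewOp_eq_sum (B := B + 1) fun k hk => (hB k (by omega)).2.1]
  have hph : skewPhase (n - 1) = - skewPhase n := by
    have := skewPhase_add_nat (n - 1) 1
    rw [show n - 1 + ((1 : ℕ) : ℂ) = n by push_cast; ring] at this
    rw [this]
    ring
  have hterm : ∀ k : ℕ, (skewPhase n * (-1) ^ k) •
        divPow (M₃.L (-1)) k (𝒴 (n + k) w₁ (M₂.L (-1) w₂))
      -- The commutator with L(-1) gives three families. The first at k cancels the second at k + 1,
      -- and the third is the required right-hand side. The range `B + 1` leaves a boundary term of
      -- the first family at `B`, which vanishes by truncation.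
      = ((skewPhase n * (-1) ^ k) • (((k : ℂ) + 1) • divPow (M₃.L (-1)) (k + 1) (𝒴 (n + k) w₁ w₂))
        + (skewPhase n * (-1) ^ k * k) • divPow (M₃.L (-1)) k (𝒴 (n - 1 + k) w₁ w₂))
        + -n • ((skewPhase (n - 1) * (-1) ^ k) •
          divPow (M₃.L (-1)) k (𝒴 (n - 1 + k) w₁ w₂)) := by
    intro k
    have hs := LinearMap.congr_fun (succ_smul_divPow_succ (M₃.L (-1)) k) (𝒴 (n + k) w₁ w₂)
    rw [LinearMap.smul_apply, Module.End.mul_apply] at hs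
    rw [h.L_neg_one_commutator, map_add, map_smul, hph, hs,
      show n + k - 1 = n - 1 + (k : ℂ) by ring]
    module
  rw [sum_congr rfl fun k _ => hterm k, sum_add_distrib, ← smul_sum, sum_add_distrib,
    sum_range_succ, sum_range_succ' _ B]
  rw [(hB B le_rfl).2.2]
  simp only [map_zero, smul_zero, add_zero, Nat.cast_zero, mul_zero, zero_smul]
  rw [← sum_add_distrib, sum_eq_zero, zero_add]
  intro k _
  rw [show n - 1 + ((k + 1 : ℕ) : ℂ) = n + k by push_cast; ring]
  push_cast
  rw [pow_succ]
  module

/-- Exchanging `w₁` and `w₂` permutes the terms of the Jacobi identity. The identity at (l, m, n)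
for the skew operator is the combination, over k, of the identities for `𝒴` at (m, l, n + k), with
the iterate term and the term where v acts on the second argument interchanged. -/
theorem IsIntertwining.skew_jacobi (h : IsIntertwining M₁ M₂ M₃ 𝒴) (v : V) (w₂ : M₂)
    (w₁ : M₁) (l m : ℤ) (n : ℂ) :
    (∑ᶠ i : ℕ, ((-1) ^ i * cchoose l i) • M₃.mode (m + l - i) v (h.skew (n + i) w₂ w₁))
      - ((l.negOnePow : ℤ) : ℂ) •
        (∑ᶠ i : ℕ, ((-1) ^ i * cchoose l i) • h.skew (n + l - i) w₂ (M₁.mode (m + i) v w₁))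
      = ∑ᶠ i : ℕ, cchoose m i • h.skew (m + n - i) (M₂.mode (l + i) v w₂) w₁ := by
  obtain ⟨B₁, hB₁⟩ := h.exists_bound n w₁ w₂
  obtain ⟨B₂, hB₂⟩ := M₂.exists_bound l v w₂
  obtain ⟨B₃, hB₃⟩ := M₁.exists_bound m v w₁
  obtain ⟨B₄, hB₄⟩ := exists_forall_lt_bound
    (fun i : ℕ => h.exists_bound₂ (m + n - i) (n + l - i) w₁ (M₁.mode (m + i) v w₁)
      (M₂.mode (l + i) v w₂) w₂) (max B₂ B₃)
  obtain ⟨B, hB1, hB2, hB3, hB4⟩ : ∃ B, B₁ ≤ B ∧ B₂ ≤ B ∧ B₃ ≤ B ∧ B₄ ≤ B :=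
    ⟨max (max B₁ B₂) (max B₃ B₄), by omega, by omega, by omega, by omega⟩
  have z1 : ∀ k : ℕ, B ≤ k → 𝒴 (n + k) w₁ w₂ = 0 := fun k hk => hB₁ k (by omega)
  have z2 : ∀ i k : ℕ, B ≤ i ∨ B ≤ k → 𝒴 (m + n - i + k) w₁ (M₂.mode (l + i) v w₂) = 0 := by
    intro i k hik
    by_cases hi : i < B₂
    · exact (hB₄ i (by omega) k (by omega)).1
    · rw [hB₂ i (by omega), map_zero]
  have z3 : ∀ i k : ℕ, B ≤ i ∨ B ≤ k → 𝒴 (n + l - i + k) (M₁.mode (m + i) v w₁) w₂ = 0 := by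
    intro i k hik
    by_cases hi : i < B₃
    · exact (hB₄ i (by omega) k (by omega)).2
    · rw [hB₃ i (by omega), map_zero, LinearMap.zero_apply]
  set T := M₃.L (-1) with hT
  -- `Φ` is the combination of coefficients that builds e^{xL(-1)} with its phase. Truncated at a
  -- common bound `B`, it is a finite sum and commutes with the sums over i.
  set Φ : (ℕ → M₃) → M₃ := fun x => ∑ k ∈ range B, (skewPhase n * (-1) ^ k) • divPow T k (x k)
    with hΦ
  -- Only this term needs the conjugation identity, because here v acts outside e^{xL(-1)}. In `e2`
  -- and `e3` it acts inside, and matching the phases and reordering the sums is enough.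
  have e1 : (∑ᶠ i : ℕ, ((-1) ^ i * cchoose l i) • M₃.mode (m + l - i) v (h.skew (n + i) w₂ w₁))
      = Φ fun k => ∑ᶠ i : ℕ, ((-1) ^ i * cchoose m i) •
        M₃.mode (l + m - i) v (𝒴 (n + k + i) w₁ w₂) := by
    have hs : ∀ i : ℕ, h.skew (n + i) w₂ w₁ = ∑ k ∈ range B,
        (skewPhase n * (-1) ^ (i + k)) • divPow T k (𝒴 (n + (i + k : ℕ)) w₁ w₂) := by
      intro i
      rw [h.skew_apply, skewOp_eq_sum (B := B) fun k hk => ?_]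
      · refine sum_congr rfl fun k _ => ?_
        rw [skewPhase_add_nat, pow_add, show n + i + (k : ℂ) = n + (i + k : ℕ) by push_cast; ring]
        congr 1
        ring
      · rw [add_assoc, ← Nat.cast_add]
        exact z1 _ (by omega)
    rw [finsum_eq_sum_range (B := B) fun i hi => by
      rw [hs, sum_eq_zero fun k _ => by rw [z1 _ (by omega), map_zero, smul_zero], map_zero,
        smul_zero]]
    have hL : ∀ i ∈ range B, ((-1) ^ i * cchoose l i) • M₃.mode (m + l - i) v
          (h.skew (n + i) w₂ w₁)
        = ∑ k ∈ range B, skewPhase n • ((-1) ^ k * cchoose l i) •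
          (M₃.mode (m + l - i) v * divPow T k) (𝒴 (n + (i + k : ℕ)) w₁ w₂) := by
      intro i _
      rw [hs, map_sum, smul_sum]
      refine sum_congr rfl fun k _ => ?_
      rw [map_smul, smul_smul, smul_smul, Module.End.mul_apply]
      congr 1
      have : (-1 : ℂ) ^ i * (-1) ^ i = 1 := by rw [← mul_pow]; simp
      rw [pow_add]
      linear_combination (skewPhase n * (-1) ^ k * cchoose l i) * this
    have hR : (Φ fun k => ∑ᶠ i : ℕ, ((-1) ^ i * cchoose m i) •
          M₃.mode (l + m - i) v (𝒴 (n + k + i) w₁ w₂))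
        = ∑ k ∈ range B, ∑ i ∈ range B, skewPhase n • ((-1) ^ (i + k) * cchoose m i) •
          (divPow T k * M₃.mode (m + l - i) v) (𝒴 (n + (i + k : ℕ)) w₁ w₂) := by
      rw [hΦ]
      refine sum_congr rfl fun k _ => ?_
      have e : ∀ i : ℕ, n + k + (i : ℂ) = n + (i + k : ℕ) := fun i => by push_cast; ring
      simp only [e]
      rw [finsum_eq_sum_range (B := B) fun i hi => by
        rw [z1 _ (by omega), map_zero, smul_zero], map_sum, smul_sum]
      refine sum_congr rfl fun i _ => ?_
      rw [map_smul, smul_smul, smul_smul, Module.End.mul_apply, add_comm l m]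
      congr 1
      rw [pow_add]
      ring
    rw [sum_congr rfl hL, hR, sum_comm (s := range B) (t := range B)
        (f := fun k i => skewPhase n • ((-1) ^ (i + k) * cchoose m i) •
          (divPow T k * M₃.mode (m + l - i) v) (𝒴 (n + (i + k : ℕ)) w₁ w₂)),
      sum_range_sum_range_antidiagonal fun i j hij => by
        rw [z1 _ hij, map_zero, smul_zero, smul_zero],
      sum_range_sum_range_antidiagonal fun i j hij => by
        rw [z1 _ hij, map_zero, smul_zero, smul_zero]]
    refine sum_congr rfl fun N _ => ?_
    have hk := LinearMap.congr_fun (M₃.sum_divPow_L_neg_one_mode v l m N) (𝒴 (n + N) w₁ w₂)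
    rw [LinearMap.sum_apply, LinearMap.sum_apply] at hk
    rw [← smul_sum, ← smul_sum]
    congr 1
    refine Eq.trans (sum_congr rfl fun p hp => ?_) (hk.symm.trans (sum_congr rfl fun p hp => ?_))
    · rw [HasAntidiagonal.mem_antidiagonal] at hp
      rw [hp]
      rfl
    · rw [HasAntidiagonal.mem_antidiagonal] at hp
      rw [hp]
      rfl
  have e2 : ((l.negOnePow : ℤ) : ℂ) •
        (∑ᶠ i : ℕ, ((-1) ^ i * cchoose l i) • h.skew (n + l - i) w₂ (M₁.mode (m + i) v w₁))
      = Φ fun k => ∑ᶠ i : ℕ, cchoose l i • 𝒴 (l + (n + k) - i) (M₁.mode (m + i) v w₁) w₂ := by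
    have hs : ∀ i : ℕ, h.skew (n + l - i) w₂ (M₁.mode (m + i) v w₁) = ∑ k ∈ range B,
        (((l.negOnePow : ℤ) : ℂ) * (-1) ^ i * skewPhase n * (-1) ^ k) •
          divPow T k (𝒴 (n + l - i + k) (M₁.mode (m + i) v w₁) w₂) := by
      intro i
      rw [h.skew_apply, skewOp_eq_sum (B := B) fun k hk => z3 i k (Or.inr hk),
        show n + l - (i : ℂ) = n + (l - i : ℤ) by push_cast; ring, skewPhase_add_int,
        negOnePow_sub_nat_complex]
    rw [finsum_eq_sum_range (B := B) fun i hi => by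
      rw [hs, sum_eq_zero fun k _ => by rw [z3 _ _ (Or.inl hi), map_zero, smul_zero], smul_zero]]
    have e : ∀ i k : ℕ, l + (n + k) - (i : ℂ) = n + l - i + k := fun i k => by ring
    have hf : ∀ k : ℕ, (∑ᶠ i : ℕ, cchoose l i • 𝒴 (n + l - i + k) (M₁.mode (m + i) v w₁) w₂)
        = ∑ i ∈ range B, cchoose l i • 𝒴 (n + l - i + k) (M₁.mode (m + i) v w₁) w₂ := fun k =>
      finsum_eq_sum_range fun i hi => by rw [z3 _ _ (Or.inl hi), smul_zero]
    simp only [hΦ, e, hf, map_sum, smul_sum]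
    rw [sum_comm]
    refine sum_congr rfl fun i _ => ?_
    rw [hs, smul_sum, smul_sum]
    refine sum_congr rfl fun k _ => ?_
    rw [map_smul, smul_smul, smul_smul, smul_smul]
    congr 1
    have h1 : (-1 : ℂ) ^ i * (-1) ^ i = 1 := by rw [← mul_pow]; simp
    have h2 := negOnePow_mul_self_complex l
    linear_combination (cchoose l i * skewPhase n * (-1) ^ k) * ((-1 : ℂ) ^ i * (-1) ^ i) * h2
      + (cchoose l i * skewPhase n * (-1) ^ k) * h1
  have e3 : (∑ᶠ i : ℕ, cchoose m i • h.skew (m + n - i) (M₂.mode (l + i) v w₂) w₁)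
      = ((m.negOnePow : ℤ) : ℂ) • Φ fun k => ∑ᶠ i : ℕ, ((-1) ^ i * cchoose m i) •
        𝒴 (n + k + m - i) w₁ (M₂.mode (l + i) v w₂) := by
    have hs : ∀ i : ℕ, h.skew (m + n - i) (M₂.mode (l + i) v w₂) w₁ = ∑ k ∈ range B,
        (((m.negOnePow : ℤ) : ℂ) * (-1) ^ i * skewPhase n * (-1) ^ k) •
          divPow T k (𝒴 (m + n - i + k) w₁ (M₂.mode (l + i) v w₂)) := by
      intro i
      rw [h.skew_apply, skewOp_eq_sum (B := B) fun k hk => z2 i k (Or.inr hk),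
        show m + n - (i : ℂ) = n + (m - i : ℤ) by push_cast; ring, skewPhase_add_int,
        negOnePow_sub_nat_complex]
    rw [finsum_eq_sum_range (B := B) fun i hi => by
      rw [hs, sum_eq_zero fun k _ => by rw [z2 _ _ (Or.inl hi), map_zero, smul_zero], smul_zero]]
    have e : ∀ i k : ℕ, n + k + m - (i : ℂ) = m + n - i + k := fun i k => by ring
    have hf : ∀ k : ℕ, (∑ᶠ i : ℕ, ((-1) ^ i * cchoose m i) •
          𝒴 (m + n - i + k) w₁ (M₂.mode (l + i) v w₂))
        = ∑ i ∈ range B, ((-1) ^ i * cchoose m i) •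
          𝒴 (m + n - i + k) w₁ (M₂.mode (l + i) v w₂) := fun k =>
      finsum_eq_sum_range fun i hi => by rw [z2 _ _ (Or.inl hi), smul_zero]
    simp only [hΦ, e, hf, map_sum, smul_sum]
    rw [sum_comm]
    refine sum_congr rfl fun i _ => ?_
    rw [hs, smul_sum]
    refine sum_congr rfl fun k _ => ?_
    rw [map_smul, smul_smul, smul_smul, smul_smul]
    congr 1
    ring
  rw [e1, e2, e3, sub_eq_iff_eq_add]
  simp only [hΦ]
  rw [smul_sum, ← sum_add_distrib]
  refine sum_congr rfl fun k _ => ?_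
  -- The Jacobi identity of `𝒴` with l and m exchanged, to be summed under `Φ`.
  have hJ := h.jacobi_complex v w₁ w₂ m l (n + k)
  rw [sub_eq_iff_eq_add] at hJ
  rw [hJ, map_add, map_smul, smul_add, add_comm]
  congr 1
  rw [smul_comm]

theorem IsIntertwining.isIntertwining_skew (h : IsIntertwining M₁ M₂ M₃ 𝒴) :
    IsIntertwining M₂ M₁ M₃ h.skew where
  truncation := h.skew_truncation
  jacobi := jacobiIdentity_of_complex
    (fun n w₂ w₁ => exists_bound_of_truncation (h.skew_truncation w₂ w₁) n) M₁.exists_bound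
    h.skew_jacobi
  derivative := h.skew_derivative

end Skew

theorem sum_antidiagonal_left_comm {M : Type*} [AddCommMonoid M] (f : ℕ → ℕ → ℕ → M) (N : ℕ) :
    ∑ p ∈ antidiagonal N, ∑ q ∈ antidiagonal p.2, f p.1 q.1 q.2
      = ∑ p ∈ antidiagonal N, ∑ q ∈ antidiagonal p.2, f q.1 p.1 q.2 := by
  rw [sum_antidiagonal_assoc f, sum_antidiagonal_assoc fun a b c => f b a c]
  refine sum_congr rfl fun p _ => ?_
  rw [← Nat.sum_antidiagonal_swap]
  rfl

theorem hasFiniteSupport_sum {M : Type*} [AddCommGroup M] {f : ℕ → ℕ → M} (s : Finset ℕ)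
    (h : ∀ j, (fun i => f i j).HasFiniteSupport) :
    (fun i => ∑ j ∈ s, f i j).HasFiniteSupport := by
  refine (s.finite_toSet.biUnion fun j _ => h j).subset fun i hi => ?_
  by_contra hn
  simp only [Set.mem_iUnion, not_exists] at hn
  exact hi (sum_eq_zero fun j hj => by simpa using hn j hj)

/-! ### Opposite operators and their Jacobi identity. -/

section Opposite

variable {V : Type u} [AddCommGroup V] [Module ℂ V] {X : VOA V}

theorem VOA.divPow_L_one_mem_weight (X : VOA V) {d : ℤ} {v : V} (hv : v ∈ X.weight d) (k : ℕ) :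
    divPow (X.Y 2 X.conformal) k v ∈ X.weight (d - k) :=
  Submodule.smul_mem _ _ (X.L_one_pow_mem_weight hv k)

theorem WeakModule.divPow_L_one_mem_weight (M : WeakModule X) {μ : ℂ} {w : M}
    (hw : w ∈ M.weight μ) (k : ℕ) : divPow (M.L 1) k w ∈ M.weight (μ - k) :=
  Submodule.smul_mem _ _ (M.L_one_pow_mem_weight hw k)

/-- The conjugation formula for e^{xL(1)}. The inner sum is ad(L(1))^r(v_q)/r!; it involves two
indices because [L(1), v_n] both replaces v by L(1)v and raises n. -/
theorem WeakModule.divPow_L_one_mul_mode (M : WeakModule X) {d : ℤ} {v : V}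
    (hv : v ∈ X.weight d) (q : ℤ) (p : ℕ) :
    divPow (M.L 1) p * M.mode q v = ∑ r ∈ antidiagonal p,
      (∑ x ∈ antidiagonal r.1, cchoose (2 * d - x.1 - q - 2) x.2 •
        M.mode (q + x.2) (divPow (X.Y 2 X.conformal) x.1 v)) * divPow (M.L 1) r.2 := by
  set ℓ := X.Y 2 X.conformal with hℓ
  have h := divPow_mul_eq_sum (M.L 1)
    (fun r => (∑ x ∈ antidiagonal r, cchoose (2 * d - x.1 - q - 2) x.2 •
        M.mode (q + x.2) (divPow ℓ x.1 v) : Module.End ℂ M)) ?_ p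
  · simpa [cchoose_zero_right, divPow_zero] using h
  intro r
  ext w
  set c : ℕ → ℕ → ℂ := fun k s => cchoose (2 * d - k - q - 2) s with hc
  set u : ℕ → ℕ → M := fun k s => M.mode (q + s) (divPow ℓ k v) w with hu
  have hbr : ∀ k s : ℕ, M.L 1 (u k s) - M.mode (q + s) (divPow ℓ k v) (M.L 1 w)
      = ((k : ℂ) + 1) • u (k + 1) s + (2 * d - 2 * k - q - s - 2 : ℂ) • u k (s + 1) := by
    intro k s
    have h1 := M.L_one_commutator (X.divPow_L_one_mem_weight hv k) (q + s) w
    have h2 := LinearMap.congr_fun (succ_smul_divPow_succ' ℓ k) v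
    rw [LinearMap.smul_apply, Module.End.mul_apply] at h2
    rw [h1, ← hℓ, ← h2, map_smul, LinearMap.smul_apply]
    simp only [hu]
    rw [show q + ((s + 1 : ℕ) : ℤ) = q + s + 1 by push_cast; ring]
    congr 2
    push_cast
    ring
  have hl : (((r : ℂ) + 1) • (∑ x ∈ antidiagonal (r + 1), cchoose (2 * d - x.1 - q - 2) x.2 •
        M.mode (q + x.2) (divPow ℓ x.1 v) : Module.End ℂ M)) w
      = ∑ x ∈ antidiagonal r, (((x.1 : ℂ) + 1) • c (x.1 + 1) x.2 • u (x.1 + 1) x.2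
        + ((x.2 : ℂ) + 1) • c x.1 (x.2 + 1) • u x.1 (x.2 + 1)) := by
    rw [← sum_antidiagonal_leibniz (fun k s => c k s • u k s) r, LinearMap.smul_apply,
      LinearMap.sum_apply]
    rfl
  have hr : ((M.L 1 * ∑ x ∈ antidiagonal r, cchoose (2 * d - x.1 - q - 2) x.2 •
        M.mode (q + x.2) (divPow ℓ x.1 v) : Module.End ℂ M)
      - (∑ x ∈ antidiagonal r, cchoose (2 * d - x.1 - q - 2) x.2 •
        M.mode (q + x.2) (divPow ℓ x.1 v) : Module.End ℂ M) * M.L 1) w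
      = ∑ x ∈ antidiagonal r, c x.1 x.2 • (((x.1 : ℂ) + 1) • u (x.1 + 1) x.2
        + (2 * d - 2 * x.1 - q - x.2 - 2 : ℂ) • u x.1 (x.2 + 1)) := by
    rw [LinearMap.sub_apply, Module.End.mul_apply, Module.End.mul_apply, LinearMap.sum_apply,
      LinearMap.sum_apply, map_sum, ← sum_sub_distrib]
    refine sum_congr rfl fun x _ => ?_
    rw [← hbr, LinearMap.smul_apply, map_smul, LinearMap.smul_apply, ← smul_sub]
  -- The binomial recursion yields the factor 2d - k - q - s - 2, whereas the bracket yields 2d - 2k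
  -- - q - s - 2. `g` records the discrepancy k; with Pascal's rule the difference of the two sides
  -- telescopes along the antidiagonal.
  set g : ℕ → ℕ → M := fun k s =>
    match s with
    | 0 => 0
    | s + 1 => ((k : ℂ) * c k s) • u k (s + 1) with hg
  have hg0 : ∀ s, g 0 s = 0 := by
    rintro (_ | s)
    · rfl
    · simp [hg]
  have hgs : ∑ x ∈ antidiagonal r, g (x.1 + 1) x.2 = ∑ x ∈ antidiagonal r, g x.1 (x.2 + 1) := by
    have h1 := Nat.sum_antidiagonal_succ (n := r) (f := fun x : ℕ × ℕ => g x.1 x.2)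
    have h2 := Nat.sum_antidiagonal_succ' (n := r) (f := fun x : ℕ × ℕ => g x.1 x.2)
    simp only [hg0, zero_add] at h1
    rw [← h1, h2]
    simp [hg]
  rw [hl, hr, ← sub_eq_zero, ← sum_sub_distrib]
  have hterm : ∀ x ∈ antidiagonal r, (((x.1 : ℂ) + 1) • c (x.1 + 1) x.2 • u (x.1 + 1) x.2
        + ((x.2 : ℂ) + 1) • c x.1 (x.2 + 1) • u x.1 (x.2 + 1))
      - c x.1 x.2 • (((x.1 : ℂ) + 1) • u (x.1 + 1) x.2
        + (2 * d - 2 * x.1 - q - x.2 - 2 : ℂ) • u x.1 (x.2 + 1))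
      = g x.1 (x.2 + 1) - g (x.1 + 1) x.2 := by
    rintro ⟨k, s⟩ _
    have h1 : ((s : ℂ) + 1) * c k (s + 1) = (2 * d - k - q - 2 - s) * c k s := by
      simp only [hc]
      rw [succ_mul_cchoose_succ]
      push_cast
      ring
    have h2 : g (k + 1) s = (((k : ℂ) + 1) * (c k s - c (k + 1) s)) • u (k + 1) s := by
      cases s with
      | zero => simp [hg, hc, cchoose_zero_right]
      | succ s =>
        have h3 := cchoose_succ_succ (2 * d - (k + 1 : ℕ) - q - 2) s
        rw [show 2 * d - ((k + 1 : ℕ) : ℤ) - q - 2 + 1 = 2 * d - k - q - 2 by push_cast; ring] at h3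
        simp only [hg, hc]
        rw [h3]
        congr 1
        push_cast
        ring
    rw [h2]
    simp only [hg]
    rw [smul_smul, smul_smul, h1]
    module
  rw [sum_congr rfl hterm, sum_sub_distrib, hgs, sub_self]

/-- After conjugation the two binomial factors combine by `sum_antidiagonal_cchoose`. The new upper
entry 2d - k - l - m - 2 is precisely the mode index at which the opposite operator evaluates L(1)^k
v, so the result fits the right side of the Jacobi identity for the original operator. -/
theorem WeakModule.sum_divPow_L_one_mode (M : WeakModule X) {d : ℤ} {v : V}
    (hv : v ∈ X.weight d) (l m : ℤ) (N : ℕ) :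
    ∑ p ∈ antidiagonal N, ((-1) ^ p.1 * cchoose m p.1) •
        (divPow (M.L 1) p.2 * M.mode (l + p.1) v)
      = ∑ p ∈ antidiagonal N, ∑ q ∈ antidiagonal p.1,
        cchoose (2 * d - q.1 - l - m - 2) q.2 •
          (M.mode (l + q.2) (divPow (X.Y 2 X.conformal) q.1 v) * divPow (M.L 1) p.2) := by
  set ℓ := X.Y 2 X.conformal with hℓ
  have h₁ : ∀ p ∈ antidiagonal N, ((-1) ^ p.1 * cchoose m p.1) •
        (divPow (M.L 1) p.2 * M.mode (l + p.1) v)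
      = ∑ r ∈ antidiagonal p.2, ∑ x ∈ antidiagonal r.1,
        ((-1) ^ p.1 * cchoose m p.1 * cchoose (2 * d - x.1 - l - 2 - p.1) x.2) •
          (M.mode (l + (p.1 + x.2 : ℕ)) (divPow ℓ x.1 v) * divPow (M.L 1) r.2) := by
    intro p _
    rw [M.divPow_L_one_mul_mode hv, smul_sum]
    refine sum_congr rfl fun r _ => ?_
    rw [sum_mul, smul_sum]
    refine sum_congr rfl fun x _ => ?_
    rw [smul_mul_assoc, smul_smul, show l + (p.1 : ℤ) + x.2 = l + (p.1 + x.2 : ℕ) by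
      push_cast; ring, show 2 * d - (x.1 : ℤ) - (l + p.1) - 2 = 2 * d - x.1 - l - 2 - p.1 by ring]
  rw [sum_congr rfl h₁, sum_antidiagonal_assoc fun a b c => ∑ x ∈ antidiagonal b,
        ((-1) ^ a * cchoose m a * cchoose (2 * d - x.1 - l - 2 - a) x.2) •
          (M.mode (l + (a + x.2 : ℕ)) (divPow ℓ x.1 v) * divPow (M.L 1) c)]
  refine sum_congr rfl fun p _ => ?_
  rw [sum_antidiagonal_left_comm fun a b c =>
        ((-1) ^ a * cchoose m a * cchoose (2 * d - b - l - 2 - a) c) •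
          (M.mode (l + (a + c : ℕ)) (divPow ℓ b v) * divPow (M.L 1) p.2)]
  refine sum_congr rfl fun q _ => ?_
  rw [show 2 * d - (q.1 : ℤ) - l - m - 2 = (2 * d - q.1 - l - 2) - m by ring,
    ← sum_antidiagonal_cchoose, sum_smul]
  refine sum_congr rfl fun x hx => ?_
  rw [HasAntidiagonal.mem_antidiagonal] at hx
  rw [hx]

/-- `e^{-πi μ}`. -/
noncomputable def oppPhase (μ : ℂ) : ℂ := Complex.exp (-(Real.pi * Complex.I * μ))

theorem oppPhase_add_int (μ : ℂ) (m : ℤ) :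
    oppPhase (μ + m) = ((m.negOnePow : ℤ) : ℂ) * oppPhase μ := by
  rw [← Int.negOnePow_neg, oppPhase, oppPhase, ← exp_pi_mul_I_mul_int, ← Complex.exp_add]
  congr 1
  push_cast
  ring

theorem oppPhase_intCast (m : ℤ) : oppPhase m = ((m.negOnePow : ℤ) : ℂ) := by
  have h := oppPhase_add_int 0 m
  rw [zero_add] at h
  rw [h, oppPhase]
  simp

section

variable {M₁ M₂ M₃ : WeakModule X}

/-- `Z(w₁, x) = 𝒴(e^{x L(1)} (e^{-πi} x^{-2})^{L(0)} w₁, x^{-1})`, coefficientwise. -/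
def IsOpposite (𝒴 Z : ℂ → M₁ →ₗ[ℂ] M₂ →ₗ[ℂ] M₃) : Prop :=
  ∀ μ, ∀ w₁ ∈ M₁.weight μ, ∀ (n : ℂ) (w₂ : M₂),
    Z n w₁ w₂ = ∑ᶠ k : ℕ, oppPhase μ • 𝒴 (2 * μ - k - n - 2) (divPow (M₁.L 1) k w₁) w₂

/-- The opposite vertex operators of a weak module:
`Z(v, x) = Y(e^{x L(1)} (-x^{-2})^{L(0)} v, x^{-1})`, coefficientwise. -/
def WeakModule.IsOppositeMode (M : WeakModule X) (Z : ℤ → V →ₗ[ℂ] M →ₗ[ℂ] M) : Prop :=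
  ∀ d : ℤ, ∀ v ∈ X.weight d, ∀ (n : ℤ) (w : M),
    Z n v w = ∑ᶠ k : ℕ, ((d.negOnePow : ℤ) : ℂ) •
      M.mode (2 * d - k - n - 2) (divPow (X.Y 2 X.conformal) k v) w

theorem WeakModule.LOneNilpotent.divPow_eq_zero {M : WeakModule X} (hM : M.LOneNilpotent) (w : M) :
    ∃ K : ℕ, ∀ k, K ≤ k → divPow (M.L 1) k w = 0 := by
  obtain ⟨K, hK⟩ := hM w
  exact ⟨K, fun k hk => by rw [divPow_apply, hK k hk, smul_zero]⟩

theorem VOA.divPow_eq_zero (X : VOA V) (v : V) :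
    ∃ K : ℕ, ∀ k, K ≤ k → divPow (X.Y 2 X.conformal) k v = 0 :=
  X.adjoint_LOneNilpotent.divPow_eq_zero v

/-- The defining formula involves the weight of the first argument, so it is prescribed on weight
spaces and extended linearly. Local nilpotency of L(1) makes each sum finite. -/
theorem exists_isOpposite (hs : ⨆ μ, M₁.weight μ = ⊤) (hn : M₁.LOneNilpotent)
    (𝒴 : ℂ → M₁ →ₗ[ℂ] M₂ →ₗ[ℂ] M₃) : ∃ Z, IsOpposite 𝒴 Z := by
  have key : ∀ (n μ : ℂ) (w : M₁) (B : ℕ), (∀ k, B ≤ k → divPow (M₁.L 1) k w = 0) →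
      (∑ᶠ k : ℕ, oppPhase μ • 𝒴 (2 * μ - k - n - 2) (divPow (M₁.L 1) k w))
        = ∑ k ∈ range B, oppPhase μ • 𝒴 (2 * μ - k - n - 2) (divPow (M₁.L 1) k w) :=
    fun n μ w B hB => finsum_eq_sum_range fun k hk => by rw [hB k hk, map_zero, smul_zero]
  let D : ℂ → ℂ → M₁ →ₗ[ℂ] M₂ →ₗ[ℂ] M₃ := fun n μ =>
    { toFun := fun w => ∑ᶠ k : ℕ, oppPhase μ • 𝒴 (2 * μ - k - n - 2) (divPow (M₁.L 1) k w)
      map_add' := fun w w' => by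
        obtain ⟨K, hK⟩ := hn.divPow_eq_zero w
        obtain ⟨K', hK'⟩ := hn.divPow_eq_zero w'
        rw [key n μ w (max K K') fun k hk => hK k (le_of_max_le_left hk),
          key n μ w' (max K K') fun k hk => hK' k (le_of_max_le_right hk),
          key n μ (w + w') (max K K') fun k hk => by
            rw [map_add, hK k (le_of_max_le_left hk), hK' k (le_of_max_le_right hk), add_zero],
          ← sum_add_distrib]
        exact sum_congr rfl fun k _ => by rw [map_add, map_add, smul_add]
      map_smul' := fun c w => by
        rw [RingHom.id_apply, smul_finsum]
        exact finsum_congr fun k => by rw [map_smul, map_smul, smul_comm] }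
  choose Z hZ using fun n => M₁.exists_linearMap hs (D n)
  refine ⟨Z, fun μ w₁ hw₁ n w₂ => ?_⟩
  rw [hZ n μ w₁ hw₁]
  obtain ⟨K, hK⟩ := hn.divPow_eq_zero w₁
  change (∑ᶠ k : ℕ, oppPhase μ • 𝒴 (2 * μ - k - n - 2) (divPow (M₁.L 1) k w₁)) w₂ = _
  rw [key n μ w₁ K hK, LinearMap.sum_apply,
    finsum_eq_sum_range (B := K) fun k hk => by
      rw [hK k hk, map_zero, LinearMap.zero_apply, smul_zero]]
  rfl

theorem WeakModule.exists_isOppositeMode (M : WeakModule X) : ∃ Z, M.IsOppositeMode Z := by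
  obtain ⟨Z, hZ⟩ := exists_isOpposite (M₂ := M) (M₃ := M) X.adjoint_iSup_weight
    X.adjoint_LOneNilpotent M.extMode
  refine ⟨fun n => Z n, fun d v hv n w => ?_⟩
  refine (hZ d v hv n w).trans (finsum_congr fun k => ?_)
  rw [oppPhase_intCast, M.extMode_of_eq (m := 2 * d - k - n - 2) (by push_cast; ring)]
  rfl

/-- The Jacobi identity for opposite operators, on homogeneous vectors. -/
theorem IsIntertwining.opposite_jacobi_of_mem {𝒴 Z : ℂ → M₁ →ₗ[ℂ] M₂ →ₗ[ℂ] M₃}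
    (h : IsIntertwining M₁ M₂ M₃ 𝒴) (hn : M₁.LOneNilpotent) (hZ : IsOpposite 𝒴 Z)
    {Z₂ : ℤ → V →ₗ[ℂ] M₂ →ₗ[ℂ] M₂} (hZ₂ : M₂.IsOppositeMode Z₂)
    {Z₃ : ℤ → V →ₗ[ℂ] M₃ →ₗ[ℂ] M₃} (hZ₃ : M₃.IsOppositeMode Z₃)
    {d : ℤ} {v : V} (hv : v ∈ X.weight d) {μ : ℂ} {w₁ : M₁} (hw₁ : w₁ ∈ M₁.weight μ)
    (w₂ : M₂) (l m : ℤ) (n : ℂ) :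
    (∑ᶠ i : ℕ, ((-1) ^ i * cchoose l i) • Z (n + i) w₁ (Z₂ (m + l - i) v w₂))
      - ((l.negOnePow : ℤ) : ℂ) •
        (∑ᶠ i : ℕ, ((-1) ^ i * cchoose l i) • Z₃ (m + i) v (Z (n + l - i) w₁ w₂))
      = ∑ᶠ i : ℕ, cchoose m i • Z (m + n - i) (M₁.mode (l + i) v w₁) w₂ := by
  set ℓ := X.Y 2 X.conformal with hℓ
  obtain ⟨K, hK⟩ := X.divPow_eq_zero v
  obtain ⟨J, hJ⟩ := hn.divPow_eq_zero w₁
  -- For each pair (k, j) the Jacobi identity of `𝒴` will be used for the divided powers L(1)^k v /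
  -- k! and L(1)^j w₁ / j! at indices (l, `m' k`, `n' j`), which result from reflecting m and n
  -- under x ↦ x^{-1}. The factor `φ` collects the signs common to all pairs.
  set m' : ℕ → ℤ := fun k => 2 * d - k - l - m - 2 with hm'
  set n' : ℕ → ℂ := fun j => 2 * μ - l - n - 2 - j with hn'
  set φ : ℂ := oppPhase μ * ((d.negOnePow : ℤ) : ℂ) with hφ
  -- the right-hand side
  have hR : (∑ᶠ i : ℕ, cchoose m i • Z (m + n - i) (M₁.mode (l + i) v w₁) w₂)
      = -(((l.negOnePow : ℤ) : ℂ) * φ) • ∑ k ∈ range K, ∑ j ∈ range J,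
        ∑ᶠ t : ℕ, cchoose (m' k) t • 𝒴 (m' k + n' j - t)
          (M₁.mode (l + t) (divPow ℓ k v) (divPow (M₁.L 1) j w₁)) w₂ := by
    obtain ⟨I, hI⟩ := M₁.exists_bound l v w₁
    obtain ⟨P, hP⟩ := exists_forall_lt_bound
      (fun i : ℕ => hn.divPow_eq_zero (M₁.mode (l + i) v w₁)) I
    obtain ⟨T, hT⟩ := exists_forall_lt_bound
      (P := fun k t => ∀ j, j < J →
        M₁.mode (l + t) (divPow ℓ k v) (divPow (M₁.L 1) j w₁) = 0)
      (fun k => (exists_forall_lt_bound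
        (fun j : ℕ => M₁.exists_bound l (divPow ℓ k v) (divPow (M₁.L 1) j w₁)) J).imp
        fun B hB t ht j hj => hB j hj t ht) K
    -- With `c₀`, the index of `𝒴` depends only on the total degree, so terms of equal degree can be
    -- grouped. The minus sign and (-1)^l in `ψ` come from the weight d + μ - l - i - 1 of v_{l+i}
    -- w₁, on which the phase of `Z` depends.
    set c₀ : ℂ := 2 * d + 2 * μ - 2 * l - m - n - 4 with hc₀
    set ψ : ℂ := -(((l.negOnePow : ℤ) : ℂ) * φ) with hψ
    have hz : ∀ i p : ℕ, I + P ≤ i + p → divPow (M₁.L 1) p (M₁.mode (l + i) v w₁) = 0 := by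
      intro i p hip
      by_cases hi : i < I
      · exact hP i hi p (by omega)
      · rw [hI i (by omega), map_zero]
    have h1 : ∀ i : ℕ, cchoose m i • Z (m + n - i) (M₁.mode (l + i) v w₁) w₂
        = ∑ᶠ p : ℕ, ψ • ((-1) ^ i * cchoose m i) • 𝒴 (c₀ - (i + p : ℕ))
          (divPow (M₁.L 1) p (M₁.mode (l + i) v w₁)) w₂ := by
      intro i
      rw [hZ _ _ (M₁.mode_mem_weight hv hw₁ (l + i)), smul_finsum]
      refine finsum_congr fun p => ?_
      rw [smul_smul, smul_smul, show (d : ℂ) + μ - ((l + i : ℤ) : ℂ) - 1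
        = μ + (d - l - ((i + 1 : ℕ) : ℤ) : ℤ) by push_cast; ring, oppPhase_add_int,
        negOnePow_sub_nat_complex, Int.negOnePow_sub]
      rw [show 2 * (μ + ((d - l - ((i + 1 : ℕ) : ℤ) : ℤ) : ℂ)) - p - (m + n - i) - 2
        = c₀ - (i + p : ℕ) by rw [hc₀]; push_cast; ring]
      congr 1
      rw [hψ, hφ, pow_succ]
      push_cast
      ring
    have hG : ∀ k t j : ℕ, K ≤ k ∨ T ≤ t ∨ J ≤ j →
        M₁.mode (l + t) (divPow ℓ k v) (divPow (M₁.L 1) j w₁) = 0 := by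
      intro k t j hktj
      by_cases hk : k < K
      · by_cases hj : j < J
        · exact hT k hk t (by omega) j hj
        · rw [hJ j (by omega), map_zero]
      · rw [hK k (by omega), map_zero, LinearMap.zero_apply]
    set G : ℕ → ℕ → ℕ → M₃ := fun k t j => ψ • cchoose (m' k) t • 𝒴 (c₀ - (k + t + j : ℕ))
      (M₁.mode (l + t) (divPow ℓ k v) (divPow (M₁.L 1) j w₁)) w₂ with hGdef
    have hG0 : ∀ k t j : ℕ, K ≤ k ∨ T ≤ t ∨ J ≤ j → G k t j = 0 := by
      intro k t j hktj
      simp only [hGdef]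
      rw [hG k t j hktj, map_zero, LinearMap.zero_apply, smul_zero, smul_zero]
    have h2 : ∀ N : ℕ, (∑ p ∈ antidiagonal N, ψ • ((-1) ^ p.1 * cchoose m p.1) •
          𝒴 (c₀ - (p.1 + p.2 : ℕ)) (divPow (M₁.L 1) p.2 (M₁.mode (l + p.1) v w₁)) w₂)
        = ∑ p ∈ antidiagonal N, ∑ q ∈ antidiagonal p.1, G q.1 q.2 p.2 := by
      intro N
      have hk := congrArg (fun x => ψ • 𝒴 (c₀ - N) x w₂)
        (LinearMap.congr_fun (M₁.sum_divPow_L_one_mode hv l m N) w₁)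
      simp only [LinearMap.sum_apply, map_sum, smul_sum, LinearMap.smul_apply, map_smul,
        Module.End.mul_apply] at hk
      refine Eq.trans (sum_congr rfl fun p hp => ?_) (hk.trans (sum_congr rfl fun p hp =>
        sum_congr rfl fun q hq => ?_))
      · rw [HasAntidiagonal.mem_antidiagonal] at hp
        rw [hp]
      · rw [HasAntidiagonal.mem_antidiagonal] at hp hq
        simp only [hGdef]
        rw [hq, hp]
    rw [finsum_congr h1, finsum_finsum_antidiagonal (B := I + P) fun i p hip => by
        rw [hz i p hip, map_zero, LinearMap.zero_apply, smul_zero, smul_zero],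
      finsum_congr h2,
      ← finsum_finsum_antidiagonal (f := fun s j => ∑ q ∈ antidiagonal s, G q.1 q.2 j)
        (B := K + T + J) fun s j hsj => sum_eq_zero fun q hq => hG0 _ _ _ (by
          rw [HasAntidiagonal.mem_antidiagonal] at hq
          omega),
      finsum_finsum_comm (B := K + T + J) fun s j hsj => sum_eq_zero fun q hq => hG0 _ _ _ (by
          rw [HasAntidiagonal.mem_antidiagonal] at hq
          omega)]
    have h3 : ∀ j : ℕ, (∑ᶠ s : ℕ, ∑ q ∈ antidiagonal s, G q.1 q.2 j)
        = ∑ k ∈ range K, ∑ᶠ t : ℕ, G k t j := by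
      intro j
      rw [← finsum_finsum_antidiagonal (f := fun k t => G k t j) (B := K + T) fun k t hkt =>
          hG0 _ _ _ (by omega),
        finsum_eq_sum_range (B := K) fun k hk => finsum_eq_zero_of_forall_eq_zero fun t =>
          hG0 _ _ _ (Or.inl hk)]
    rw [finsum_congr h3, finsum_eq_sum_range (B := J) fun j hj => sum_eq_zero fun k _ =>
      finsum_eq_zero_of_forall_eq_zero fun t => hG0 _ _ _ (by omega), sum_comm, smul_sum]
    refine sum_congr rfl fun k _ => ?_
    rw [smul_sum]
    refine sum_congr rfl fun j _ => ?_
    rw [smul_finsum]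
    refine finsum_congr fun t => ?_
    simp only [hGdef]
    rw [show c₀ - ((k + t + j : ℕ) : ℂ) = m' k + n' j - t by
      rw [hc₀, hm', hn']; push_cast; ring]
  have hZ₂' : ∀ (q : ℤ) (w : M₂), Z₂ q v w = ∑ k ∈ range K, ((d.negOnePow : ℤ) : ℂ) •
      M₂.mode (2 * d - k - q - 2) (divPow ℓ k v) w := fun q w => by
    rw [hZ₂ d v hv, finsum_eq_sum_range (B := K) fun k hk => by
      rw [← hℓ, hK k hk, map_zero, LinearMap.zero_apply, smul_zero]]
  have hZ₃' : ∀ (q : ℤ) (w : M₃), Z₃ q v w = ∑ k ∈ range K, ((d.negOnePow : ℤ) : ℂ) •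
      M₃.mode (2 * d - k - q - 2) (divPow ℓ k v) w := fun q w => by
    rw [hZ₃ d v hv, finsum_eq_sum_range (B := K) fun k hk => by
      rw [← hℓ, hK k hk, map_zero, LinearMap.zero_apply, smul_zero]]
  have hZ' : ∀ (q : ℂ) (w : M₂), Z q w₁ w = ∑ j ∈ range J, oppPhase μ •
      𝒴 (2 * μ - j - q - 2) (divPow (M₁.L 1) j w₁) w := fun q w => by
    rw [hZ μ w₁ hw₁, finsum_eq_sum_range (B := J) fun k hk => by
      rw [hJ k hk, map_zero, LinearMap.zero_apply, smul_zero]]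
  have hL₁ : (∑ᶠ i : ℕ, ((-1) ^ i * cchoose l i) • Z (n + i) w₁ (Z₂ (m + l - i) v w₂))
      = φ • ∑ k ∈ range K, ∑ j ∈ range J, ∑ᶠ i : ℕ, ((-1) ^ i * cchoose l i) •
        𝒴 (n' j + l - i) (divPow (M₁.L 1) j w₁) (M₂.mode (m' k + i) (divPow ℓ k v) w₂) := by
    have h1 : ∀ i : ℕ, ((-1) ^ i * cchoose l i) • Z (n + i) w₁ (Z₂ (m + l - i) v w₂)
        = φ • ∑ k ∈ range K, ∑ j ∈ range J, ((-1) ^ i * cchoose l i) •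
          𝒴 (n' j + l - i) (divPow (M₁.L 1) j w₁) (M₂.mode (m' k + i) (divPow ℓ k v) w₂) := by
      intro i
      rw [hZ₂', map_sum, smul_sum, smul_sum]
      refine sum_congr rfl fun k _ => ?_
      rw [map_smul, hZ', smul_sum, smul_sum, smul_sum]
      refine sum_congr rfl fun j _ => ?_
      rw [show 2 * μ - j - (n + i) - 2 = n' j + l - i by rw [hn']; ring,
        show 2 * d - k - (m + l - i) - 2 = m' k + i by rw [hm']; ring]
      module
    have hz : ∀ k j : ℕ, (fun i : ℕ => ((-1 : ℂ) ^ i * cchoose l i) •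
          𝒴 (n' j + l - i) (divPow (M₁.L 1) j w₁)
            (M₂.mode (m' k + i) (divPow ℓ k v) w₂)).HasFiniteSupport := by
      intro k j
      obtain ⟨B, hB⟩ := M₂.exists_bound (m' k) (divPow ℓ k v) w₂
      exact finite_support_of_eventually_zero (B := B) fun i hi => by
        rw [hB i hi, map_zero, smul_zero]
    rw [finsum_congr h1, ← smul_finsum, finsum_sum_comm _ _ fun k _ => ?_]
    · congr 1
      exact sum_congr rfl fun k _ => finsum_sum_comm _ _ fun j _ => hz k j
    · exact hasFiniteSupport_sum _ fun j => hz k j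
  have hL₂ : (∑ᶠ i : ℕ, ((-1) ^ i * cchoose l i) • Z₃ (m + i) v (Z (n + l - i) w₁ w₂))
      = φ • ∑ k ∈ range K, ∑ j ∈ range J, ∑ᶠ i : ℕ, ((-1) ^ i * cchoose l i) •
        M₃.mode (m' k + l - i) (divPow ℓ k v) (𝒴 (n' j + i) (divPow (M₁.L 1) j w₁) w₂) := by
    have h1 : ∀ i : ℕ, ((-1) ^ i * cchoose l i) • Z₃ (m + i) v (Z (n + l - i) w₁ w₂)
        = φ • ∑ k ∈ range K, ∑ j ∈ range J, ((-1) ^ i * cchoose l i) •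
          M₃.mode (m' k + l - i) (divPow ℓ k v) (𝒴 (n' j + i) (divPow (M₁.L 1) j w₁) w₂) := by
      intro i
      rw [hZ₃', smul_sum, smul_sum]
      refine sum_congr rfl fun k _ => ?_
      rw [hZ', map_sum, smul_sum, smul_sum, smul_sum]
      refine sum_congr rfl fun j _ => ?_
      rw [map_smul, show 2 * μ - j - (n + l - i) - 2 = n' j + i by rw [hn']; ring,
        show 2 * d - k - (m + i) - 2 = m' k + l - i by rw [hm']; ring]
      module
    have hz : ∀ k j : ℕ, (fun i : ℕ => ((-1 : ℂ) ^ i * cchoose l i) •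
          M₃.mode (m' k + l - i) (divPow ℓ k v)
            (𝒴 (n' j + i) (divPow (M₁.L 1) j w₁) w₂)).HasFiniteSupport := by
      intro k j
      obtain ⟨B, hB⟩ := h.exists_bound (n' j) (divPow (M₁.L 1) j w₁) w₂
      exact finite_support_of_eventually_zero (B := B) fun i hi => by
        rw [hB i hi, map_zero, smul_zero]
    rw [finsum_congr h1, ← smul_finsum, finsum_sum_comm _ _ fun k _ => ?_]
    · congr 1
      exact sum_congr rfl fun k _ => finsum_sum_comm _ _ fun j _ => hz k j
    · exact hasFiniteSupport_sum _ fun j => hz k j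
  rw [hL₁, hL₂, hR, smul_smul, smul_sum, smul_sum, smul_sum, ← sum_sub_distrib]
  refine sum_congr rfl fun k _ => ?_
  rw [smul_sum, smul_sum, smul_sum, ← sum_sub_distrib]
  refine sum_congr rfl fun j _ => ?_
  rw [← h.jacobi_complex (divPow ℓ k v) (divPow (M₁.L 1) j w₁) w₂ l (m' k) (n' j), smul_sub,
    smul_smul, neg_mul, mul_right_comm, negOnePow_mul_self_complex]
  module

end

end Opposite

/-! ### Weights, truncation, derivative and involutivity of opposite operators. -/

section OppositeProperties

variable {V : Type u} [AddCommGroup V] [Module ℂ V] {X : VOA V}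

theorem VOA.L_one_vacuum (X : VOA V) : X.Y 2 X.conformal X.vacuum = 0 :=
  X.creation_nonneg _ 2 (by norm_num)

theorem divPow_apply_eq_zero {M : Type*} [AddCommGroup M] [Module ℂ M] {a : Module.End ℂ M}
    {w : M} (h : a w = 0) {k : ℕ} (hk : 1 ≤ k) : divPow a k w = 0 := by
  obtain ⟨j, rfl⟩ := Nat.exists_eq_add_of_le' hk
  rw [divPow_apply, pow_succ, Module.End.mul_apply, h, map_zero, smul_zero]

theorem divPow_comm {M : Type*} [AddCommGroup M] [Module ℂ M] (a : Module.End ℂ M) (j k : ℕ)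
    (w : M) : divPow a j (divPow a k w) = divPow a k (divPow a j w) := by
  rw [← Module.End.mul_apply, ← Module.End.mul_apply, divPow_mul, divPow_mul, add_comm k j,
    Nat.choose_symm_add]

/-- The standard sl₂ computation from [L(1), L(-1)] = 2L(0), by induction on k, with L(1)^k w of
weight μ - k. -/
theorem WeakModule.divPow_L_one_L_neg_one (M : WeakModule X) {μ : ℂ} {w : M}
    (hw : w ∈ M.weight μ) (k : ℕ) :
    divPow (M.L 1) (k + 1) (M.L (-1) w)
      = M.L (-1) (divPow (M.L 1) (k + 1) w) + (2 * μ - k) • divPow (M.L 1) k w := by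
  induction k with
  | zero =>
    rw [zero_add, divPow_one, divPow_zero, M.L_one_L_neg_one, WeakModule.mem_weight.mp hw]
    simp [smul_smul]
  | succ k ih =>
    have hk : ((k + 1 : ℕ) : ℂ) + 1 ≠ 0 := Nat.cast_add_one_ne_zero _
    have e1 := fun x : M => LinearMap.congr_fun (succ_smul_divPow_succ' (M.L 1) (k + 1)) x
    have e2 := LinearMap.congr_fun (succ_smul_divPow_succ' (M.L 1) k) w
    simp only [LinearMap.smul_apply, Module.End.mul_apply] at e1 e2
    refine smul_right_injective _ hk ?_
    change (((k + 1 : ℕ) : ℂ) + 1) • _ = (((k + 1 : ℕ) : ℂ) + 1) • _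
    rw [e1, ih, smul_add, ← map_smul (M.L (-1)), e1, map_add, M.L_one_L_neg_one, map_smul, ← e2,
      WeakModule.mem_weight.mp (M.divPow_L_one_mem_weight hw (k + 1))]
    push_cast
    module

variable {M₁ M₂ M₃ : WeakModule X} {𝒴 Z : ℂ → M₁ →ₗ[ℂ] M₂ →ₗ[ℂ] M₃}

theorem IsOpposite.apply_eq_sum (hZ : IsOpposite 𝒴 Z) {μ : ℂ} {w₁ : M₁}
    (hw₁ : w₁ ∈ M₁.weight μ) {B : ℕ} (hB : ∀ k, B ≤ k → divPow (M₁.L 1) k w₁ = 0) (n : ℂ)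
    (w₂ : M₂) : Z n w₁ w₂
      = ∑ k ∈ range B, oppPhase μ • 𝒴 (2 * μ - k - n - 2) (divPow (M₁.L 1) k w₁) w₂ := by
  rw [hZ μ w₁ hw₁]
  exact finsum_eq_sum_range fun k hk => by
    rw [hB k hk, map_zero, LinearMap.zero_apply, smul_zero]

theorem IsOpposite.mem_weight (h : IsIntertwining M₁ M₂ M₃ 𝒴) (hn : M₁.LOneNilpotent)
    (hZ : IsOpposite 𝒴 Z) {μ ν : ℂ} {w₁ : M₁} {w₂ : M₂} (hw₁ : w₁ ∈ M₁.weight μ)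
    (hw₂ : w₂ ∈ M₂.weight ν) (n : ℂ) : Z n w₁ w₂ ∈ M₃.weight (ν - μ + n + 1) := by
  obtain ⟨B, hB⟩ := hn.divPow_eq_zero w₁
  rw [hZ.apply_eq_sum hw₁ hB]
  refine Submodule.sum_mem _ fun k _ => Submodule.smul_mem _ _ ?_
  have := h.mem_weight (M₁.divPow_L_one_mem_weight hw₁ k) hw₂ (2 * μ - k - n - 2)
  rwa [show μ - k + ν - (2 * μ - k - n - 2) - 1 = ν - μ + n + 1 by ring] at this

/-- The substitution x ↦ x^{-1} reverses the direction of truncation, so the coefficients vanish for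
indices going to -∞. -/
theorem IsOpposite.exists_bound (h : IsIntertwining M₁ M₂ M₃ 𝒴) (hs : ⨆ μ, M₁.weight μ = ⊤)
    (hn : M₁.LOneNilpotent) (hZ : IsOpposite 𝒴 Z) (n : ℂ) (w₁ : M₁) (w₂ : M₂) :
    ∃ B : ℕ, ∀ i : ℕ, B ≤ i → Z (n - i) w₁ w₂ = 0 := by
  refine WeakModule.induction_weight hs
    (p := fun w₁ => ∃ B : ℕ, ∀ i : ℕ, B ≤ i → Z (n - i) w₁ w₂ = 0) w₁ ?_ ?_ ?_
  · intro μ w₁ hw₁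
    obtain ⟨K, hK⟩ := hn.divPow_eq_zero w₁
    obtain ⟨B, hB⟩ := exists_forall_lt_bound
      (fun k : ℕ => h.exists_bound (2 * μ - k - n - 2) (divPow (M₁.L 1) k w₁) w₂) K
    refine ⟨B, fun i hi => ?_⟩
    rw [hZ.apply_eq_sum hw₁ hK]
    refine sum_eq_zero fun k hk => ?_
    rw [show 2 * μ - k - (n - i) - 2 = 2 * μ - k - n - 2 + i by ring,
      hB k (mem_range.mp hk) i hi, smul_zero]
  · exact ⟨0, fun i _ => by rw [map_zero, LinearMap.zero_apply]⟩
  · rintro x y ⟨B, hB⟩ ⟨B', hB'⟩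
    exact ⟨max B B', fun i hi => by
      rw [map_add, LinearMap.add_apply, hB i (le_of_max_le_left hi), hB' i (le_of_max_le_right hi),
        add_zero]⟩

/-- Commuting L(-1) past L(1)^k contributes 2μ - k, and the derivative property of `𝒴` contributes
2μ - k - n. The phase changes sign when the weight goes up by one, and the difference of the two
factors leaves -n. -/
theorem IsOpposite.derivative (h : IsIntertwining M₁ M₂ M₃ 𝒴) (hs : ⨆ μ, M₁.weight μ = ⊤)
    (hn : M₁.LOneNilpotent) (hZ : IsOpposite 𝒴 Z) (n : ℂ) (w₁ : M₁) (w₂ : M₂) :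
    Z n (M₁.L (-1) w₁) w₂ = -n • Z (n - 1) w₁ w₂ := by
  refine WeakModule.induction_weight hs
    (p := fun w₁ => Z n (M₁.L (-1) w₁) w₂ = -n • Z (n - 1) w₁ w₂) w₁ ?_ ?_ ?_
  · intro μ w hw
    obtain ⟨B, hB⟩ := hn.divPow_eq_zero w
    have hB' : ∀ k, B + 1 ≤ k → divPow (M₁.L 1) k (M₁.L (-1) w) = 0 := by
      intro k hk
      obtain ⟨j, rfl⟩ := Nat.exists_eq_add_of_le' (show 1 ≤ k by omega)
      rw [M₁.divPow_L_one_L_neg_one hw, hB _ (by omega), hB j (by omega), map_zero, smul_zero,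
        add_zero]
    have hph : oppPhase (μ + 1) = -oppPhase μ := by
      have := oppPhase_add_int μ 1
      simpa using this
    rw [hZ.apply_eq_sum (M₁.L_neg_one_mem_weight hw) hB', hZ.apply_eq_sum hw hB, sum_range_succ',
      hph]
    have h0 : 𝒴 (2 * (μ + 1) - ((0 : ℕ) : ℂ) - n - 2) (divPow (M₁.L 1) 0 (M₁.L (-1) w)) w₂
        = -(2 * μ - n) • 𝒴 (2 * μ - n - 1) (divPow (M₁.L 1) 0 w) w₂ := by
      rw [divPow_zero, Module.End.one_apply, h.derivative]
      simp only [Module.End.one_apply]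
      rw [show 2 * (μ + 1) - ((0 : ℕ) : ℂ) - n - 2 = 2 * μ - n by push_cast; ring]
    have hk : ∀ k : ℕ, 𝒴 (2 * (μ + 1) - ((k + 1 : ℕ) : ℂ) - n - 2)
          (divPow (M₁.L 1) (k + 1) (M₁.L (-1) w)) w₂
        = -(2 * μ - (k + 1 : ℕ) - n) • 𝒴 (2 * μ - (k + 1 : ℕ) - n - 1)
            (divPow (M₁.L 1) (k + 1) w) w₂
          + (2 * μ - k) • 𝒴 (2 * μ - k - n - 1) (divPow (M₁.L 1) k w) w₂ := by
      intro k
      rw [M₁.divPow_L_one_L_neg_one hw, map_add, LinearMap.add_apply, h.derivative, map_smul,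
        LinearMap.smul_apply,
        show 2 * (μ + 1) - ((k + 1 : ℕ) : ℂ) - n - 2 = 2 * μ - (k + 1 : ℕ) - n by ring]
      congr 3
      push_cast
      ring_nf
    have hsum := sum_range_succ' (fun k : ℕ => (-oppPhase μ) • (-(2 * μ - k - n)) •
        𝒴 (2 * μ - k - n - 1) (divPow (M₁.L 1) k w) w₂) B
    rw [sum_range_succ, hB B le_rfl, map_zero, LinearMap.zero_apply, smul_zero, smul_zero,
      add_zero] at hsum
    have h0' : (-oppPhase μ) • 𝒴 (2 * (μ + 1) - ((0 : ℕ) : ℂ) - n - 2)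
          (divPow (M₁.L 1) 0 (M₁.L (-1) w)) w₂
        = (-oppPhase μ) • (-(2 * μ - ((0 : ℕ) : ℂ) - n)) •
          𝒴 (2 * μ - ((0 : ℕ) : ℂ) - n - 1) (divPow (M₁.L 1) 0 w) w₂ := by
      rw [h0]
      simp
    rw [h0', sum_congr rfl fun k _ => by rw [hk k, smul_add], sum_add_distrib, add_right_comm,
      ← hsum, ← sum_add_distrib, smul_sum]
    refine sum_congr rfl fun k _ => ?_
    rw [show 2 * μ - k - (n - 1) - 2 = 2 * μ - k - n - 1 by ring]
    module
  · simp
  · intro x y hx hy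
    rw [map_add, map_add, map_add, LinearMap.add_apply, LinearMap.add_apply, hx, hy, smul_add]

theorem WeakModule.IsOppositeMode.apply_eq_sum {M : WeakModule X} {Z : ℤ → V →ₗ[ℂ] M →ₗ[ℂ] M}
    (hZ : M.IsOppositeMode Z) {d : ℤ} {v : V} (hv : v ∈ X.weight d) {B : ℕ}
    (hB : ∀ k, B ≤ k → divPow (X.Y 2 X.conformal) k v = 0) (n : ℤ) (w : M) :
    Z n v w = ∑ k ∈ range B, ((d.negOnePow : ℤ) : ℂ) •
      M.mode (2 * d - k - n - 2) (divPow (X.Y 2 X.conformal) k v) w := by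
  rw [hZ d v hv]
  exact finsum_eq_sum_range fun k hk => by
    rw [hB k hk, map_zero, LinearMap.zero_apply, smul_zero]

/-- The opposite of the vertex operator with complex indices restricts to the opposite vertex
operator. -/
theorem WeakModule.IsOppositeMode.eq_of_isOpposite {M : WeakModule X}
    {Z : ℤ → V →ₗ[ℂ] M →ₗ[ℂ] M} (hZ : M.IsOppositeMode Z)
    {Zc : ℂ → X.adjoint →ₗ[ℂ] M →ₗ[ℂ] M} (hZc : IsOpposite (M₁ := X.adjoint) M.extMode Zc)
    (n : ℤ) (v : V) (w : M) : Zc n v w = Z n v w := by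
  have key : ∀ d : ℤ, ∀ v ∈ X.weight d, Zc n v w = Z n v w := by
    intro d v hv
    refine (hZc d v hv n w).trans (Eq.trans (finsum_congr fun k => ?_) (hZ d v hv n w).symm)
    rw [oppPhase_intCast, M.extMode_of_eq (m := 2 * d - k - n - 2) (by push_cast; ring)]
    rfl
  let Zn : V →ₗ[ℂ] M →ₗ[ℂ] M := Zc n
  refine X.induction_weight (p := fun v => Zn v w = Z n v w) v key (by simp) fun x y hx hy => ?_
  rw [map_add, map_add, LinearMap.add_apply, LinearMap.add_apply, hx, hy]

theorem WeakModule.IsOppositeMode.exists_bound {M : WeakModule X} {Z : ℤ → V →ₗ[ℂ] M →ₗ[ℂ] M}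
    (hZ : M.IsOppositeMode Z) (n : ℤ) (v : V) (w : M) :
    ∃ B : ℕ, ∀ i : ℕ, B ≤ i → Z (n - i) v w = 0 := by
  obtain ⟨Zc, hZc⟩ := exists_isOpposite (M₁ := X.adjoint) (M₂ := M) (M₃ := M)
    X.adjoint_iSup_weight X.adjoint_LOneNilpotent M.extMode
  obtain ⟨B, hB⟩ := hZc.exists_bound M.isIntertwining_extMode X.adjoint_iSup_weight
    X.adjoint_LOneNilpotent n v w
  refine ⟨B, fun i hi => ?_⟩
  rw [← hZ.eq_of_isOpposite hZc, ← hB i hi]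
  push_cast
  rfl

theorem WeakModule.IsOppositeMode.mem_weight {M : WeakModule X} {Z : ℤ → V →ₗ[ℂ] M →ₗ[ℂ] M}
    (hZ : M.IsOppositeMode Z) {d : ℤ} {v : V} (hv : v ∈ X.weight d) {ν : ℂ} {w : M}
    (hw : w ∈ M.weight ν) (n : ℤ) : Z n v w ∈ M.weight (ν - d + n + 1) := by
  obtain ⟨B, hB⟩ := X.divPow_eq_zero v
  rw [hZ.apply_eq_sum hv hB]
  refine Submodule.sum_mem _ fun k _ => Submodule.smul_mem _ _ ?_
  have := M.mode_mem_weight (X.divPow_L_one_mem_weight hv k) hw (2 * d - k - n - 2)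
  convert this using 2
  push_cast
  ring

theorem WeakModule.IsOppositeMode.derivative {M : WeakModule X} {Z : ℤ → V →ₗ[ℂ] M →ₗ[ℂ] M}
    (hZ : M.IsOppositeMode Z) (n : ℤ) (v : V) (w : M) :
    Z n (X.Y 0 X.conformal v) w = -(n : ℂ) • Z (n - 1) v w := by
  obtain ⟨Zc, hZc⟩ := exists_isOpposite (M₁ := X.adjoint) (M₂ := M) (M₃ := M)
    X.adjoint_iSup_weight X.adjoint_LOneNilpotent M.extMode
  rw [← hZ.eq_of_isOpposite hZc, ← hZ.eq_of_isOpposite hZc]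
  refine (hZc.derivative M.isIntertwining_extMode X.adjoint_iSup_weight
    X.adjoint_LOneNilpotent n v w).trans ?_
  push_cast
  rfl

theorem WeakModule.IsOppositeMode.vacuum {M : WeakModule X} {Z : ℤ → V →ₗ[ℂ] M →ₗ[ℂ] M}
    (hZ : M.IsOppositeMode Z) (n : ℤ) (w : M) :
    Z n X.vacuum w = if n = -1 then w else 0 := by
  have hv : X.vacuum ∈ X.weight 0 := by
    rw [VOA.mem_weight]
    simpa using Module.End.mem_eigenspace_iff.mp X.vacuum_mem
  rw [hZ.apply_eq_sum hv (B := 1) fun k hk => divPow_apply_eq_zero X.L_one_vacuum hk]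
  simp only [sum_range_one, divPow_zero, Module.End.one_apply, M.vacuum_mode]
  have : (-n - 2 = -1) ↔ n = -1 := by omega
  simp [this]

/-- Since L(1)ω = 0, only the leading term remains: passing to opposites exchanges L(n) and L(-n).
-/
theorem WeakModule.IsOppositeMode.conformal {M : WeakModule X} {Z : ℤ → V →ₗ[ℂ] M →ₗ[ℂ] M}
    (hZ : M.IsOppositeMode Z) (n : ℤ) (w : M) :
    Z n X.conformal w = M.mode (2 - n) X.conformal w := by
  rw [hZ.apply_eq_sum X.conformal_mem_weight (B := 1) fun k hk =>
    divPow_apply_eq_zero X.L_one_conformal hk]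
  simp only [sum_range_one, divPow_zero, Module.End.one_apply]
  rw [Int.negOnePow_even 2 (by decide), show 2 * 2 - ((0 : ℕ) : ℤ) - n - 2 = 2 - n by
    push_cast; ring]
  simp

/-- Passing to the opposite vertex operators is an involution. -/
theorem WeakModule.IsOppositeMode.involutive {M : WeakModule X} {Z : ℤ → V →ₗ[ℂ] M →ₗ[ℂ] M}
    (hZ : M.IsOppositeMode Z) {d : ℤ} {v : V} (hv : v ∈ X.weight d) (n : ℤ) (w : M) :
    M.mode n v w = ∑ᶠ k : ℕ, ((d.negOnePow : ℤ) : ℂ) •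
      Z (2 * d - k - n - 2) (divPow (X.Y 2 X.conformal) k v) w := by
  set ℓ := X.Y 2 X.conformal with hℓ
  obtain ⟨B, hB⟩ := X.divPow_eq_zero v
  have hz : ∀ k j : ℕ, B ≤ k + j → divPow ℓ k (divPow ℓ j v) = 0 := by
    intro k j hkj
    rw [← Module.End.mul_apply, divPow_mul, LinearMap.smul_apply, hB _ hkj, smul_zero]
  -- L(1)^k v has weight d - k, so the two parity signs multiply to (-1)^k. Hence e^{L(1)} is
  -- composed with e^{-L(1)}, and only total degree zero survives.
  have h1 : ∀ k : ℕ, ((d.negOnePow : ℤ) : ℂ) • Z (2 * d - k - n - 2) (divPow ℓ k v) w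
      = ∑ᶠ j : ℕ, (-1 : ℂ) ^ k • M.mode (n - (k + j : ℕ)) (divPow ℓ k (divPow ℓ j v)) w := by
    intro k
    rw [hZ _ _ (X.divPow_L_one_mem_weight hv k), smul_finsum]
    refine finsum_congr fun j => ?_
    rw [smul_smul, negOnePow_sub_nat_complex, ← mul_assoc, negOnePow_mul_self_complex, one_mul,
      divPow_comm, show 2 * (d - k) - j - (2 * d - k - n - 2) - 2 = n - (k + j : ℕ) by
        push_cast; ring]
  rw [finsum_congr h1, finsum_finsum_antidiagonal (B := B) fun k j hkj => by
    rw [hz k j hkj, map_zero, LinearMap.zero_apply, smul_zero]]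
  have h2 : ∀ N : ℕ, (∑ p ∈ antidiagonal N, (-1 : ℂ) ^ p.1 •
        M.mode (n - (p.1 + p.2 : ℕ)) (divPow ℓ p.1 (divPow ℓ p.2 v)) w)
      = if N = 0 then M.mode n v w else 0 := by
    intro N
    have hk := congrArg (fun x => M.mode (n - N) x w)
      (LinearMap.congr_fun (sum_antidiagonal_neg_one_pow_divPow ℓ N) v)
    simp only [LinearMap.sum_apply, map_sum, LinearMap.smul_apply, map_smul,
      Module.End.mul_apply] at hk
    refine (sum_congr rfl fun p hp => ?_).trans (hk.trans ?_)
    · rw [HasAntidiagonal.mem_antidiagonal] at hp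
      rw [hp]
    · split_ifs with h0
      · subst h0; simp
      · simp
  rw [finsum_congr h2, finsum_eq_sum_range (B := 1) fun N hN => if_neg (by omega)]
  simp

/-- The Jacobi identity for opposite operators. -/
theorem IsIntertwining.opposite_jacobi (h : IsIntertwining M₁ M₂ M₃ 𝒴)
    (hs : ⨆ μ, M₁.weight μ = ⊤) (hn : M₁.LOneNilpotent) (hZ : IsOpposite 𝒴 Z)
    {Z₂ : ℤ → V →ₗ[ℂ] M₂ →ₗ[ℂ] M₂} (hZ₂ : M₂.IsOppositeMode Z₂)
    {Z₃ : ℤ → V →ₗ[ℂ] M₃ →ₗ[ℂ] M₃} (hZ₃ : M₃.IsOppositeMode Z₃)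
    (v : V) (w₁ : M₁) (w₂ : M₂) (l m : ℤ) (n : ℂ) :
    (∑ᶠ i : ℕ, ((-1) ^ i * cchoose l i) • Z (n + i) w₁ (Z₂ (m + l - i) v w₂))
      - ((l.negOnePow : ℤ) : ℂ) •
        (∑ᶠ i : ℕ, ((-1) ^ i * cchoose l i) • Z₃ (m + i) v (Z (n + l - i) w₁ w₂))
      = ∑ᶠ i : ℕ, cchoose m i • Z (m + n - i) (M₁.mode (l + i) v w₁) w₂ := by
  have f1 : ∀ v w₁, (fun i : ℕ => ((-1 : ℂ) ^ i * cchoose l i) •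
      Z (n + i) w₁ (Z₂ (m + l - i) v w₂)).HasFiniteSupport := by
    intro v w₁
    obtain ⟨B, hB⟩ := hZ₂.exists_bound (m + l) v w₂
    exact finite_support_of_eventually_zero (B := B) fun i hi => by
      rw [hB i hi, map_zero, smul_zero]
  have f2 : ∀ v w₁, (fun i : ℕ => ((-1 : ℂ) ^ i * cchoose l i) •
      Z₃ (m + i) v (Z (n + l - i) w₁ w₂)).HasFiniteSupport := by
    intro v w₁
    obtain ⟨B, hB⟩ := hZ.exists_bound h hs hn (n + l) w₁ w₂
    exact finite_support_of_eventually_zero (B := B) fun i hi => by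
      rw [hB i hi, map_zero, smul_zero]
  have f3 : ∀ v w₁, (fun i : ℕ => cchoose m i •
      Z (m + n - i) (M₁.mode (l + i) v w₁) w₂).HasFiniteSupport := by
    intro v w₁
    obtain ⟨B, hB⟩ := M₁.exists_bound l v w₁
    exact finite_support_of_eventually_zero (B := B) fun i hi => by
      rw [hB i hi, map_zero, LinearMap.zero_apply, smul_zero]
  refine X.induction_weight (p := fun v =>
    (∑ᶠ i : ℕ, ((-1 : ℂ) ^ i * cchoose l i) • Z (n + i) w₁ (Z₂ (m + l - i) v w₂))
      - ((l.negOnePow : ℤ) : ℂ) •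
        (∑ᶠ i : ℕ, ((-1 : ℂ) ^ i * cchoose l i) • Z₃ (m + i) v (Z (n + l - i) w₁ w₂))
      = ∑ᶠ i : ℕ, cchoose m i • Z (m + n - i) (M₁.mode (l + i) v w₁) w₂) v ?_ (by simp) ?_
  · intro d v hv
    refine WeakModule.induction_weight hs (p := fun w₁ =>
      (∑ᶠ i : ℕ, ((-1 : ℂ) ^ i * cchoose l i) • Z (n + i) w₁ (Z₂ (m + l - i) v w₂))
        - ((l.negOnePow : ℤ) : ℂ) •
          (∑ᶠ i : ℕ, ((-1 : ℂ) ^ i * cchoose l i) • Z₃ (m + i) v (Z (n + l - i) w₁ w₂))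
        = ∑ᶠ i : ℕ, cchoose m i • Z (m + n - i) (M₁.mode (l + i) v w₁) w₂) w₁ ?_ (by simp) ?_
    · intro μ w₁ hw₁
      exact h.opposite_jacobi_of_mem hn hZ hZ₂ hZ₃ hv hw₁ w₂ l m n
    · intro x y hx hy
      simp only [map_add, LinearMap.add_apply, smul_add]
      rw [finsum_add_distrib (f1 v x) (f1 v y), finsum_add_distrib (f2 v x) (f2 v y),
        finsum_add_distrib (f3 v x) (f3 v y), ← hx, ← hy, smul_add]
      abel
  · intro x y hx hy
    simp only [map_add, LinearMap.add_apply, smul_add]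
    rw [finsum_add_distrib (f1 x w₁) (f1 y w₁), finsum_add_distrib (f2 x w₁) (f2 y w₁),
      finsum_add_distrib (f3 x w₁) (f3 y w₁), ← hx, ← hy, smul_add]
    abel

theorem WeakModule.IsOppositeMode.jacobi {M : WeakModule X} {Z : ℤ → V →ₗ[ℂ] M →ₗ[ℂ] M}
    (hZ : M.IsOppositeMode Z) (u v : V) (w : M) (l m n : ℤ) :
    (∑ᶠ i : ℕ, ((-1) ^ i * cchoose l i) • Z (n + i) v (Z (m + l - i) u w))
      - ((l.negOnePow : ℤ) : ℂ) •
        (∑ᶠ i : ℕ, ((-1) ^ i * cchoose l i) • Z (m + i) u (Z (n + l - i) v w))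
      = ∑ᶠ i : ℕ, cchoose m i • Z (m + n - i) (X.Y (l + i) u v) w := by
  obtain ⟨Zc, hZc⟩ := exists_isOpposite (M₁ := X.adjoint) (M₂ := M) (M₃ := M)
    X.adjoint_iSup_weight X.adjoint_LOneNilpotent M.extMode
  have e : ∀ (n : ℂ) (q : ℤ) (v : V) (w : M), n = q → Zc n v w = Z q v w := by
    rintro _ q v w rfl
    exact hZ.eq_of_isOpposite hZc q v w
  have hJ := M.isIntertwining_extMode.opposite_jacobi X.adjoint_iSup_weight
    X.adjoint_LOneNilpotent hZc hZ hZ u v w l m n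
  refine Eq.trans (congrArg₂ (· - ·) (finsum_congr fun i => ?_)
    (congrArg _ (finsum_congr fun i => ?_))) (hJ.trans (finsum_congr fun i => ?_))
  · rw [e _ (n + i) _ _ (by push_cast; ring)]
  · rw [e _ (n + l - i) _ _ (by push_cast; ring)]
  · exact congrArg _ (e (m + n - i) (m + n - i) (X.Y (l + i) u v) w (by push_cast; ring))

end OppositeProperties

/-! ### Graded duals and contragredient modules. -/

section Contragredient

variable {V : Type u} [AddCommGroup V] [Module ℂ V] {X : VOA V}

namespace WeakModule

/-- The projection of a graded module onto a homogeneous subspace. -/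
noncomputable def proj (M : WeakModule X) (hM : ⨆ μ, M.weight μ = ⊤) (μ : ℂ) : M →ₗ[ℂ] M :=
  open Classical in
  (M.exists_linearMap hM fun ν => if ν = μ then LinearMap.id else 0).choose

variable {M : WeakModule X}

theorem proj_apply_of_mem (hM : ⨆ μ, M.weight μ = ⊤) {μ : ℂ} {w : M} (hw : w ∈ M.weight μ) :
    M.proj hM μ w = w := by
  classical
  rw [proj, (M.exists_linearMap hM fun ν => if ν = μ then LinearMap.id else 0).choose_spec μ w hw,
    if_pos rfl, LinearMap.id_apply]

theorem proj_apply_of_mem_of_ne (hM : ⨆ μ, M.weight μ = ⊤) {μ ν : ℂ} (h : ν ≠ μ) {w : M}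
    (hw : w ∈ M.weight ν) :
    M.proj hM μ w = 0 := by
  classical
  rw [proj, (M.exists_linearMap hM fun ν => if ν = μ then LinearMap.id else 0).choose_spec ν w hw,
    if_neg h, LinearMap.zero_apply]

theorem proj_mem (hM : ⨆ μ, M.weight μ = ⊤) (μ : ℂ) (w : M) : M.proj hM μ w ∈ M.weight μ := by
  refine induction_weight hM (p := fun w => M.proj hM μ w ∈ M.weight μ) w ?_ ?_ ?_
  · intro ν w hw
    by_cases h : ν = μ
    · subst h
      rwa [proj_apply_of_mem hM hw]
    · rw [proj_apply_of_mem_of_ne hM h hw]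
      exact Submodule.zero_mem _
  · rw [map_zero]
    exact Submodule.zero_mem _
  · intro x y hx hy
    rw [map_add]
    exact Submodule.add_mem _ hx hy

theorem exists_sum_proj (hM : ⨆ μ, M.weight μ = ⊤) (w : M) :
    ∃ t : Finset ℂ, ∀ s : Finset ℂ, t ⊆ s → w = ∑ μ ∈ s, M.proj hM μ w := by
  classical
  refine induction_weight hM
    (p := fun w => ∃ t : Finset ℂ, ∀ s : Finset ℂ, t ⊆ s → w = ∑ μ ∈ s, M.proj hM μ w) w ?_ ?_ ?_
  · intro ν w hw
    refine ⟨{ν}, fun s hs => ?_⟩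
    rw [sum_eq_single ν, proj_apply_of_mem hM hw]
    · intro μ _ hμ
      exact proj_apply_of_mem_of_ne hM hμ.symm hw
    · intro h
      exact absurd (hs (mem_singleton_self ν)) h
  · exact ⟨∅, fun s _ => by simp⟩
  · rintro x y ⟨t, ht⟩ ⟨t', ht'⟩
    refine ⟨t ∪ t', fun s hs => ?_⟩
    conv_lhs => rw [ht s (union_subset_left hs), ht' s (union_subset_right hs)]
    rw [← sum_add_distrib]
    exact sum_congr rfl fun μ _ => (map_add _ _ _).symm

/-- An `L(0)`-stable subspace contains the homogeneous components of its elements. -/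
theorem mem_of_sum_mem {S : Submodule ℂ M} (hS : ∀ w ∈ S, M.L 0 w ∈ S) (t : Finset ℂ) :
    ∀ f : ℂ → M, (∀ μ, f μ ∈ M.weight μ) → ∑ μ ∈ t, f μ ∈ S → ∀ μ ∈ t, f μ ∈ S := by
  classical
  induction t using Finset.induction_on with
  | empty => intro f _ _ μ hμ; simp at hμ
  | insert a t ha ih =>
    intro f hf hsum
    -- L(0) - a kills the component of weight a and multiplies each other component by a nonzero
    -- scalar, which reduces the number of weights.
    have h1 : ∑ μ ∈ t, (μ - a) • f μ ∈ S := by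
      have h2 : M.L 0 (∑ μ ∈ insert a t, f μ) - a • ∑ μ ∈ insert a t, f μ ∈ S :=
        S.sub_mem (hS _ hsum) (S.smul_mem _ hsum)
      rw [map_sum, smul_sum, ← sum_sub_distrib, sum_insert ha, mem_weight.mp (hf a), sub_self,
        zero_add] at h2
      convert h2 using 1
      refine sum_congr rfl fun μ _ => ?_
      rw [mem_weight.mp (hf μ), sub_smul]
    have h3 : ∀ μ ∈ t, f μ ∈ S := by
      intro μ hμ
      have hne : μ - a ≠ 0 := sub_ne_zero.mpr fun h => ha (h ▸ hμ)
      have h4 := ih (fun μ => (μ - a) • f μ) (fun μ => Submodule.smul_mem _ _ (hf μ)) h1 μ hμ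
      have h5 := S.smul_mem (μ - a)⁻¹ h4
      rwa [smul_smul, inv_mul_cancel₀ hne, one_smul] at h5
    intro μ hμ
    rcases mem_insert.mp hμ with rfl | hμ
    · rw [sum_insert ha] at hsum
      have := S.sub_mem hsum (S.sum_mem h3)
      rwa [add_sub_cancel_right] at this
    · exact h3 μ hμ

theorem proj_mem_of_stable (hM : ⨆ μ, M.weight μ = ⊤) {S : Submodule ℂ M}
    (hS : ∀ w ∈ S, M.L 0 w ∈ S) {w : M} (hw : w ∈ S)
    (μ : ℂ) : M.proj hM μ w ∈ S := by
  classical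
  obtain ⟨t, ht⟩ := exists_sum_proj hM w
  have h := ht (insert μ t) (subset_insert μ t)
  rw [h] at hw
  exact mem_of_sum_mem hS _ (fun μ => M.proj hM μ w) (fun μ => proj_mem hM μ w) hw μ
    (mem_insert_self μ t)

theorem ext_proj (hM : ⨆ μ, M.weight μ = ⊤) {w : M} (h : ∀ μ, M.proj hM μ w = 0) : w = 0 := by
  obtain ⟨t, ht⟩ := exists_sum_proj hM w
  rw [ht t (Subset.refl t)]
  exact sum_eq_zero fun μ _ => h μ

/-- The summand `(M_(μ))^*` of the graded dual. -/
def dualWeight (M : WeakModule X) (μ : ℂ) : Submodule ℂ (Module.Dual ℂ M) :=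
  (⨆ ν : ℂ, ⨆ _ : ν ≠ μ, M.weight ν).dualAnnihilator

theorem mem_dualWeight {μ : ℂ} {φ : Module.Dual ℂ M} :
    φ ∈ M.dualWeight μ ↔ ∀ ν, ν ≠ μ → ∀ w ∈ M.weight ν, φ w = 0 := by
  rw [dualWeight, Submodule.mem_dualAnnihilator]
  constructor
  · intro h ν hν w hw
    exact h w (Submodule.mem_iSup_of_mem ν (Submodule.mem_iSup_of_mem hν hw))
  · intro h
    have : (⨆ ν : ℂ, ⨆ _ : ν ≠ μ, M.weight ν) ≤ LinearMap.ker φ :=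
      iSup_le fun ν => iSup_le fun hν w hw => h ν hν w hw
    exact fun w hw => this hw

theorem dualWeight_le_gradedDual (μ : ℂ) : M.dualWeight μ ≤ M.gradedDual :=
  le_iSup (fun μ => M.dualWeight μ) μ

theorem gradedDual_induction {p : Module.Dual ℂ M → Prop} {φ : Module.Dual ℂ M}
    (hφ : φ ∈ M.gradedDual) (h : ∀ μ, ∀ φ ∈ M.dualWeight μ, p φ) (h0 : p 0)
    (hadd : ∀ x y, p x → p y → p (x + y)) : p φ :=
  Submodule.iSup_induction (fun μ => M.dualWeight μ) (motive := p) hφ h h0 hadd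

theorem comp_proj_mem_dualWeight (hM : ⨆ μ, M.weight μ = ⊤) (μ : ℂ) (φ : Module.Dual ℂ M) :
    φ ∘ₗ M.proj hM μ ∈ M.dualWeight μ := by
  rw [mem_dualWeight]
  intro ν hν w hw
  rw [LinearMap.comp_apply, proj_apply_of_mem_of_ne hM hν hw, map_zero]

theorem dual_ext (hM : ⨆ μ, M.weight μ = ⊤) {φ ψ : Module.Dual ℂ M}
    (h : ∀ μ, ∀ w ∈ M.weight μ, φ w = ψ w) : φ = ψ := by
  ext w
  exact induction_weight hM (p := fun w => φ w = ψ w) w h (by simp) fun x y hx hy => by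
    rw [map_add, map_add, hx, hy]

/-- Once the opposite operators exist as linear maps, invariance of the pairing is plain adjointness
and extends from homogeneous v to all of V. -/
theorem isContragredient_iff {N M : WeakModule X} {β : N →ₗ[ℂ] Module.Dual ℂ M}
    {Z : ℤ → V →ₗ[ℂ] M →ₗ[ℂ] M} (hZ : M.IsOppositeMode Z) :
    IsContragredient N M β ↔ Function.Injective β ∧ LinearMap.range β = M.gradedDual ∧
      ∀ (n : ℤ) (v : V) (w' : N) (w : M), β (N.mode n v w') w = β w' (Z n v w) := by
  have key : ∀ (d : ℤ), ∀ v ∈ X.weight d, ∀ (n : ℤ) (w' : N) (w : M),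
      (∑ᶠ k : ℕ, ((k.factorial : ℂ)⁻¹ * ((d.negOnePow : ℤ) : ℂ)) *
            β w' (M.mode (2 * d - k - n - 2) ((X.Y 2 X.conformal ^ k) v) w)) = β w' (Z n v w) := by
    intro d v hv n w' w
    obtain ⟨B, hB⟩ := X.divPow_eq_zero v
    rw [hZ d v hv, map_finsum (β w') (finite_support_of_eventually_zero (B := B) fun k hk => by
      rw [hB k hk, map_zero, LinearMap.zero_apply, smul_zero])]
    refine finsum_congr fun k => ?_
    rw [divPow_apply, map_smul, map_smul, LinearMap.smul_apply, map_smul, smul_eq_mul, smul_eq_mul]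
    ring
  refine and_congr_right fun _ => and_congr_right fun _ => ⟨fun h n v w' w => ?_,
    fun h d v hv n w' w => ?_⟩
  · refine X.induction_weight (p := fun v => β (N.mode n v w') w = β w' (Z n v w)) v ?_ (by simp) ?_
    · intro d v hv
      rw [h d v hv n w' w, key d v hv]
    · intro x y hx hy
      simp only [map_add, LinearMap.add_apply, hx, hy]
  · rw [h, key d v hv]

end WeakModule

open WeakModule

variable {N M : WeakModule X} {β : N →ₗ[ℂ] Module.Dual ℂ M}

namespace WeakModule.IsContragredient

/-- Taking opposites is an involution, so invariance can be read from either side of the pairing. -/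
theorem flip_invariance (h : IsContragredient N M β) {Z : ℤ → V →ₗ[ℂ] N →ₗ[ℂ] N}
    (hZ : N.IsOppositeMode Z) (n : ℤ) (v : V) (w' : N) (w : M) :
    β w' (M.mode n v w) = β (Z n v w') w := by
  obtain ⟨Y, hY⟩ := M.exists_isOppositeMode
  have hinv := ((isContragredient_iff hY).mp h).2.2
  refine X.induction_weight (p := fun v => β w' (M.mode n v w) = β (Z n v w') w) v ?_ (by simp) ?_
  · intro d v hv
    obtain ⟨B, hB⟩ := X.divPow_eq_zero v
    rw [hY.involutive hv, finsum_eq_sum_range (B := B) fun k hk => by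
      rw [hB k hk, map_zero, LinearMap.zero_apply, smul_zero], hZ.apply_eq_sum hv hB, map_sum,
      map_sum, LinearMap.sum_apply]
    refine sum_congr rfl fun k _ => ?_
    rw [map_smul, map_smul, LinearMap.smul_apply, hinv]
  · intro x y hx hy
    simp only [map_add, LinearMap.add_apply, hx, hy]

theorem conformal_mode (h : IsContragredient N M β) (n : ℤ) (w' : N) (w : M) :
    β (N.mode n X.conformal w') w = β w' (M.mode (2 - n) X.conformal w) := by
  obtain ⟨Y, hY⟩ := M.exists_isOppositeMode
  rw [((isContragredient_iff hY).mp h).2.2, hY.conformal]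

theorem L_zero (h : IsContragredient N M β) (w' : N) (w : M) :
    β (N.L 0 w') w = β w' (M.L 0 w) := h.conformal_mode 1 w' w

theorem L_one (h : IsContragredient N M β) (w' : N) (w : M) :
    β (N.L 1 w') w = β w' (M.L (-1) w) := h.conformal_mode 2 w' w

theorem divPow_L_one (h : IsContragredient N M β) (k : ℕ) (w' : N) (w : M) :
    β (divPow (N.L 1) k w') w = β w' (divPow (M.L (-1)) k w) := by
  have hp : ∀ (k : ℕ) (w' : N) (w : M), β ((N.L 1 ^ k) w') w = β w' ((M.L (-1) ^ k) w) := by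
    intro k
    induction k with
    | zero => intro w' w; rfl
    | succ k ih =>
      intro w' w
      rw [pow_succ, Module.End.mul_apply, ih, h.L_one, pow_succ', Module.End.mul_apply]
  rw [divPow_apply, divPow_apply, map_smul, LinearMap.smul_apply, map_smul, hp]

/-- L(0) is self-adjoint for the pairing, so distinct eigenvalues give orthogonal weight spaces. -/
theorem apply_eq_zero (h : IsContragredient N M β) {μ ν : ℂ} (hne : μ ≠ ν) {w' : N} {w : M}
    (hw' : w' ∈ N.weight μ) (hw : w ∈ M.weight ν) : β w' w = 0 := by
  have h1 := h.L_zero w' w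
  rw [mem_weight.mp hw', mem_weight.mp hw, map_smul, LinearMap.smul_apply, map_smul, smul_eq_mul,
    smul_eq_mul] at h1
  have h2 : (μ - ν) * β w' w = 0 := by rw [sub_mul, h1, sub_self]
  exact (mul_eq_zero.mp h2).resolve_left (sub_ne_zero.mpr hne)

theorem mem_weight_iff (h : IsContragredient N M β) (hM : ⨆ μ, M.weight μ = ⊤) {μ : ℂ} {w' : N} :
    w' ∈ N.weight μ ↔ β w' ∈ M.dualWeight μ := by
  rw [mem_dualWeight]
  refine ⟨fun hw' ν hν w hw => h.apply_eq_zero hν.symm hw' hw, fun hw' => ?_⟩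
  rw [WeakModule.mem_weight]
  refine h.1 (dual_ext hM fun ν w hw => ?_)
  rw [h.L_zero, mem_weight.mp hw, map_smul, map_smul, LinearMap.smul_apply]
  by_cases hν : ν = μ
  · rw [hν]
  · rw [hw' ν hν w hw, smul_zero, smul_zero]

theorem iSup_weight (h : IsContragredient N M β) (hM : ⨆ μ, M.weight μ = ⊤) :
    ⨆ μ, N.weight μ = ⊤ := by
  rw [eq_top_iff]
  intro w' _
  have hw' : β w' ∈ M.gradedDual := h.2.1 ▸ LinearMap.mem_range_self β w'
  have hex : ∃ y ∈ ⨆ μ, N.weight μ, β y = β w' := by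
    refine gradedDual_induction (p := fun φ => ∃ y ∈ ⨆ μ, N.weight μ, β y = φ) hw' ?_ ?_ ?_
    · intro μ φ hφ
      obtain ⟨y, rfl⟩ : φ ∈ LinearMap.range β := h.2.1 ▸ dualWeight_le_gradedDual μ hφ
      exact ⟨y, Submodule.mem_iSup_of_mem μ ((h.mem_weight_iff hM).mpr hφ), rfl⟩
    · exact ⟨0, Submodule.zero_mem _, map_zero β⟩
    · rintro x y ⟨a, ha, rfl⟩ ⟨b, hb, rfl⟩
      exact ⟨a + b, Submodule.add_mem _ ha hb, map_add β a b⟩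
  obtain ⟨y, hy, he⟩ := hex
  exact h.1 he ▸ hy

/-- The restriction of the pairing to homogeneous subspaces. -/
def restrict (_h : IsContragredient N M β) (μ : ℂ) :
    N.weight μ →ₗ[ℂ] Module.Dual ℂ (M.weight μ) :=
  (M.weight μ).subtype.dualMap ∘ₗ β ∘ₗ (N.weight μ).subtype

theorem restrict_apply (h : IsContragredient N M β) (μ : ℂ) (w' : N.weight μ) (w : M.weight μ) :
    h.restrict μ w' w = β w' w := rfl

theorem restrict_injective (h : IsContragredient N M β) (hM : ⨆ μ, M.weight μ = ⊤) (μ : ℂ) :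
    Function.Injective (h.restrict μ) := by
  rw [← LinearMap.ker_eq_bot, LinearMap.ker_eq_bot']
  intro w' hw'
  ext
  refine h.1 ?_
  rw [Submodule.coe_zero, map_zero]
  refine dual_ext hM fun ν w hw => ?_
  by_cases hν : ν = μ
  · subst hν
    exact LinearMap.congr_fun hw' ⟨w, hw⟩
  · exact h.apply_eq_zero (Ne.symm hν) w'.2 hw

theorem restrict_surjective (h : IsContragredient N M β) (hM : ⨆ μ, M.weight μ = ⊤) (μ : ℂ) :
    Function.Surjective (h.restrict μ) := by
  intro f
  -- Extension by zero along the other weight spaces places the functional in one summand of the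
  -- graded dual, which lies in the range of `β`.
  set φ : Module.Dual ℂ M := f ∘ₗ (M.proj hM μ).codRestrict (M.weight μ) (proj_mem hM μ) with hφ
  have hmem : φ ∈ M.dualWeight μ := by
    rw [mem_dualWeight]
    intro ν hν w hw
    rw [hφ, LinearMap.comp_apply, show (M.proj hM μ).codRestrict (M.weight μ) (proj_mem hM μ) w = 0
      from Subtype.ext (proj_apply_of_mem_of_ne hM hν hw), map_zero]
  obtain ⟨w', hw'⟩ : φ ∈ LinearMap.range β := h.2.1 ▸ dualWeight_le_gradedDual μ hmem
  refine ⟨⟨w', (h.mem_weight_iff hM).mpr (hw' ▸ hmem)⟩, ?_⟩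
  ext w
  rw [h.restrict_apply, hw', hφ, LinearMap.comp_apply]
  congr 1
  exact Subtype.ext (proj_apply_of_mem hM w.2)

theorem finite_weight (h : IsContragredient N M β) (hM : ⨆ μ, M.weight μ = ⊤) (μ : ℂ)
    [FiniteDimensional ℂ (M.weight μ)] : FiniteDimensional ℂ (N.weight μ) :=
  Module.Finite.of_injective (h.restrict μ) (h.restrict_injective hM μ)

theorem weight_eq_bot (h : IsContragredient N M β) (hM : ⨆ μ, M.weight μ = ⊤) {μ : ℂ}
    (hμ : M.weight μ = ⊥) : N.weight μ = ⊥ := by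
  rw [eq_bot_iff]
  intro w' hw'
  have : (⟨w', hw'⟩ : N.weight μ) = 0 := by
    refine h.restrict_injective hM μ ?_
    rw [map_zero]
    ext ⟨w, hw⟩
    rw [hμ, Submodule.mem_bot] at hw
    subst hw
    exact map_zero _
  exact congrArg Subtype.val this

theorem flip_injective (h : IsContragredient N M β) (hM : ⨆ μ, M.weight μ = ⊤) :
    Function.Injective β.flip := by
  rw [← LinearMap.ker_eq_bot, LinearMap.ker_eq_bot']
  intro w hw
  refine ext_proj hM fun μ => ?_
  rw [← Module.forall_dual_apply_eq_zero_iff ℂ]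
  intro f
  obtain ⟨w', hw'⟩ : f ∘ₗ M.proj hM μ ∈ LinearMap.range β :=
    h.2.1 ▸ dualWeight_le_gradedDual μ (comp_proj_mem_dualWeight hM μ f)
  have := LinearMap.congr_fun hw w'
  rw [LinearMap.flip_apply, hw'] at this
  exact this

/-- If `N` is the contragredient of `M`, then `M` is the contragredient of `N`. -/
theorem symm (h : IsContragredient N M β) (hM : ⨆ μ, M.weight μ = ⊤)
    (hfin : ∀ μ, FiniteDimensional ℂ (M.weight μ)) : IsContragredient M N β.flip := by
  have hN := h.iSup_weight hM
  obtain ⟨Z, hZ⟩ := N.exists_isOppositeMode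
  refine (isContragredient_iff hZ).mpr ⟨h.flip_injective hM, le_antisymm ?_ ?_,
    fun n v w w' => h.flip_invariance hZ n v w' w⟩
  · rintro _ ⟨w, rfl⟩
    refine induction_weight hM (p := fun w => β.flip w ∈ N.gradedDual) w ?_ ?_ ?_
    · intro ν w hw
      refine dualWeight_le_gradedDual ν ?_
      rw [mem_dualWeight]
      intro μ hμ w' hw'
      exact h.apply_eq_zero hμ hw' hw
    · rw [map_zero]
      exact Submodule.zero_mem _
    · intro x y hx hy
      rw [map_add]
      exact Submodule.add_mem _ hx hy
  · refine iSup_le fun μ φ hφ => ?_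
    rw [← dualWeight, mem_dualWeight] at hφ
    let e := LinearEquiv.ofBijective (h.restrict μ)
      ⟨h.restrict_injective hM μ, h.restrict_surjective hM μ⟩
    have := hfin μ
    -- The weight space of `N` is the full dual of that of `M`, so a functional on it is evaluation
    -- at a vector, by finite-dimensionality.
    let w : M.weight μ := (Module.evalEquiv ℂ (M.weight μ)).symm
      ((φ ∘ₗ (N.weight μ).subtype) ∘ₗ e.symm.toLinearMap)
    have hw : ∀ f : Module.Dual ℂ (M.weight μ), f w = φ (e.symm f) := by
      intro f
      have h1 : Module.evalEquiv ℂ (M.weight μ) w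
          = (φ ∘ₗ (N.weight μ).subtype) ∘ₗ e.symm.toLinearMap := LinearEquiv.apply_symm_apply _ _
      exact LinearMap.congr_fun h1 f
    refine ⟨w, dual_ext hN fun ν w' hw' => ?_⟩
    rw [LinearMap.flip_apply]
    by_cases hν : ν = μ
    · subst hν
      have h2 := hw (e ⟨w', hw'⟩)
      rw [LinearEquiv.symm_apply_apply] at h2
      exact h2
    · rw [hφ ν hν w' hw', h.apply_eq_zero hν hw' w.2]

theorem isomorphic {N' : WeakModule X} {β' : N' →ₗ[ℂ] Module.Dual ℂ M}
    (h : IsContragredient N M β) (h' : IsContragredient N' M β') : N.Isomorphic N' := by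
  obtain ⟨Z, hZ⟩ := M.exists_isOppositeMode
  have hr : LinearMap.range β = LinearMap.range β' := h.2.1.trans h'.2.1.symm
  let f : N ≃ₗ[ℂ] N' := (LinearEquiv.ofInjective β h.1).trans
    ((LinearEquiv.ofEq _ _ hr).trans (LinearEquiv.ofInjective β' h'.1).symm)
  have hf : ∀ x, β' (f x) = β x := by
    intro x
    have h1 : LinearEquiv.ofInjective β' h'.1 (f x)
        = LinearEquiv.ofEq _ _ hr (LinearEquiv.ofInjective β h.1 x) :=
      LinearEquiv.apply_symm_apply _ _
    exact congrArg Subtype.val h1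
  refine ⟨f, fun n v w' => h'.1 ?_⟩
  ext w
  rw [hf, ((isContragredient_iff hZ).mp h).2.2, ((isContragredient_iff hZ).mp h').2.2, hf]

theorem comp_equiv {N' : WeakModule X} (h : IsContragredient N M β) (f : N' ≃ₗ[ℂ] N)
    (hf : ∀ (n : ℤ) (v : V) (w : N'), f (N'.mode n v w) = N.mode n v (f w)) :
    IsContragredient N' M (β ∘ₗ f.toLinearMap) := by
  refine ⟨h.1.comp f.injective, ?_, fun d v hv n w' w => ?_⟩
  · rw [LinearMap.range_comp, LinearEquiv.range, Submodule.map_top, h.2.1]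
  · have := h.2.2 d v hv n (f w') w
    rw [← hf] at this
    exact this

/-- The annihilator in `M` of a submodule S of `N` is a submodule, hence zero or all of `M`. If it
is all of `M`, then S = 0 by injectivity of `β`. If it is zero, S contains every weight space by
finite-dimensional duality; here S is graded because it is stable under L(0). -/
theorem isIrreducible (h : IsContragredient N M β) (hM : ⨆ μ, M.weight μ = ⊤)
    (hfin : ∀ μ, FiniteDimensional ℂ (M.weight μ)) (hirr : M.IsIrreducible) :
    N.IsIrreducible := by
  refine ⟨?_, fun S hS => ?_⟩
  · by_contra hN
    rw [not_nontrivial_iff_subsingleton] at hN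
    obtain ⟨x, y, hxy⟩ := hirr.1
    refine hxy (h.flip_injective hM ?_)
    ext w'
    rw [Subsingleton.elim w' 0, map_zero, map_zero]
  · have hN := h.iSup_weight hM
    obtain ⟨Z, hZ⟩ := N.exists_isOppositeMode
    have hSZ : ∀ (n : ℤ) (v : V), ∀ w' ∈ S, Z n v w' ∈ S := by
      intro n v w' hw'
      refine X.induction_weight (p := fun v => Z n v w' ∈ S) v ?_ ?_ ?_
      · intro d v hv
        obtain ⟨B, hB⟩ := X.divPow_eq_zero v
        rw [hZ.apply_eq_sum hv hB]
        exact S.sum_mem fun k _ => S.smul_mem _ (hS _ _ _ hw')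
      · rw [map_zero]
        exact S.zero_mem
      · intro x y hx hy
        rw [map_add]
        exact S.add_mem hx hy
    let T : Submodule ℂ M := (S.map β).dualCoannihilator
    have hT : ∀ w, w ∈ T ↔ ∀ w' ∈ S, β w' w = 0 := by
      intro w
      rw [Submodule.mem_dualCoannihilator]
      simp
    have hTsub : M.IsSubmodule T := by
      intro n v w hw
      rw [hT] at hw ⊢
      intro w' hw'
      rw [h.flip_invariance hZ]
      exact hw _ (hSZ n v w' hw')
    rcases hirr.2 T hTsub with hbot | htop
    · right
      rw [eq_top_iff, ← hN]
      refine iSup_le fun μ => ?_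
      have := hfin μ
      -- `P` is the image of the weight-μ part of S in the dual of M_(μ). A common zero of `P`
      -- annihilates all of S, since other weights are orthogonal to it, so it vanishes.
      let P : Submodule ℂ (Module.Dual ℂ (M.weight μ)) :=
        (S.comap (N.weight μ).subtype).map (h.restrict μ)
      have hP : P.dualCoannihilator = ⊥ := by
        rw [eq_bot_iff]
        rintro w hw
        rw [Submodule.mem_dualCoannihilator] at hw
        have hwT : (w : M) ∈ T := by
          rw [hT]
          intro w' hw'
          have h1 := proj_mem_of_stable hN (S := S) (fun x hx => hS _ _ x hx) hw' μ
          have h2 := hw (h.restrict μ ⟨N.proj hN μ w', proj_mem hN μ w'⟩)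
            ⟨⟨N.proj hN μ w', proj_mem hN μ w'⟩, h1, rfl⟩
          rw [h.restrict_apply] at h2
          obtain ⟨t, ht⟩ := exists_sum_proj hN w'
          classical
          rw [ht (insert μ t) (subset_insert μ t), map_sum, LinearMap.sum_apply,
            sum_eq_single μ (fun ν _ hν => h.apply_eq_zero hν (proj_mem hN ν w') w.2)
              (fun hn => absurd (mem_insert_self μ t) hn)]
          exact h2
        rw [hbot, Submodule.mem_bot] at hwT
        rw [Submodule.mem_bot]
        exact Subtype.ext hwT
      have hPt : P = ⊤ := by
        rw [← Subspace.dualCoannihilator_dualAnnihilator_eq (W := P), hP,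
          Submodule.dualAnnihilator_bot]
      intro w' hw'
      have h3 : h.restrict μ ⟨w', hw'⟩ ∈ P := hPt ▸ Submodule.mem_top
      obtain ⟨x, hx, he⟩ := h3
      have hxe := h.restrict_injective hM μ he
      subst hxe
      exact hx
    · left
      rw [eq_bot_iff]
      intro w' hw'
      rw [Submodule.mem_bot]
      refine h.1 ?_
      ext w
      rw [map_zero, LinearMap.zero_apply]
      exact (hT w).mp (htop ▸ Submodule.mem_top) w' hw'

end WeakModule.IsContragredient

end Contragredient

/-- The Jacobi identity for the transpose `I` of an operator `Z` that satisfies the opposite Jacobi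
identity. -/
theorem jacobiIdentity_of_transpose {Γ V M₁ M₂ M₃ P₂ P₃ : Type*} [Ring Γ]
    [AddCommGroup V] [Module ℂ V] [AddCommGroup M₁] [Module ℂ M₁]
    [AddCommGroup M₂] [Module ℂ M₂] [AddCommGroup M₃] [Module ℂ M₃]
    [AddCommGroup P₂] [Module ℂ P₂] [AddCommGroup P₃] [Module ℂ P₃]
    {act₁ : ℤ → V →ₗ[ℂ] M₁ →ₗ[ℂ] M₁} {a₂ : ℤ → V →ₗ[ℂ] P₂ →ₗ[ℂ] P₂}
    {a₃ : ℤ → V →ₗ[ℂ] P₃ →ₗ[ℂ] P₃} {I : Γ → M₁ →ₗ[ℂ] P₃ →ₗ[ℂ] P₂}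
    {Z₂ : ℤ → V →ₗ[ℂ] M₂ →ₗ[ℂ] M₂} {Z₃ : ℤ → V →ₗ[ℂ] M₃ →ₗ[ℂ] M₃}
    {Z : Γ → M₁ →ₗ[ℂ] M₂ →ₗ[ℂ] M₃}
    (b₂ : P₂ →ₗ[ℂ] Module.Dual ℂ M₂) (hb₂ : Function.Injective b₂) (b₃ : P₃ →ₗ[ℂ] Module.Dual ℂ M₃)
    (h₂ : ∀ m v p w, b₂ (a₂ m v p) w = b₂ p (Z₂ m v w))
    (h₃ : ∀ m v p w, b₃ (a₃ m v p) w = b₃ p (Z₃ m v w))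
    (hI : ∀ n w₁ p w, b₂ (I n w₁ p) w = b₃ p (Z n w₁ w))
    (hIb : ∀ (n : Γ) (w₁ : M₁) (p : P₃), ∃ B : ℕ, ∀ i : ℕ, B ≤ i → I (n + i) w₁ p = 0)
    (hab : ∀ (m : ℤ) (v : V) (p : P₃), ∃ B : ℕ, ∀ i : ℕ, B ≤ i → a₃ (m + i) v p = 0)
    (h₁b : ∀ (m : ℤ) (v : V) (w₁ : M₁), ∃ B : ℕ, ∀ i : ℕ, B ≤ i → act₁ (m + i) v w₁ = 0)
    (hZ₂b : ∀ (m : ℤ) (v : V) (w : M₂), ∃ B : ℕ, ∀ i : ℕ, B ≤ i → Z₂ (m - i) v w = 0)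
    (hZb : ∀ (n : Γ) (w₁ : M₁) (w : M₂), ∃ B : ℕ, ∀ i : ℕ, B ≤ i → Z (n - i) w₁ w = 0)
    (hJ : ∀ (v : V) (w₁ : M₁) (w₂ : M₂) (l m : ℤ) (n : Γ),
      (∑ᶠ i : ℕ, ((-1) ^ i * cchoose l i) • Z (n + i) w₁ (Z₂ (m + l - i) v w₂))
      - ((l.negOnePow : ℤ) : ℂ) •
        (∑ᶠ i : ℕ, ((-1) ^ i * cchoose l i) • Z₃ (m + i) v (Z (n + l - i) w₁ w₂))
      = ∑ᶠ i : ℕ, cchoose m i • Z (m + n - i) (act₁ (l + i) v w₁) w₂) :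
    JacobiIdentity act₁ a₃ a₂ I := by
  refine jacobiIdentity_of_complex hIb hab fun v w₁ p l m n => hb₂ ?_
  ext w
  let ev : P₂ →ₗ[ℂ] ℂ := b₂.flip w
  have hev : ∀ x, b₂ x w = ev x := fun x => rfl
  have h := congrArg (b₃ p) (hJ v w₁ w l m n)
  obtain ⟨B₁, hB₁⟩ := hIb n w₁ p
  obtain ⟨B₂, hB₂⟩ := hab m v p
  obtain ⟨B₃, hB₃⟩ := h₁b l v w₁
  obtain ⟨B₄, hB₄⟩ := hZ₂b (m + l) v w
  obtain ⟨B₅, hB₅⟩ := hZb (n + l) w₁ w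
  rw [map_sub, map_smul,
    map_finsum (b₃ p) (finite_support_of_eventually_zero (B := B₄) fun i hi => by simp [hB₄ i hi]),
    map_finsum (b₃ p) (finite_support_of_eventually_zero (B := B₅) fun i hi => by simp [hB₅ i hi]),
    map_finsum (b₃ p) (finite_support_of_eventually_zero (B := B₃) fun i hi => by simp [hB₃ i hi])]
    at h
  rw [hev, hev, map_sub, map_smul,
    map_finsum ev (finite_support_of_eventually_zero (B := B₁) fun i hi => by simp [hB₁ i hi]),
    map_finsum ev (finite_support_of_eventually_zero (B := B₂) fun i hi => by simp [hB₂ i hi]),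
    map_finsum ev (finite_support_of_eventually_zero (B := B₃) fun i hi => by simp [hB₃ i hi])]
  simp only [map_smul] at h ⊢
  simp only [← hev, h₂, hI, h₃]
  exact h

/-! ### Existence of contragredient modules and of representatives. -/

section Existence

variable {V : Type u} [AddCommGroup V] [Module ℂ V] {X : VOA V}

namespace WeakModule

variable {M : WeakModule X}

theorem eq_zero_of_mem_dualWeight (hM : ⨆ μ, M.weight μ = ⊤) {μ : ℂ} (hμ : M.weight μ = ⊥)
    {φ : Module.Dual ℂ M} (hφ : φ ∈ M.dualWeight μ) : φ = 0 := by
  refine dual_ext hM fun ν w hw => ?_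
  by_cases h : ν = μ
  · subst h
    rw [hμ, Submodule.mem_bot] at hw
    rw [hw, map_zero, map_zero]
  · rw [mem_dualWeight.mp hφ ν h w hw, LinearMap.zero_apply]

theorem IsOppositeMode.comp_mem_dualWeight {Z : ℤ → V →ₗ[ℂ] M →ₗ[ℂ] M} (hZ : M.IsOppositeMode Z)
    {d : ℤ} {v : V} (hv : v ∈ X.weight d) {μ : ℂ} {φ : Module.Dual ℂ M} (hφ : φ ∈ M.dualWeight μ)
    (n : ℤ) : φ ∘ₗ Z n v ∈ M.dualWeight (μ + d - n - 1) := by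
  rw [mem_dualWeight]
  intro ν hν w hw
  refine mem_dualWeight.mp hφ _ (fun h => hν ?_) _ (hZ.mem_weight hv hw n)
  rw [← h]
  ring

theorem IsOppositeMode.comp_mem_gradedDual {Z : ℤ → V →ₗ[ℂ] M →ₗ[ℂ] M} (hZ : M.IsOppositeMode Z)
    (n : ℤ) (v : V) {φ : Module.Dual ℂ M} (hφ : φ ∈ M.gradedDual) :
    φ ∘ₗ Z n v ∈ M.gradedDual := by
  refine X.induction_weight (p := fun v => φ ∘ₗ Z n v ∈ M.gradedDual) v ?_ ?_ ?_
  · intro d v hv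
    refine gradedDual_induction (p := fun φ => φ ∘ₗ Z n v ∈ M.gradedDual) hφ ?_ ?_ ?_
    · exact fun μ φ hφ => dualWeight_le_gradedDual _ (hZ.comp_mem_dualWeight hv hφ n)
    · rw [LinearMap.zero_comp]
      exact Submodule.zero_mem _
    · intro x y hx hy
      rw [LinearMap.add_comp]
      exact Submodule.add_mem _ hx hy
  · rw [map_zero, LinearMap.comp_zero]
    exact Submodule.zero_mem _
  · intro x y hx hy
    rw [map_add, LinearMap.comp_add]
    exact Submodule.add_mem _ hx hy

/-- The composite has weight μ + d - n - 1, whose real part falls below the lower bound of the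
weights of `M` as n grows. -/
theorem IsOppositeMode.comp_truncation {Z : ℤ → V →ₗ[ℂ] M →ₗ[ℂ] M} (hZ : M.IsOppositeMode Z)
    (hM : ⨆ μ, M.weight μ = ⊤) (hb : ∃ N : ℝ, ∀ μ : ℂ, μ.re < N → M.weight μ = ⊥)
    (v : V) {φ : Module.Dual ℂ M} (hφ : φ ∈ M.gradedDual) :
    ∃ N : ℤ, ∀ n, N ≤ n → φ ∘ₗ Z n v = 0 := by
  refine X.induction_weight (p := fun v => ∃ N : ℤ, ∀ n, N ≤ n → φ ∘ₗ Z n v = 0) v ?_ ?_ ?_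
  · intro d v hv
    refine gradedDual_induction (p := fun φ => ∃ N : ℤ, ∀ n, N ≤ n → φ ∘ₗ Z n v = 0) hφ ?_ ?_ ?_
    · intro μ φ hφ
      obtain ⟨N, hN⟩ := hb
      obtain ⟨K, hK⟩ := exists_int_gt (μ.re + d - N)
      refine ⟨K, fun n hn => eq_zero_of_mem_dualWeight hM (hN _ ?_)
        (hZ.comp_mem_dualWeight hv hφ n)⟩
      have : (K : ℝ) ≤ n := by exact_mod_cast hn
      simp only [Complex.sub_re, Complex.add_re, Complex.intCast_re, Complex.one_re]
      linarith
    · exact ⟨0, fun n _ => LinearMap.zero_comp _⟩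
    · rintro x y ⟨a, ha⟩ ⟨b, hb⟩
      exact ⟨max a b, fun n hn => by
        rw [LinearMap.add_comp, ha n ((le_max_left _ _).trans hn),
          hb n ((le_max_right _ _).trans hn), add_zero]⟩
  · exact ⟨0, fun n _ => by rw [map_zero, LinearMap.comp_zero]⟩
  · rintro x y ⟨a, ha⟩ ⟨b, hb⟩
    exact ⟨max a b, fun n hn => by
      rw [map_add, LinearMap.comp_add, ha n ((le_max_left _ _).trans hn),
        hb n ((le_max_right _ _).trans hn), add_zero]⟩

/-- The graded dual of a graded module with bounded weights is a module. -/
theorem exists_isContragredient (M : WeakModule X) (hM : ⨆ μ, M.weight μ = ⊤)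
    (hb : ∃ N : ℝ, ∀ μ : ℂ, μ.re < N → M.weight μ = ⊥) :
    ∃ (N : WeakModule X) (β : N →ₗ[ℂ] Module.Dual ℂ M), IsContragredient N M β := by
  obtain ⟨Z, hZ⟩ := M.exists_isOppositeMode
  let mode : ℤ → V →ₗ[ℂ] M.gradedDual →ₗ[ℂ] M.gradedDual := fun n =>
    LinearMap.mk₂ ℂ (fun v φ => ⟨φ.1 ∘ₗ Z n v, hZ.comp_mem_gradedDual n v φ.2⟩)
      (fun x y φ => Subtype.ext (by
        show φ.1 ∘ₗ Z n (x + y) = φ.1 ∘ₗ Z n x + φ.1 ∘ₗ Z n y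
        rw [map_add, LinearMap.comp_add]))
      (fun c x φ => Subtype.ext (by
        show φ.1 ∘ₗ Z n (c • x) = c • (φ.1 ∘ₗ Z n x)
        rw [map_smul, LinearMap.comp_smul]))
      (fun x φ ψ => Subtype.ext (LinearMap.add_comp _ _ _))
      (fun c x φ => Subtype.ext (LinearMap.smul_comp _ _ _))
  have hmode : ∀ n v (φ : M.gradedDual) w, (mode n v φ).1 w = φ.1 (Z n v w) := fun _ _ _ _ => rfl
  have htr : ∀ (v : V) (φ : M.gradedDual), ∃ N : ℤ, ∀ n, N ≤ n → mode n v φ = 0 := by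
    intro v φ
    obtain ⟨N, hN⟩ := hZ.comp_truncation hM hb v φ.2
    exact ⟨N, fun n hn => Subtype.ext (hN n hn)⟩
  have hbd : ∀ (m : ℤ) (v : V) (φ : M.gradedDual), ∃ B : ℕ, ∀ i : ℕ, B ≤ i →
      mode (m + i) v φ = 0 := by
    intro m v φ
    obtain ⟨N, hN⟩ := htr v φ
    exact ⟨(N - m).toNat, fun i hi => hN _ (by omega)⟩
  let N : WeakModule X :=
    { carrier := M.gradedDual
      mode := mode
      truncation := htr
      vacuum_mode := fun n φ => by
        refine Subtype.ext (LinearMap.ext fun w => ?_)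
        rw [hmode, hZ.vacuum]
        split_ifs
        · rfl
        · exact map_zero _
      jacobi := jacobiIdentity_of_transpose M.gradedDual.subtype Subtype.val_injective
        M.gradedDual.subtype hmode hmode hmode hbd hbd X.adjoint.exists_bound hZ.exists_bound
        hZ.exists_bound hZ.jacobi
      derivative := fun v φ n => by
        refine Subtype.ext (LinearMap.ext fun w => ?_)
        rw [hmode, hZ.derivative, map_smul]
        rfl }
  refine ⟨N, M.gradedDual.subtype, (isContragredient_iff hZ).mpr
    ⟨Subtype.val_injective, Submodule.range_subtype _, hmode⟩⟩

end WeakModule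

theorem IrreducibleModule.exists_contragredient (M : IrreducibleModule X) :
    ∃ (N : IrreducibleModule X) (β : N.toWeakModule →ₗ[ℂ] Module.Dual ℂ M.toWeakModule),
      WeakModule.IsContragredient N.toWeakModule M.toWeakModule β := by
  obtain ⟨N, β, h⟩ := M.toWeakModule.exists_isContragredient M.iSup_weight M.bounded_weight
  obtain ⟨B, hB⟩ := M.bounded_weight
  refine ⟨⟨N, h.iSup_weight M.iSup_weight, fun μ => ?_,
    ⟨B, fun μ hμ => h.weight_eq_bot M.iSup_weight (hB μ hμ)⟩,
    h.isIrreducible M.iSup_weight M.finite_weight M.irreducible⟩, β, h⟩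
  have := M.finite_weight μ
  exact h.finite_weight M.iSup_weight μ

/-- Choose a representative of each class and a contragredient of each representative. Uniqueness up
to isomorphism and symmetry of the contragredient relation give a'' = a. -/
theorem exists_representatives (X : VOA V) : Nonempty (Representatives X) := by
  choose N β hβ using fun M : IrreducibleModule X => M.exists_contragredient
  let W : IrrClass X → IrreducibleModule X := fun a => Quotient.out a
  have hW : ∀ a, Quotient.mk (IrreducibleModule.isoSetoid X) (W a) = a := fun a => Quotient.out_eq a
  let dual : IrrClass X → IrrClass X := fun a =>
    Quotient.mk (IrreducibleModule.isoSetoid X) (N (W a))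
  have hex : ∀ a b, dual a = b →
      ∃ γ : (W b).toWeakModule →ₗ[ℂ] Module.Dual ℂ (W a).toWeakModule,
        WeakModule.IsContragredient (W b).toWeakModule (W a).toWeakModule γ := by
    rintro a _ rfl
    -- The chosen representative of a' need not be the constructed contragredient itself, only
    -- isomorphic to it; the pairing is transported along the isomorphism.
    obtain ⟨f, hf⟩ : (W (dual a)).toWeakModule.Isomorphic (N (W a)).toWeakModule :=
      Quotient.exact (s := IrreducibleModule.isoSetoid X) (hW (dual a))
    exact ⟨_, (hβ (W a)).comp_equiv f hf⟩
  choose γ hγ using hex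
  refine ⟨⟨W, hW, dual, fun a => ?_, γ, hγ⟩⟩
  -- Both W^a and the constructed contragredient of W^{a'} are contragredient to W^{a'}, hence
  -- isomorphic.
  have h₁ := (hγ a _ rfl).symm (W a).iSup_weight (W a).finite_weight
  have h₂ := hβ (W (dual a))
  rw [← hW a]
  refine Eq.trans ?_ (Quotient.sound (s := IrreducibleModule.isoSetoid X) (h₂.isomorphic h₁))
  rw [hW a]

end Existence

/-! ### Lowest weights and the operators e^{πi(L(0)-h)} and e^{L(1)}. -/

section LowestWeight

variable {V : Type u} [AddCommGroup V] [Module ℂ V] {X : VOA V}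

namespace WeakModule

/-- The sum of the homogeneous subspaces whose weights differ from `μ` by an integer. -/
def cosetSubspace (M : WeakModule X) (μ : ℂ) : Submodule ℂ M := ⨆ k : ℤ, M.weight (μ + k)

theorem isSubmodule_cosetSubspace (M : WeakModule X) (μ : ℂ) :
    M.IsSubmodule (M.cosetSubspace μ) := by
  intro n v w hw
  refine Submodule.iSup_induction (fun k : ℤ => M.weight (μ + k))
    (motive := fun w => M.mode n v w ∈ M.cosetSubspace μ) hw ?_ ?_ ?_
  · intro k w hw
    refine X.induction_weight (p := fun v => M.mode n v w ∈ M.cosetSubspace μ) v ?_ ?_ ?_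
    · intro d v hv
      refine Submodule.mem_iSup_of_mem (k + d - n - 1) ?_
      convert M.mode_mem_weight hv hw n using 2
      push_cast
      ring
    · rw [map_zero, LinearMap.zero_apply]
      exact Submodule.zero_mem _
    · intro x y hx hy
      rw [map_add, LinearMap.add_apply]
      exact Submodule.add_mem _ hx hy
  · rw [map_zero]
    exact Submodule.zero_mem _
  · intro x y hx hy
    rw [map_add]
    exact Submodule.add_mem _ hx hy

end WeakModule

namespace IrreducibleModule

open WeakModule

/-- Modes shift weights by integers, so by irreducibility all weights lie in one coset of ℤ. Since
their real parts are bounded below, there is a least one. -/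
theorem exists_isLowestWeight (M : IrreducibleModule X) : ∃ h, M.IsLowestWeight h := by
  obtain ⟨μ, hμ⟩ : ∃ μ, M.weight μ ≠ ⊥ := by
    by_contra hcon
    push Not at hcon
    have htop := M.iSup_weight
    have := M.irreducible.1
    simp only [hcon, iSup_bot] at htop
    exact bot_ne_top htop
  have hS : M.cosetSubspace μ = ⊤ := by
    refine (M.irreducible.2 _ (M.isSubmodule_cosetSubspace μ)).resolve_left fun hbot => hμ ?_
    rw [eq_bot_iff, ← hbot]
    refine le_trans (le_of_eq ?_) (le_iSup (fun k : ℤ => M.weight (μ + k)) 0)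
    rw [Int.cast_zero, add_zero]
  have hcoset : ∀ ν, M.weight ν ≠ ⊥ → ∃ k : ℤ, ν = μ + k := by
    intro ν hν
    by_contra hcon
    push Not at hcon
    refine hν ?_
    rw [eq_bot_iff]
    intro w hw
    -- Projection to a weight outside the coset kills the coset subspace, which is all of `M`.
    have hle : M.cosetSubspace μ ≤ LinearMap.ker (M.proj M.iSup_weight ν) := iSup_le fun k x hx =>
      proj_apply_of_mem_of_ne M.iSup_weight (hcon k).symm hx
    rw [Submodule.mem_bot, ← proj_apply_of_mem M.iSup_weight hw]
    exact hle (hS ▸ Submodule.mem_top)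
  obtain ⟨N, hN⟩ := M.bounded_weight
  obtain ⟨b, hb⟩ := exists_int_lt (N - μ.re)
  obtain ⟨k, hk, hmin⟩ := Int.exists_least_of_bdd (P := fun k : ℤ => M.weight (μ + k) ≠ ⊥)
    ⟨b, fun k hk => by
      by_contra hlt
      refine hk (hN _ ?_)
      have : (k : ℝ) < b := by exact_mod_cast not_le.mp hlt
      simp only [Complex.add_re, Complex.intCast_re]
      linarith⟩ ⟨0, by simpa using hμ⟩
  refine ⟨μ + k, hk, fun ν hν => ?_⟩
  obtain ⟨j, rfl⟩ := hcoset ν hν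
  refine ⟨(j - k).toNat, ?_⟩
  have h := Int.toNat_of_nonneg (sub_nonneg.mpr (hmin j hν))
  have h' : (((j - k).toNat : ℕ) : ℂ) = (j : ℂ) - k := by
    exact_mod_cast congrArg (Int.cast (R := ℂ)) h
  rw [h']
  ring

theorem isLowestWeight_lowestWeight (M : IrreducibleModule X) :
    M.IsLowestWeight M.lowestWeight :=
  Classical.epsilon_spec M.exists_isLowestWeight

/-- The weights of nonzero homogeneous vectors differ from the lowest weight by integers. -/
theorem eq_zero_or_exists_int (M : IrreducibleModule X) {μ : ℂ} {w : M.toWeakModule}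
    (hw : w ∈ M.weight μ) : w = 0 ∨ ∃ k : ℤ, μ - M.lowestWeight = k := by
  by_cases h : M.weight μ = ⊥
  · left
    rwa [h, Submodule.mem_bot] at hw
  · right
    obtain ⟨k, hk⟩ := M.isLowestWeight_lowestWeight.2 μ h
    exact ⟨k, by rw [hk]; push_cast; ring⟩

theorem LOneNilpotent (M : IrreducibleModule X) : M.LOneNilpotent :=
  LOneNilpotent_of_bounded M.iSup_weight M.bounded_weight

/-- By restriction of the pairing, a weight space of `N` vanishes exactly when that of `M` does. The
two lowest weights are then chosen by the same predicate. -/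
theorem lowestWeight_eq {M N : IrreducibleModule X}
    {β : N.toWeakModule →ₗ[ℂ] Module.Dual ℂ M.toWeakModule}
    (h : IsContragredient N.toWeakModule M.toWeakModule β) : N.lowestWeight = M.lowestWeight := by
  have hiff : ∀ μ, N.weight μ = ⊥ ↔ M.weight μ = ⊥ := fun μ =>
    ⟨(h.symm M.iSup_weight M.finite_weight).weight_eq_bot N.iSup_weight,
      h.weight_eq_bot M.iSup_weight⟩
  rw [lowestWeight, lowestWeight]
  congr 1
  funext μ
  simp only [IsLowestWeight, ne_eq, hiff]

/-- The operator that multiplies vectors of weight `μ` by `e^{πi(μ - h)}`, where `h` is the lowest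
weight. -/
noncomputable def sign (M : IrreducibleModule X) : M.toWeakModule →ₗ[ℂ] M.toWeakModule :=
  (M.exists_linearMap M.iSup_weight fun μ =>
    Complex.exp (Real.pi * Complex.I * (μ - M.lowestWeight)) • LinearMap.id).choose

theorem sign_apply (M : IrreducibleModule X) {μ : ℂ} {w : M.toWeakModule} (hw : w ∈ M.weight μ) :
    M.sign w = Complex.exp (Real.pi * Complex.I * (μ - M.lowestWeight)) • w :=
  (M.exists_linearMap M.iSup_weight fun μ =>
    Complex.exp (Real.pi * Complex.I * (μ - M.lowestWeight)) • LinearMap.id).choose_spec μ w hw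

/-- The operator `e^{L(1)}`. -/
noncomputable def expLOne (M : IrreducibleModule X) : M.toWeakModule →ₗ[ℂ] M.toWeakModule where
  toFun w := ∑ᶠ k : ℕ, divPow (M.L 1) k w
  map_add' x y := by
    obtain ⟨B, hB⟩ := M.LOneNilpotent.divPow_eq_zero x
    obtain ⟨C, hC⟩ := M.LOneNilpotent.divPow_eq_zero y
    simp only [map_add]
    exact finsum_add_distrib (finite_support_of_eventually_zero hB)
      (finite_support_of_eventually_zero hC)
  map_smul' c x := by
    simp only [map_smul, RingHom.id_apply, smul_finsum]

theorem expLOne_apply (M : IrreducibleModule X) {w : M.toWeakModule} {B : ℕ}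
    (hB : ∀ k, B ≤ k → divPow (M.L 1) k w = 0) :
    M.expLOne w = ∑ k ∈ range B, divPow (M.L 1) k w :=
  finsum_eq_sum_range hB

theorem exp_pi_sub_nat (z : ℂ) (k : ℕ) :
    Complex.exp (Real.pi * Complex.I * (z - k))
      = (-1) ^ k * Complex.exp (Real.pi * Complex.I * z) := by
  have h : Complex.exp (Real.pi * Complex.I * ((-k : ℤ) : ℂ)) = (-1) ^ k := by
    rw [exp_pi_mul_I_mul_int, Int.negOnePow_neg, negOnePow_natCast_complex]
  rw [← h, ← Complex.exp_add]
  congr 1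
  push_cast
  ring

theorem exp_pi_mul_self_of_int {z : ℂ} (hz : ∃ k : ℤ, z = k) :
    Complex.exp (Real.pi * Complex.I * z) * Complex.exp (Real.pi * Complex.I * z) = 1 := by
  obtain ⟨k, rfl⟩ := hz
  rw [exp_pi_mul_I_mul_int, negOnePow_mul_self_complex]

/-- On the weight space μ the operator is (-1)^{μ-h}, because μ - h is an integer. -/
theorem sign_sign (M : IrreducibleModule X) (w : M.toWeakModule) : M.sign (M.sign w) = w := by
  refine induction_weight M.iSup_weight (p := fun w => M.sign (M.sign w) = w) w ?_ (by simp) ?_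
  · intro μ w hw
    rcases M.eq_zero_or_exists_int hw with rfl | hk
    · rw [map_zero, map_zero]
    · rw [M.sign_apply hw, map_smul, M.sign_apply hw, smul_smul, exp_pi_mul_self_of_int hk,
        one_smul]
  · intro x y hx hy
    rw [map_add, map_add, hx, hy]

theorem sign_expLOne_apply (M : IrreducibleModule X) {μ : ℂ} {w : M.toWeakModule}
    (hw : w ∈ M.weight μ) {B : ℕ} (hB : ∀ k, B ≤ k → divPow (M.L 1) k w = 0) :
    M.sign (M.expLOne w) = Complex.exp (Real.pi * Complex.I * (μ - M.lowestWeight)) •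
      ∑ k ∈ range B, (-1 : ℂ) ^ k • divPow (M.L 1) k w := by
  rw [M.expLOne_apply hB, map_sum, smul_sum]
  refine sum_congr rfl fun k _ => ?_
  rw [M.sign_apply (M.divPow_L_one_mem_weight hw k), smul_smul, sub_right_comm, exp_pi_sub_nat,
    mul_comm]

theorem sign_expLOne_sign_apply (M : IrreducibleModule X) {μ : ℂ} {w : M.toWeakModule}
    (hw : w ∈ M.weight μ) {B : ℕ} (hB : ∀ k, B ≤ k → divPow (M.L 1) k w = 0) :
    M.sign (M.expLOne (M.sign w)) = ∑ k ∈ range B, (-1 : ℂ) ^ k • divPow (M.L 1) k w := by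
  rcases M.eq_zero_or_exists_int hw with rfl | hk
  · simp
  · rw [M.sign_apply hw, map_smul, map_smul, M.sign_expLOne_apply hw hB, smul_smul,
      exp_pi_mul_self_of_int hk, one_smul]

/-- Conjugation by the sign operator turns L(1) into -L(1), so that sEs = e^{-L(1)} = E^{-1}. -/
theorem sign_expLOne_involutive (M : IrreducibleModule X) (w : M.toWeakModule) :
    M.sign (M.expLOne (M.sign (M.expLOne w))) = w := by
  refine induction_weight M.iSup_weight
    (p := fun w => M.sign (M.expLOne (M.sign (M.expLOne w))) = w) w ?_ (by simp) ?_
  · intro μ w hw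
    obtain ⟨B, hB⟩ := M.LOneNilpotent.divPow_eq_zero w
    have hz : ∀ j k, B ≤ j + k → divPow (M.L 1) j (divPow (M.L 1) k w) = 0 := by
      intro j k hjk
      rw [← Module.End.mul_apply, divPow_mul, LinearMap.smul_apply, hB _ hjk, smul_zero]
    rw [M.expLOne_apply hB, map_sum, map_sum, map_sum, sum_congr rfl fun k _ =>
      M.sign_expLOne_sign_apply (M.divPow_L_one_mem_weight hw k) (B := B) fun j hj =>
        hz j k (by omega), sum_comm, sum_range_sum_range_antidiagonal fun j k hjk => by
          rw [hz j k hjk, smul_zero]]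
    have h2 : ∀ N : ℕ, (∑ p ∈ antidiagonal N, (-1 : ℂ) ^ p.1 •
        divPow (M.L 1) p.1 (divPow (M.L 1) p.2 w)) = if N = 0 then w else 0 := by
      intro N
      have hk := LinearMap.congr_fun (sum_antidiagonal_neg_one_pow_divPow (M.L 1) N) w
      simp only [LinearMap.sum_apply, LinearMap.smul_apply, Module.End.mul_apply] at hk
      rw [hk]
      split_ifs <;> rfl
    rw [sum_congr rfl fun N _ => h2 N, sum_ite_eq']
    split_ifs with h0
    · rfl
    · have := hB 0 (by simpa using h0)
      rw [divPow_zero] at this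
      exact this.symm
  · intro x y hx hy
    simp only [map_add, hx, hy]

theorem expLOne_sign_involutive (M : IrreducibleModule X) (w : M.toWeakModule) :
    M.expLOne (M.sign (M.expLOne (M.sign w))) = w := by
  have h := M.sign_expLOne_involutive (M.sign w)
  rw [← M.sign_sign (M.expLOne (M.sign (M.expLOne (M.sign w)))), h, M.sign_sign]

end IrreducibleModule

end LowestWeight

/-- The trilinear map with the last two arguments exchanged. -/
def LinearMap.flipLast {A B C E : Type*} [AddCommGroup A] [Module ℂ A] [AddCommGroup B] [Module ℂ B]
    [AddCommGroup C] [Module ℂ C] [AddCommGroup E] [Module ℂ E]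
    (T : A →ₗ[ℂ] B →ₗ[ℂ] C →ₗ[ℂ] E) : A →ₗ[ℂ] C →ₗ[ℂ] B →ₗ[ℂ] E where
  toFun a := (T a).flip
  map_add' x y := by rw [map_add]; rfl
  map_smul' c x := by rw [map_smul]; rfl

/-! ### Trilinear forms of intertwining operators, and the two maps as substitutions. -/

section Forms

variable {V : Type u} [AddCommGroup V] [Module ℂ V] {X : VOA V}

open WeakModule

theorem WeakModule.exists_trilinearMap {M₁ M₂ M₃ : WeakModule X} (h₁ : ⨆ μ, M₁.weight μ = ⊤)
    (h₂ : ⨆ μ, M₂.weight μ = ⊤) (h₃ : ⨆ μ, M₃.weight μ = ⊤)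
    (T : ℂ → ℂ → ℂ → M₁ →ₗ[ℂ] M₂ →ₗ[ℂ] M₃ →ₗ[ℂ] ℂ) :
    ∃ F : M₁ →ₗ[ℂ] M₂ →ₗ[ℂ] M₃ →ₗ[ℂ] ℂ, ∀ μ₁ μ₂ μ₃, ∀ w₁ ∈ M₁.weight μ₁, ∀ w₂ ∈ M₂.weight μ₂,
      ∀ w₃ ∈ M₃.weight μ₃, F w₁ w₂ w₃ = T μ₁ μ₂ μ₃ w₁ w₂ w₃ := by
  choose f hf using fun μ₁ μ₂ => M₃.exists_linearMap h₃ fun μ₃ =>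
    (T μ₁ μ₂ μ₃).flip.flipLast.flip
  choose g hg using fun μ₁ => M₂.exists_linearMap h₂ fun μ₂ => (f μ₁ μ₂).flip
  obtain ⟨F, hF⟩ := M₁.exists_linearMap h₁ fun μ₁ => (g μ₁).flipLast.flip
  refine ⟨F, fun μ₁ μ₂ μ₃ w₁ hw₁ w₂ hw₂ w₃ hw₃ => ?_⟩
  rw [hF μ₁ w₁ hw₁]
  change g μ₁ w₂ w₃ w₁ = _
  rw [hg μ₁ μ₂ w₂ hw₂, LinearMap.flip_apply, hf μ₁ μ₂ μ₃ w₃ hw₃]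
  rfl

theorem WeakModule.trilinearMap_ext {M₁ M₂ M₃ : WeakModule X} (h₁ : ⨆ μ, M₁.weight μ = ⊤)
    (h₂ : ⨆ μ, M₂.weight μ = ⊤) (h₃ : ⨆ μ, M₃.weight μ = ⊤)
    {F G : M₁ →ₗ[ℂ] M₂ →ₗ[ℂ] M₃ →ₗ[ℂ] ℂ}
    (h : ∀ μ₁ μ₂ μ₃, ∀ w₁ ∈ M₁.weight μ₁, ∀ w₂ ∈ M₂.weight μ₂, ∀ w₃ ∈ M₃.weight μ₃,
      F w₁ w₂ w₃ = G w₁ w₂ w₃) : F = G := by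
  ext w₁ w₂ w₃
  refine induction_weight h₁ (p := fun w₁ => F w₁ w₂ w₃ = G w₁ w₂ w₃) w₁ (fun μ₁ w₁ hw₁ => ?_)
    (by simp) fun x y hx hy => by simp only [map_add, LinearMap.add_apply, hx, hy]
  refine induction_weight h₂ (p := fun w₂ => F w₁ w₂ w₃ = G w₁ w₂ w₃) w₂ (fun μ₂ w₂ hw₂ => ?_)
    (by simp) fun x y hx hy => by simp only [map_add, LinearMap.add_apply, hx, hy]
  exact induction_weight h₃ (p := fun w₃ => F w₁ w₂ w₃ = G w₁ w₂ w₃) w₃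
    (fun μ₃ w₃ hw₃ => h μ₁ μ₂ μ₃ w₁ hw₁ w₂ hw₂ w₃ hw₃)
    (by simp) fun x y hx hy => by simp only [map_add, hx, hy]

variable {M₁ M₂ M₃ N₂ N₃ : IrreducibleModule X}

/-- `F` is the trilinear form `⟨𝒴(w₁, 1) w₂, w₃⟩`. -/
def IsForm (γ : M₃.toWeakModule →ₗ[ℂ] Module.Dual ℂ N₃.toWeakModule)
    (𝒴 : ℂ → M₁.toWeakModule →ₗ[ℂ] M₂.toWeakModule →ₗ[ℂ] M₃.toWeakModule)
    (F : M₁.toWeakModule →ₗ[ℂ] M₂.toWeakModule →ₗ[ℂ] N₃.toWeakModule →ₗ[ℂ] ℂ) : Prop :=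
  ∀ μ₁ μ₂ μ₃, ∀ w₁ ∈ M₁.weight μ₁, ∀ w₂ ∈ M₂.weight μ₂, ∀ w₃ ∈ N₃.weight μ₃,
    F w₁ w₂ w₃ = γ (𝒴 (μ₁ + μ₂ - μ₃ - 1) w₁ w₂) w₃

variable {γ : M₃.toWeakModule →ₗ[ℂ] Module.Dual ℂ N₃.toWeakModule}
  {𝒴 : ℂ → M₁.toWeakModule →ₗ[ℂ] M₂.toWeakModule →ₗ[ℂ] M₃.toWeakModule}

theorem exists_isForm (γ : M₃.toWeakModule →ₗ[ℂ] Module.Dual ℂ N₃.toWeakModule)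
    (𝒴 : ℂ → M₁.toWeakModule →ₗ[ℂ] M₂.toWeakModule →ₗ[ℂ] M₃.toWeakModule) :
    ∃ F, IsForm γ 𝒴 F :=
  exists_trilinearMap M₁.iSup_weight M₂.iSup_weight N₃.iSup_weight
    fun μ₁ μ₂ μ₃ => (𝒴 (μ₁ + μ₂ - μ₃ - 1)).compr₂ γ

/-- An intertwining operator is determined by its trilinear form. -/
theorem IsForm.eq {F : M₁.toWeakModule →ₗ[ℂ] M₂.toWeakModule →ₗ[ℂ] N₃.toWeakModule →ₗ[ℂ] ℂ}
    {𝒵 : ℂ → M₁.toWeakModule →ₗ[ℂ] M₂.toWeakModule →ₗ[ℂ] M₃.toWeakModule}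
    (hF : IsForm γ 𝒴 F) (hF' : IsForm γ 𝒵 F)
    (hγ : IsContragredient M₃.toWeakModule N₃.toWeakModule γ)
    (h𝒴 : IsIntertwining M₁.toWeakModule M₂.toWeakModule M₃.toWeakModule 𝒴)
    (h𝒵 : IsIntertwining M₁.toWeakModule M₂.toWeakModule M₃.toWeakModule 𝒵) : 𝒴 = 𝒵 := by
  funext n
  have hc : (𝒴 n).compr₂ γ = (𝒵 n).compr₂ γ := by
    refine trilinearMap_ext M₁.iSup_weight M₂.iSup_weight N₃.iSup_weight ?_
    intro μ₁ μ₂ μ₃ w₁ hw₁ w₂ hw₂ w₃ hw₃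
    rw [LinearMap.compr₂_apply, LinearMap.compr₂_apply]
    by_cases hn : n = μ₁ + μ₂ - μ₃ - 1
    · rw [hn, ← hF _ _ _ _ hw₁ _ hw₂ _ hw₃, hF' _ _ _ _ hw₁ _ hw₂ _ hw₃]
    -- For any other index, both coefficients have a weight orthogonal to that of w₃.
    · have hne : μ₁ + μ₂ - n - 1 ≠ μ₃ := fun h => hn (by rw [← h]; ring)
      rw [hγ.apply_eq_zero hne (h𝒴.mem_weight hw₁ hw₂ n) hw₃,
        hγ.apply_eq_zero hne (h𝒵.mem_weight hw₁ hw₂ n) hw₃]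
  ext w₁ w₂
  exact hγ.1 (LinearMap.congr_fun (LinearMap.congr_fun hc w₁) w₂)

/-- The pairing moves L(-1)^k over to L(1)^k on w₃, which gives E with alternating signs. The
normalization times the skew phase is e^{πi[(μ₁-h₁)+(μ₂-h₂)-(μ₃-h₃)]}, a product of three sign
operators because μ₃ - h₃ is an integer. -/
theorem IsForm.skew {F : M₁.toWeakModule →ₗ[ℂ] M₂.toWeakModule →ₗ[ℂ] N₃.toWeakModule →ₗ[ℂ] ℂ}
    {G : M₂.toWeakModule →ₗ[ℂ] M₁.toWeakModule →ₗ[ℂ] N₃.toWeakModule →ₗ[ℂ] ℂ}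
    {𝒵 : ℂ → M₂.toWeakModule →ₗ[ℂ] M₁.toWeakModule →ₗ[ℂ] M₃.toWeakModule}
    (hF : IsForm γ 𝒴 F) (hG : IsForm γ 𝒵 G)
    (hγ : IsContragredient M₃.toWeakModule N₃.toWeakModule γ)
    (h𝒴 : IsIntertwining M₁.toWeakModule M₂.toWeakModule M₃.toWeakModule 𝒴)
    (h𝒵 : ∀ n w₂ w₁, 𝒵 n w₂ w₁ = Complex.exp (Real.pi * Complex.I *
      (M₃.lowestWeight - M₁.lowestWeight - M₂.lowestWeight)) • skewOp (-1) 𝒴 n w₂ w₁)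
    (w₂ : M₂.toWeakModule) (w₁ : M₁.toWeakModule) (w₃ : N₃.toWeakModule) :
    G w₂ w₁ w₃ = F (M₁.sign w₁) (M₂.sign w₂) (N₃.sign (N₃.expLOne w₃)) := by
  have hS : G = ((F.compl₁₂ M₁.sign M₂.sign).compr₂
      (LinearMap.lcomp ℂ ℂ (N₃.sign ∘ₗ N₃.expLOne))).flip := by
    refine trilinearMap_ext M₂.iSup_weight M₁.iSup_weight N₃.iSup_weight ?_
    intro μ₂ μ₁ μ₃ w₂ hw₂ w₁ hw₁ w₃ hw₃
    change G w₂ w₁ w₃ = F (M₁.sign w₁) (M₂.sign w₂) (N₃.sign (N₃.expLOne w₃))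
    have hl : M₃.lowestWeight = N₃.lowestWeight := IrreducibleModule.lowestWeight_eq hγ
    rcases N₃.eq_zero_or_exists_int hw₃ with rfl | hk
    · simp only [map_zero]
    obtain ⟨B₁, hB₁⟩ := h𝒴.exists_bound (μ₂ + μ₁ - μ₃ - 1) w₁ w₂
    obtain ⟨B₂, hB₂⟩ := N₃.LOneNilpotent.divPow_eq_zero w₃
    rw [hG _ _ _ _ hw₂ _ hw₁ _ hw₃, h𝒵,
      skewOp_eq_sum (B := max B₁ B₂) fun k hk => hB₁ k (le_of_max_le_left hk),
      M₁.sign_apply hw₁, M₂.sign_apply hw₂,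
      N₃.sign_expLOne_apply hw₃ (B := max B₁ B₂) fun k hk => hB₂ k (le_of_max_le_right hk)]
    simp only [map_smul, map_sum, LinearMap.smul_apply, LinearMap.sum_apply, smul_smul, smul_eq_mul,
      mul_sum]
    refine sum_congr rfl fun k _ => ?_
    have hd := (hγ.symm N₃.iSup_weight N₃.finite_weight).divPow_L_one k w₃
      (𝒴 (μ₂ + μ₁ - μ₃ - 1 + k) w₁ w₂)
    rw [LinearMap.flip_apply, LinearMap.flip_apply] at hd
    rw [← hd, hF _ _ _ _ hw₁ _ hw₂ _ (N₃.divPow_L_one_mem_weight hw₃ k),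
      show μ₁ + μ₂ - (μ₃ - k) - 1 = μ₂ + μ₁ - μ₃ - 1 + (k : ℂ) by ring, skewPhase, hl]
    have he : Complex.exp (Real.pi * Complex.I *
          (N₃.lowestWeight - M₁.lowestWeight - M₂.lowestWeight)) *
        Complex.exp (Real.pi * Complex.I * (μ₂ + μ₁ - μ₃ - 1 + 1))
        = Complex.exp (Real.pi * Complex.I * (μ₁ - M₁.lowestWeight)) *
          Complex.exp (Real.pi * Complex.I * (μ₂ - M₂.lowestWeight)) *
          Complex.exp (Real.pi * Complex.I * (μ₃ - N₃.lowestWeight)) := by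
      -- Insert 1 = e^{2πi(μ₃ - h₃)} to reverse the sign of μ₃ - h₃ in the exponent.
      rw [← mul_one (_ * Complex.exp (Real.pi * Complex.I * (μ₂ + μ₁ - μ₃ - 1 + 1))),
        ← IrreducibleModule.exp_pi_mul_self_of_int hk]
      simp only [← Complex.exp_add]
      congr 1
      ring
    linear_combination ((-1 : ℂ) ^ k * γ (𝒴 (μ₂ + μ₁ - μ₃ - 1 + k) w₁ w₂)
      (divPow (N₃.L 1) k w₃)) * he
  rw [hS]
  rfl

variable {β : N₂.toWeakModule →ₗ[ℂ] Module.Dual ℂ M₂.toWeakModule}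
  {Z : ℂ → M₁.toWeakModule →ₗ[ℂ] M₂.toWeakModule →ₗ[ℂ] M₃.toWeakModule}

/-- At x = 1 the opposite operator is 𝒴(e^{L(1)} e^{-πiL(0)} w₁, 1). With the normalization the
phase is e^{πi(h₁-μ₁)}, which equals e^{πi(μ₁-h₁)} because μ₁ - h₁ is an integer. -/
theorem IsForm.transpose {F : M₁.toWeakModule →ₗ[ℂ] M₂.toWeakModule →ₗ[ℂ] N₃.toWeakModule →ₗ[ℂ] ℂ}
    {G : M₁.toWeakModule →ₗ[ℂ] N₃.toWeakModule →ₗ[ℂ] M₂.toWeakModule →ₗ[ℂ] ℂ}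
    {𝒵 : ℂ → M₁.toWeakModule →ₗ[ℂ] N₃.toWeakModule →ₗ[ℂ] N₂.toWeakModule}
    (hF : IsForm γ 𝒴 F) (hG : IsForm β 𝒵 G) (hZ : IsOpposite 𝒴 Z)
    (h𝒵 : ∀ n w₁ w₃ w₂, β (𝒵 n w₁ w₃) w₂
      = Complex.exp (Real.pi * Complex.I * M₁.lowestWeight) * γ (Z n w₁ w₂) w₃)
    (w₁ : M₁.toWeakModule) (w₃ : N₃.toWeakModule) (w₂ : M₂.toWeakModule) :
    G w₁ w₃ w₂ = F (M₁.expLOne (M₁.sign w₁)) w₂ w₃ := by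
  have hS : G = (F ∘ₗ M₁.expLOne ∘ₗ M₁.sign).flipLast := by
    refine trilinearMap_ext M₁.iSup_weight N₃.iSup_weight M₂.iSup_weight ?_
    intro μ₁ μ₃ μ₂ w₁ hw₁ w₃ hw₃ w₂ hw₂
    change G w₁ w₃ w₂ = F (M₁.expLOne (M₁.sign w₁)) w₂ w₃
    rcases M₁.eq_zero_or_exists_int hw₁ with rfl | hk
    · simp only [map_zero, LinearMap.zero_apply]
    obtain ⟨B, hB⟩ := M₁.LOneNilpotent.divPow_eq_zero w₁
    rw [hG _ _ _ _ hw₁ _ hw₃ _ hw₂, h𝒵, hZ.apply_eq_sum hw₁ hB, M₁.sign_apply hw₁, map_smul,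
      M₁.expLOne_apply hB]
    simp only [map_smul, map_sum, LinearMap.smul_apply, LinearMap.sum_apply, smul_eq_mul, mul_sum]
    refine sum_congr rfl fun k _ => ?_
    rw [hF _ _ _ _ (M₁.divPow_L_one_mem_weight hw₁ k) _ hw₂ _ hw₃,
      show 2 * μ₁ - k - (μ₁ + μ₃ - μ₂ - 1) - 2 = μ₁ - k + μ₂ - μ₃ - 1 by ring, oppPhase,
      ← mul_assoc]
    congr 1
    rw [← mul_one (Complex.exp (Real.pi * Complex.I * M₁.lowestWeight) * _),
      ← IrreducibleModule.exp_pi_mul_self_of_int hk]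
    simp only [← Complex.exp_add]
    congr 1
    ring
  rw [hS]
  rfl

end Forms

/-! ### The transposed opposite operator is intertwining. -/

section Transpose

variable {V : Type u} [AddCommGroup V] [Module ℂ V] {X : VOA V}

open WeakModule

variable {M₁ M₂ M₃ N₂ N₃ : IrreducibleModule X}
  {γ : M₃.toWeakModule →ₗ[ℂ] Module.Dual ℂ N₃.toWeakModule}
  {β : N₂.toWeakModule →ₗ[ℂ] Module.Dual ℂ M₂.toWeakModule}
  {𝒴 Z : ℂ → M₁.toWeakModule →ₗ[ℂ] M₂.toWeakModule →ₗ[ℂ] M₃.toWeakModule}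

/-- The functional `w₂ ↦ ⟨Z_n(w₁) w₂, w₃⟩`, as a bilinear function of `w₁` and `w₃`. -/
noncomputable def transposeMap (γ : M₃.toWeakModule →ₗ[ℂ] Module.Dual ℂ N₃.toWeakModule)
    (Z : M₁.toWeakModule →ₗ[ℂ] M₂.toWeakModule →ₗ[ℂ] M₃.toWeakModule) :
    M₁.toWeakModule →ₗ[ℂ] N₃.toWeakModule →ₗ[ℂ] Module.Dual ℂ M₂.toWeakModule :=
  (Z.compr₂ γ).flipLast

theorem transposeMap_mem_dualWeight (hγ : IsContragredient M₃.toWeakModule N₃.toWeakModule γ)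
    (h : IsIntertwining M₁.toWeakModule M₂.toWeakModule M₃.toWeakModule 𝒴) (hZ : IsOpposite 𝒴 Z)
    {μ₁ μ₃ : ℂ} {w₁ : M₁.toWeakModule} {w₃ : N₃.toWeakModule} (hw₁ : w₁ ∈ M₁.weight μ₁)
    (hw₃ : w₃ ∈ N₃.weight μ₃) (n : ℂ) :
    transposeMap γ (Z n) w₁ w₃ ∈ M₂.dualWeight (μ₃ + μ₁ - n - 1) := by
  rw [mem_dualWeight]
  intro ν hν w₂ hw₂
  refine hγ.apply_eq_zero (fun heq => hν ?_) (hZ.mem_weight h M₁.LOneNilpotent hw₁ hw₂ n) hw₃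
  rw [← heq]
  ring

theorem transposeMap_mem_gradedDual (hγ : IsContragredient M₃.toWeakModule N₃.toWeakModule γ)
    (h : IsIntertwining M₁.toWeakModule M₂.toWeakModule M₃.toWeakModule 𝒴) (hZ : IsOpposite 𝒴 Z)
    (n : ℂ) (w₁ : M₁.toWeakModule) (w₃ : N₃.toWeakModule) :
    transposeMap γ (Z n) w₁ w₃ ∈ M₂.gradedDual := by
  refine induction_weight M₁.iSup_weight
    (p := fun w₁ => transposeMap γ (Z n) w₁ w₃ ∈ M₂.gradedDual) w₁ (fun μ₁ w₁ hw₁ => ?_)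
    (by rw [map_zero]; exact Submodule.zero_mem _)
    fun x y hx hy => by rw [map_add]; exact Submodule.add_mem _ hx hy
  exact induction_weight N₃.iSup_weight
    (p := fun w₃ => transposeMap γ (Z n) w₁ w₃ ∈ M₂.gradedDual) w₃
    (fun μ₃ w₃ hw₃ => dualWeight_le_gradedDual _ (transposeMap_mem_dualWeight hγ h hZ hw₁ hw₃ n))
    (by rw [map_zero]; exact Submodule.zero_mem _)
    fun x y hx hy => by rw [map_add]; exact Submodule.add_mem _ hx hy

theorem transpose_truncation (hγ : IsContragredient M₃.toWeakModule N₃.toWeakModule γ)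
    (hβ : IsContragredient N₂.toWeakModule M₂.toWeakModule β)
    (h : IsIntertwining M₁.toWeakModule M₂.toWeakModule M₃.toWeakModule 𝒴) (hZ : IsOpposite 𝒴 Z)
    {𝒵 : ℂ → M₁.toWeakModule →ₗ[ℂ] N₃.toWeakModule →ₗ[ℂ] N₂.toWeakModule} {c : ℂ}
    (h𝒵 : ∀ n w₁ w₃, β (𝒵 n w₁ w₃) = c • transposeMap γ (Z n) w₁ w₃)
    (w₁ : M₁.toWeakModule) (w₃ : N₃.toWeakModule) :
    ∃ N : ℝ, ∀ n : ℂ, N ≤ n.re → 𝒵 n w₁ w₃ = 0 := by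
  have hadd : ∀ {f g : ℂ → N₂.toWeakModule}, (∃ N : ℝ, ∀ n : ℂ, N ≤ n.re → f n = 0) →
      (∃ N : ℝ, ∀ n : ℂ, N ≤ n.re → g n = 0) → ∃ N : ℝ, ∀ n : ℂ, N ≤ n.re → f n + g n = 0 := by
    rintro f g ⟨a, ha⟩ ⟨b, hb⟩
    exact ⟨max a b, fun n hn => by
      rw [ha n ((le_max_left _ _).trans hn), hb n ((le_max_right _ _).trans hn), add_zero]⟩
  refine induction_weight M₁.iSup_weight
    (p := fun w₁ => ∃ N : ℝ, ∀ n : ℂ, N ≤ n.re → 𝒵 n w₁ w₃ = 0) w₁ (fun μ₁ w₁ hw₁ => ?_)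
    ⟨0, fun n _ => by rw [map_zero, LinearMap.zero_apply]⟩
    fun x y hx hy => by
      simp only [map_add, LinearMap.add_apply]
      exact hadd hx hy
  refine induction_weight N₃.iSup_weight
    (p := fun w₃ => ∃ N : ℝ, ∀ n : ℂ, N ≤ n.re → 𝒵 n w₁ w₃ = 0) w₃ (fun μ₃ w₃ hw₃ => ?_)
    ⟨0, fun n _ => map_zero _⟩
    fun x y hx hy => by
      simp only [map_add]
      exact hadd hx hy
  obtain ⟨N, hN⟩ := N₂.bounded_weight
  refine ⟨(μ₃ + μ₁).re - N, fun n hn => ?_⟩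
  have hmem : 𝒵 n w₁ w₃ ∈ N₂.weight (μ₃ + μ₁ - n - 1) := by
    rw [hβ.mem_weight_iff M₂.iSup_weight, h𝒵]
    exact Submodule.smul_mem _ _ (transposeMap_mem_dualWeight hγ h hZ hw₁ hw₃ n)
  rwa [hN _ (by simp only [Complex.sub_re, Complex.one_re]; linarith), Submodule.mem_bot] at hmem

/-- Weight considerations put the transposed functionals in the graded dual of `M₂`, the range of
`β`, so they lift to `N₂`. Injectivity of `β` then lifts the axioms from the opposite operator. -/
theorem exists_transpose (hγ : IsContragredient M₃.toWeakModule N₃.toWeakModule γ)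
    (hβ : IsContragredient N₂.toWeakModule M₂.toWeakModule β)
    (h : IsIntertwining M₁.toWeakModule M₂.toWeakModule M₃.toWeakModule 𝒴) (hZ : IsOpposite 𝒴 Z)
    (c : ℂ) :
    ∃ 𝒵, IsIntertwining M₁.toWeakModule N₃.toWeakModule N₂.toWeakModule 𝒵 ∧
      ∀ n w₁ w₃ w₂, β (𝒵 n w₁ w₃) w₂ = c * γ (Z n w₁ w₂) w₃ := by
  obtain ⟨g, hg⟩ := LinearMap.exists_leftInverse_of_injective β (LinearMap.ker_eq_bot.mpr hβ.1)
  have hbg : ∀ φ ∈ M₂.gradedDual, β (g φ) = φ := by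
    intro φ hφ
    obtain ⟨x, rfl⟩ : φ ∈ LinearMap.range β := hβ.2.1 ▸ hφ
    exact congrArg β (LinearMap.congr_fun hg x)
  let 𝒵 : ℂ → M₁.toWeakModule →ₗ[ℂ] N₃.toWeakModule →ₗ[ℂ] N₂.toWeakModule := fun n =>
    c • (transposeMap γ (Z n)).compr₂ g
  have h𝒵 : ∀ n w₁ w₃, β (𝒵 n w₁ w₃) = c • transposeMap γ (Z n) w₁ w₃ := by
    intro n w₁ w₃
    change β (c • g (transposeMap γ (Z n) w₁ w₃)) = _
    rw [map_smul, hbg _ (transposeMap_mem_gradedDual hγ h hZ n w₁ w₃)]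
  have h𝒵' : ∀ n w₁ w₃ w₂, β (𝒵 n w₁ w₃) w₂ = c * γ (Z n w₁ w₂) w₃ := by
    intro n w₁ w₃ w₂
    rw [h𝒵]
    rfl
  obtain ⟨Z₂, hZ₂⟩ := M₂.exists_isOppositeMode
  obtain ⟨Z₃, hZ₃⟩ := M₃.exists_isOppositeMode
  have hγs := hγ.symm N₃.iSup_weight N₃.finite_weight
  have htr := transpose_truncation hγ hβ h hZ h𝒵
  refine ⟨𝒵, ⟨htr, ?_, fun n w₁ w₃ => hβ.1 ?_⟩, h𝒵'⟩
  -- The scalar c is absorbed into the pairing on the source side, where injectivity is not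
  -- required; thus c may be arbitrary.
  · refine jacobiIdentity_of_transpose β hβ.1 (c • γ.flip)
      ((isContragredient_iff hZ₂).mp hβ).2.2 (Z₃ := Z₃) (fun m v p w => ?_) h𝒵'
      (fun n w₁ w₃ => exists_bound_of_truncation (htr w₁ w₃) n) N₃.exists_bound M₁.exists_bound
      hZ₂.exists_bound (hZ.exists_bound h M₁.iSup_weight M₁.LOneNilpotent)
      (h.opposite_jacobi M₁.iSup_weight M₁.LOneNilpotent hZ hZ₂ hZ₃)
    exact congrArg (c * ·) (((isContragredient_iff hZ₃).mp hγs).2.2 m v p w)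
  · ext w₂
    rw [h𝒵', hZ.derivative h M₁.iSup_weight M₁.LOneNilpotent, map_smul, map_smul,
      LinearMap.smul_apply, LinearMap.smul_apply, h𝒵', smul_eq_mul, smul_eq_mul, mul_left_comm]

/-- The coefficient of `A_{-1}(𝒴)`, as a functional, is the transpose of the opposite operator. -/
theorem contragredientOp_apply (hZ : IsOpposite 𝒴 Z) {μ : ℂ} {w₁ : M₁.toWeakModule}
    (hw₁ : w₁ ∈ M₁.weight μ) (n : ℂ) (f : Module.Dual ℂ M₃.toWeakModule) (w₂ : M₂.toWeakModule) :
    contragredientOp (-1) 𝒴 μ n w₁ f w₂ = f (Z n w₁ w₂) := by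
  obtain ⟨B, hB⟩ := M₁.LOneNilpotent w₁
  rw [contragredientOp, finsum_eq_sum_range (B := B) fun k hk => by
      rw [hB k hk, map_zero, LinearMap.comp_zero, smul_zero],
    hZ.apply_eq_sum hw₁ (B := B) fun k hk => by rw [divPow_apply, hB k hk, smul_zero],
    map_sum, LinearMap.sum_apply]
  refine sum_congr rfl fun k _ => ?_
  rw [divPow_apply, map_smul, map_smul, LinearMap.smul_apply, LinearMap.smul_apply, map_smul,
    smul_eq_mul, smul_eq_mul, smul_eq_mul, LinearMap.comp_apply, oppPhase,
    show (2 * ((-1 : ℤ) : ℂ) + 1) * Real.pi * Complex.I * μ = -(Real.pi * Complex.I * μ) by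
      push_cast; ring]
  ring

end Transpose

/-! ### A presentation of S₃. -/

section SymmetricGroup

theorem perm_fin_three_cases (σ : Equiv.Perm (Fin 3)) :
    σ = 1 ∨ σ = Equiv.swap 0 1 ∨ σ = Equiv.swap 1 2 ∨ σ = Equiv.swap 0 1 * Equiv.swap 1 2 ∨
      σ = Equiv.swap 1 2 * Equiv.swap 0 1 ∨
      σ = Equiv.swap 0 1 * (Equiv.swap 1 2 * Equiv.swap 0 1) := by
  revert σ
  decide

theorem monoidHom_perm_fin_three_ext {M : Type*} [Monoid M] {f g : Equiv.Perm (Fin 3) →* M}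
    (h₁ : f (Equiv.swap 0 1) = g (Equiv.swap 0 1)) (h₂ : f (Equiv.swap 1 2) = g (Equiv.swap 1 2)) :
    f = g := by
  ext σ
  rcases perm_fin_three_cases σ with rfl | rfl | rfl | rfl | rfl | rfl <;>
    simp only [map_mul, map_one, h₁, h₂]

/-- The presentation of the symmetric group on three letters by two adjacent transpositions. -/
theorem exists_monoidHom_perm_fin_three {M : Type*} [Monoid M] {s t : M} (hs : s * s = 1)
    (ht : t * t = 1) (hst : s * (t * s) = t * (s * t)) :
    ∃ f : Equiv.Perm (Fin 3) →* M, f (Equiv.swap 0 1) = s ∧ f (Equiv.swap 1 2) = t := by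
  set a : Equiv.Perm (Fin 3) := Equiv.swap 0 1 with ha
  set b : Equiv.Perm (Fin 3) := Equiv.swap 1 2 with hb
  have hs' : ∀ x, s * (s * x) = x := fun x => by rw [← mul_assoc, hs, one_mul]
  have ht' : ∀ x, t * (t * x) = x := fun x => by rw [← mul_assoc, ht, one_mul]
  -- The map is a table of reduced words in the two generators. Multiplicativity follows from
  -- compatibility with left multiplication by each generator, checked on six elements.
  let f : Equiv.Perm (Fin 3) → M := fun σ =>
    if σ = 1 then 1 else if σ = a then s else if σ = b then t else if σ = a * b then s * t
    else if σ = b * a then t * s else s * (t * s)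
  have f₁ : f 1 = 1 := rfl
  have f₂ : f a = s := rfl
  have f₃ : f b = t := rfl
  have f₄ : f (a * b) = s * t := rfl
  have f₅ : f (b * a) = t * s := rfl
  have f₆ : f (a * (b * a)) = s * (t * s) := rfl
  have hfa : ∀ σ, f (a * σ) = s * f σ := by
    intro σ
    rcases perm_fin_three_cases σ with rfl | rfl | rfl | rfl | rfl | rfl
    · rw [mul_one, f₁, f₂, mul_one]
    · rw [← ha, show a * a = 1 by decide, f₁, f₂, hs]
    · rw [← hb, f₃, f₄]
    · rw [← ha, ← hb, show a * (a * b) = b by decide, f₃, f₄, hs']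
    · rw [← ha, ← hb, f₅, f₆]
    · rw [← ha, ← hb, show a * (a * (b * a)) = b * a by decide, f₅, f₆, hs']
  have hfb : ∀ σ, f (b * σ) = t * f σ := by
    intro σ
    rcases perm_fin_three_cases σ with rfl | rfl | rfl | rfl | rfl | rfl
    · rw [mul_one, f₁, f₃, mul_one]
    · rw [← ha, f₂, f₅]
    · rw [← hb, show b * b = 1 by decide, f₁, f₃, ht]
    · rw [← ha, ← hb, show b * (a * b) = a * (b * a) by decide, f₆, f₄, hst]
    · rw [← ha, ← hb, show b * (b * a) = a by decide, f₂, f₅, ht']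
    · rw [← ha, ← hb, show b * (a * (b * a)) = a * b by decide, f₄, f₆, hst, ht']
  refine ⟨⟨⟨f, f₁⟩, fun σ τ => ?_⟩, f₂, f₃⟩
  change f (σ * τ) = f σ * f τ
  rcases perm_fin_three_cases σ with rfl | rfl | rfl | rfl | rfl | rfl <;>
    simp only [← ha, ← hb, mul_assoc, hfa, hfb, f₁, f₂, f₃, one_mul]

end SymmetricGroup

/-! ### The maps σ₁₂ and σ₂₃ and the relations of S₃. -/

section Action

variable {V : Type u} [AddCommGroup V] [Module ℂ V] {X : VOA V}

namespace Representatives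

open WeakModule

variable (C : Representatives X) {a₁ a₂ a₃ b₂ b₃ : IrrClass X}

/-- The trilinear form `⟨𝒴(w₁, 1) w₂, w₃⟩` of an intertwining operator. -/
noncomputable def form (h : C.dual b₃ = a₃) : C.space a₁ a₂ a₃ →ₗ[ℂ]
    ((C.W a₁).toWeakModule →ₗ[ℂ] (C.W a₂).toWeakModule →ₗ[ℂ] (C.W b₃).toWeakModule →ₗ[ℂ] ℂ) where
  toFun 𝒴 := (exists_isForm (C.pairing b₃ a₃ h) 𝒴.1).choose
  map_add' 𝒴 𝒵 := by
    refine trilinearMap_ext (C.W a₁).iSup_weight (C.W a₂).iSup_weight (C.W b₃).iSup_weight ?_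
    intro μ₁ μ₂ μ₃ w₁ hw₁ w₂ hw₂ w₃ hw₃
    simp only [LinearMap.add_apply]
    rw [(exists_isForm (C.pairing b₃ a₃ h) (𝒴 + 𝒵).1).choose_spec _ _ _ _ hw₁ _ hw₂ _ hw₃,
      (exists_isForm (C.pairing b₃ a₃ h) 𝒴.1).choose_spec _ _ _ _ hw₁ _ hw₂ _ hw₃,
      (exists_isForm (C.pairing b₃ a₃ h) 𝒵.1).choose_spec _ _ _ _ hw₁ _ hw₂ _ hw₃]
    simp
  map_smul' c 𝒴 := by
    refine trilinearMap_ext (C.W a₁).iSup_weight (C.W a₂).iSup_weight (C.W b₃).iSup_weight ?_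
    intro μ₁ μ₂ μ₃ w₁ hw₁ w₂ hw₂ w₃ hw₃
    simp only [LinearMap.smul_apply, RingHom.id_apply]
    rw [(exists_isForm (C.pairing b₃ a₃ h) (c • 𝒴).1).choose_spec _ _ _ _ hw₁ _ hw₂ _ hw₃,
      (exists_isForm (C.pairing b₃ a₃ h) 𝒴.1).choose_spec _ _ _ _ hw₁ _ hw₂ _ hw₃]
    simp

theorem isForm_form (h : C.dual b₃ = a₃) (𝒴 : C.space a₁ a₂ a₃) :
    IsForm (C.pairing b₃ a₃ h) 𝒴.1 (C.form h 𝒴) :=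
  (exists_isForm (C.pairing b₃ a₃ h) 𝒴.1).choose_spec

theorem form_injective (h : C.dual b₃ = a₃) :
    Function.Injective (C.form (a₁ := a₁) (a₂ := a₂) h) := by
  intro 𝒴 𝒵 heq
  have h𝒵 := C.isForm_form h 𝒵
  rw [← heq] at h𝒵
  exact Subtype.ext ((C.isForm_form h 𝒴).eq h𝒵 (C.isContragredient b₃ a₃ h) 𝒴.2 𝒵.2)

theorem form_ext (h : C.dual b₃ = a₃) {𝒴 𝒵 : C.space a₁ a₂ a₃}
    (heq : ∀ w₁ w₂ w₃, C.form h 𝒴 w₁ w₂ w₃ = C.form h 𝒵 w₁ w₂ w₃) : 𝒴 = 𝒵 :=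
  C.form_injective h (LinearMap.ext fun w₁ => LinearMap.ext fun w₂ => LinearMap.ext fun w₃ =>
    heq w₁ w₂ w₃)

theorem exists_isSigma₁₂ (𝒴 : C.space a₁ a₂ a₃) : ∃ 𝒵 : C.space a₂ a₁ a₃, C.IsSigma₁₂ 𝒴 𝒵 :=
  ⟨⟨_, Submodule.smul_mem _
    (Complex.exp (Real.pi * Complex.I * (C.h a₃ - C.h a₁ - C.h a₂))) 𝒴.2.isIntertwining_skew⟩,
    fun _ _ _ => rfl⟩

variable {C}

theorem IsSigma₁₂.eq {𝒴 : C.space a₁ a₂ a₃} {𝒵 𝒵' : C.space a₂ a₁ a₃} (h𝒵 : C.IsSigma₁₂ 𝒴 𝒵)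
    (h𝒵' : C.IsSigma₁₂ 𝒴 𝒵') : 𝒵 = 𝒵' := by
  refine Subtype.ext (funext fun n => ?_)
  ext w₂ w₁
  rw [h𝒵, h𝒵']

theorem IsSigma₁₂.form_apply {𝒴 : C.space a₁ a₂ a₃} {𝒵 : C.space a₂ a₁ a₃} (h𝒵 : C.IsSigma₁₂ 𝒴 𝒵)
    (h : C.dual b₃ = a₃) (w₂ : (C.W a₂).toWeakModule) (w₁ : (C.W a₁).toWeakModule)
    (w₃ : (C.W b₃).toWeakModule) :
    C.form h 𝒵 w₂ w₁ w₃ = C.form h 𝒴 ((C.W a₁).sign w₁) ((C.W a₂).sign w₂)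
      ((C.W b₃).sign ((C.W b₃).expLOne w₃)) :=
  (C.isForm_form h 𝒴).skew (C.isForm_form h 𝒵) (C.isContragredient b₃ a₃ h) 𝒴.2 h𝒵 w₂ w₁ w₃

variable (C)

/-- The map `σ₁₂`. -/
noncomputable def sigma₁₂ (a₁ a₂ a₃ : IrrClass X) : C.space a₁ a₂ a₃ →ₗ[ℂ] C.space a₂ a₁ a₃ where
  toFun 𝒴 := (C.exists_isSigma₁₂ 𝒴).choose
  -- Linearity is inherited through forms, since the substitution formula is linear in `𝒴`.
  map_add' 𝒴 𝒵 := C.form_ext (C.dual_dual a₃) fun w₁ w₂ w₃ => by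
    rw [map_add, LinearMap.add_apply, LinearMap.add_apply, LinearMap.add_apply,
      (C.exists_isSigma₁₂ (𝒴 + 𝒵)).choose_spec.form_apply,
      (C.exists_isSigma₁₂ 𝒴).choose_spec.form_apply, (C.exists_isSigma₁₂ 𝒵).choose_spec.form_apply,
      map_add]
    rfl
  map_smul' c 𝒴 := C.form_ext (C.dual_dual a₃) fun w₁ w₂ w₃ => by
    rw [map_smul, LinearMap.smul_apply, LinearMap.smul_apply, LinearMap.smul_apply,
      (C.exists_isSigma₁₂ (c • 𝒴)).choose_spec.form_apply,
      (C.exists_isSigma₁₂ 𝒴).choose_spec.form_apply, map_smul]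
    rfl

theorem isSigma₁₂_sigma₁₂ (𝒴 : C.space a₁ a₂ a₃) : C.IsSigma₁₂ 𝒴 (C.sigma₁₂ a₁ a₂ a₃ 𝒴) :=
  (C.exists_isSigma₁₂ 𝒴).choose_spec

/-- `𝒵 = σ₂₃(𝒴)`, where `b₃` stands for `a₃'` and `b₂` for `a₂'`. -/
def IsSigma₂₃Of (h₃ : C.dual b₃ = a₃) (h₂ : C.dual a₂ = b₂) (𝒴 : C.space a₁ a₂ a₃)
    (𝒵 : C.space a₁ b₃ b₂) : Prop :=
  ∀ (μ : ℂ), ∀ w₁ ∈ (C.W a₁).weight μ, ∀ (n : ℂ) (w₃ : (C.W b₃).toWeakModule),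
    C.pairing a₂ b₂ h₂ (𝒵.1 n w₁ w₃)
      = Complex.exp (Real.pi * Complex.I * C.h a₁) •
          contragredientOp (-1) 𝒴.1 μ n w₁ ((C.pairing b₃ a₃ h₃).flip w₃)

theorem exists_isSigma₂₃Of (h₃ : C.dual b₃ = a₃) (h₂ : C.dual a₂ = b₂) (𝒴 : C.space a₁ a₂ a₃) :
    ∃ 𝒵 : C.space a₁ b₃ b₂, C.IsSigma₂₃Of h₃ h₂ 𝒴 𝒵 := by
  obtain ⟨Z, hZ⟩ := exists_isOpposite (C.W a₁).iSup_weight (C.W a₁).LOneNilpotent 𝒴.1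
  obtain ⟨𝒵, h𝒵, he⟩ := exists_transpose (C.isContragredient b₃ a₃ h₃)
    (C.isContragredient a₂ b₂ h₂) 𝒴.2 hZ (Complex.exp (Real.pi * Complex.I * C.h a₁))
  refine ⟨⟨𝒵, h𝒵⟩, fun μ w₁ hw₁ n w₃ => ?_⟩
  ext w₂
  rw [he, LinearMap.smul_apply, contragredientOp_apply hZ hw₁, smul_eq_mul, LinearMap.flip_apply]

variable {C}

theorem IsSigma₂₃Of.eq {h₃ : C.dual b₃ = a₃} {h₂ : C.dual a₂ = b₂} {𝒴 : C.space a₁ a₂ a₃}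
    {𝒵 𝒵' : C.space a₁ b₃ b₂} (h𝒵 : C.IsSigma₂₃Of h₃ h₂ 𝒴 𝒵) (h𝒵' : C.IsSigma₂₃Of h₃ h₂ 𝒴 𝒵') :
    𝒵 = 𝒵' := by
  refine Subtype.ext (funext fun n => ?_)
  ext w₁ w₃
  refine induction_weight (C.W a₁).iSup_weight (p := fun w₁ => 𝒵.1 n w₁ w₃ = 𝒵'.1 n w₁ w₃) w₁
    (fun μ w₁ hw₁ => (C.isContragredient a₂ b₂ h₂).1 ?_) (by simp)
    fun x y hx hy => by simp only [map_add, LinearMap.add_apply, hx, hy]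
  rw [h𝒵 μ w₁ hw₁, h𝒵' μ w₁ hw₁]

theorem IsSigma₂₃Of.form_apply {h₃ : C.dual b₃ = a₃} {h₂ : C.dual a₂ = b₂} {𝒴 : C.space a₁ a₂ a₃}
    {𝒵 : C.space a₁ b₃ b₂} (h𝒵 : C.IsSigma₂₃Of h₃ h₂ 𝒴 𝒵) (w₁ : (C.W a₁).toWeakModule)
    (w₃ : (C.W b₃).toWeakModule) (w₂ : (C.W a₂).toWeakModule) :
    C.form h₂ 𝒵 w₁ w₃ w₂ = C.form h₃ 𝒴 ((C.W a₁).expLOne ((C.W a₁).sign w₁)) w₂ w₃ := by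
  obtain ⟨Z, hZ⟩ := exists_isOpposite (C.W a₁).iSup_weight (C.W a₁).LOneNilpotent 𝒴.1
  refine (C.isForm_form h₃ 𝒴).transpose (C.isForm_form h₂ 𝒵) hZ (fun n w₁ w₃ w₂ => ?_) w₁ w₃ w₂
  refine induction_weight (C.W a₁).iSup_weight (p := fun w₁ =>
    C.pairing a₂ b₂ h₂ (𝒵.1 n w₁ w₃) w₂ = Complex.exp (Real.pi * Complex.I * C.h a₁) *
      C.pairing b₃ a₃ h₃ (Z n w₁ w₂) w₃) w₁ (fun μ w₁ hw₁ => ?_) (by simp)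
    fun x y hx hy => by simp only [map_add, LinearMap.add_apply, hx, hy, mul_add]
  rw [h𝒵 μ w₁ hw₁, LinearMap.smul_apply, contragredientOp_apply hZ hw₁, smul_eq_mul,
    LinearMap.flip_apply]

variable (C)

/-- The map `σ₂₃`, where `b₃` stands for `a₃'` and `b₂` for `a₂'`. -/
noncomputable def sigma₂₃ (a₁ : IrrClass X) (h₃ : C.dual b₃ = a₃) (h₂ : C.dual a₂ = b₂) :
    C.space a₁ a₂ a₃ →ₗ[ℂ] C.space a₁ b₃ b₂ where
  toFun 𝒴 := (C.exists_isSigma₂₃Of h₃ h₂ 𝒴).choose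
  map_add' 𝒴 𝒵 := C.form_ext h₂ fun w₁ w₂ w₃ => by
    rw [map_add, LinearMap.add_apply, LinearMap.add_apply, LinearMap.add_apply,
      (C.exists_isSigma₂₃Of h₃ h₂ (𝒴 + 𝒵)).choose_spec.form_apply,
      (C.exists_isSigma₂₃Of h₃ h₂ 𝒴).choose_spec.form_apply,
      (C.exists_isSigma₂₃Of h₃ h₂ 𝒵).choose_spec.form_apply, map_add]
    rfl
  map_smul' c 𝒴 := C.form_ext h₂ fun w₁ w₂ w₃ => by
    rw [map_smul, LinearMap.smul_apply, LinearMap.smul_apply, LinearMap.smul_apply,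
      (C.exists_isSigma₂₃Of h₃ h₂ (c • 𝒴)).choose_spec.form_apply,
      (C.exists_isSigma₂₃Of h₃ h₂ 𝒴).choose_spec.form_apply, map_smul]
    rfl

theorem isSigma₂₃Of_sigma₂₃ (h₃ : C.dual b₃ = a₃) (h₂ : C.dual a₂ = b₂) (𝒴 : C.space a₁ a₂ a₃) :
    C.IsSigma₂₃Of h₃ h₂ 𝒴 (C.sigma₂₃ a₁ h₃ h₂ 𝒴) :=
  (C.exists_isSigma₂₃Of h₃ h₂ 𝒴).choose_spec

/-- In forms: s² = 1 on the first two arguments and (sE)² = 1 on the third. -/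
theorem sigma₁₂_sigma₁₂ (𝒴 : C.space a₁ a₂ a₃) :
    C.sigma₁₂ a₂ a₁ a₃ (C.sigma₁₂ a₁ a₂ a₃ 𝒴) = 𝒴 := by
  refine C.form_ext (C.dual_dual a₃) fun w₁ w₂ w₃ => ?_
  rw [(C.isSigma₁₂_sigma₁₂ _).form_apply, (C.isSigma₁₂_sigma₁₂ _).form_apply,
    IrreducibleModule.sign_sign, IrreducibleModule.sign_sign,
    IrreducibleModule.sign_expLOne_involutive]

/-- In forms: (Es)² = 1 on the first argument, while the other two are exchanged twice. -/
theorem sigma₂₃_sigma₂₃ (h₃ : C.dual b₃ = a₃) (h₂ : C.dual a₂ = b₂) (𝒴 : C.space a₁ a₂ a₃) :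
    C.sigma₂₃ a₁ h₂ h₃ (C.sigma₂₃ a₁ h₃ h₂ 𝒴) = 𝒴 := by
  refine C.form_ext h₃ fun w₁ w₂ w₃ => ?_
  rw [(C.isSigma₂₃Of_sigma₂₃ _ _ _).form_apply, (C.isSigma₂₃Of_sigma₂₃ _ _ _).form_apply,
    IrreducibleModule.expLOne_sign_involutive]

/-- At (x, y, z) both forms reduce to F(Ez, sEy, sEs x), where F is the form of `𝒴`; only s² = 1 is
needed. -/
theorem sigma_braid {b₁ : IrrClass X} (h₁ : C.dual a₁ = b₁) (h₂ : C.dual a₂ = b₂)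
    (h₃ : C.dual b₃ = a₃) (𝒴 : C.space a₁ a₂ a₃) :
    C.sigma₁₂ a₂ b₃ b₁ (C.sigma₂₃ a₂ h₃ h₁ (C.sigma₁₂ a₁ a₂ a₃ 𝒴))
      = C.sigma₂₃ b₃ h₂ h₁ (C.sigma₁₂ a₁ b₃ b₂ (C.sigma₂₃ a₁ h₃ h₂ 𝒴)) := by
  refine C.form_ext h₁ fun w₁ w₂ w₃ => ?_
  rw [(C.isSigma₁₂_sigma₁₂ _).form_apply, (C.isSigma₂₃Of_sigma₂₃ _ _ _).form_apply,
    (C.isSigma₁₂_sigma₁₂ _).form_apply, (C.isSigma₂₃Of_sigma₂₃ _ _ _).form_apply,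
    (C.isSigma₁₂_sigma₁₂ _).form_apply, (C.isSigma₂₃Of_sigma₂₃ _ _ _).form_apply]
  simp only [IrreducibleModule.sign_sign]

theorem total_ext {f g : Module.End ℂ C.total}
    (h : ∀ a₁ a₂ a₃ (𝒴 : C.space a₁ a₂ a₃), f (C.incl a₁ a₂ a₃ 𝒴) = g (C.incl a₁ a₂ a₃ 𝒴)) :
    f = g := by
  classical
  refine DirectSum.linearMap_ext ℂ ?_
  rintro ⟨a₁, a₂, a₃⟩
  refine LinearMap.ext fun 𝒴 => ?_
  exact h a₁ a₂ a₃ 𝒴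

theorem exists_end (f : ∀ a₁ a₂ a₃, C.space a₁ a₂ a₃ →ₗ[ℂ] C.total) :
    ∃ F : Module.End ℂ C.total, ∀ a₁ a₂ a₃ (𝒴 : C.space a₁ a₂ a₃),
      F (C.incl a₁ a₂ a₃ 𝒴) = f a₁ a₂ a₃ 𝒴 := by
  classical
  refine ⟨DirectSum.toModule ℂ (IrrClass X × IrrClass X × IrrClass X) C.total
    fun t => f t.1 t.2.1 t.2.2, fun a₁ a₂ a₃ 𝒴 => ?_⟩
  rw [incl, DirectSum.toModule_lof]

/-- The action of `σ₁₂` on the direct sum. -/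
noncomputable def totalSigma₁₂ : Module.End ℂ C.total :=
  (C.exists_end fun a₁ a₂ a₃ => C.incl a₂ a₁ a₃ ∘ₗ C.sigma₁₂ a₁ a₂ a₃).choose

/-- The action of `σ₂₃` on the direct sum. -/
noncomputable def totalSigma₂₃ : Module.End ℂ C.total :=
  (C.exists_end fun a₁ a₂ a₃ =>
    C.incl a₁ (C.dual a₃) (C.dual a₂) ∘ₗ C.sigma₂₃ a₁ (C.dual_dual a₃) rfl).choose

theorem totalSigma₁₂_incl (𝒴 : C.space a₁ a₂ a₃) :
    C.totalSigma₁₂ (C.incl a₁ a₂ a₃ 𝒴) = C.incl a₂ a₁ a₃ (C.sigma₁₂ a₁ a₂ a₃ 𝒴) :=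
  (C.exists_end fun a₁ a₂ a₃ => C.incl a₂ a₁ a₃ ∘ₗ C.sigma₁₂ a₁ a₂ a₃).choose_spec a₁ a₂ a₃ 𝒴

/-- With the dual classes given as variables subject to equations, repeated applications of σ₂₃ need
no transport along a'' = a. -/
theorem totalSigma₂₃_incl (h₃ : C.dual b₃ = a₃) (h₂ : C.dual a₂ = b₂) (𝒴 : C.space a₁ a₂ a₃) :
    C.totalSigma₂₃ (C.incl a₁ a₂ a₃ 𝒴) = C.incl a₁ b₃ b₂ (C.sigma₂₃ a₁ h₃ h₂ 𝒴) := by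
  subst h₂
  obtain rfl : C.dual a₃ = b₃ := by rw [← h₃, C.dual_dual]
  exact (C.exists_end fun a₁ a₂ a₃ => C.incl a₁ (C.dual a₃) (C.dual a₂) ∘ₗ
    C.sigma₂₃ a₁ (C.dual_dual a₃) rfl).choose_spec a₁ a₂ a₃ 𝒴

theorem totalSigma₁₂_mul_self : C.totalSigma₁₂ * C.totalSigma₁₂ = 1 := by
  refine C.total_ext fun a₁ a₂ a₃ 𝒴 => ?_
  rw [Module.End.mul_apply, totalSigma₁₂_incl, totalSigma₁₂_incl, sigma₁₂_sigma₁₂,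
    Module.End.one_apply]

theorem totalSigma₂₃_mul_self : C.totalSigma₂₃ * C.totalSigma₂₃ = 1 := by
  refine C.total_ext fun a₁ a₂ a₃ 𝒴 => ?_
  rw [Module.End.mul_apply, C.totalSigma₂₃_incl (C.dual_dual a₃) rfl,
    C.totalSigma₂₃_incl rfl (C.dual_dual a₃), sigma₂₃_sigma₂₃, Module.End.one_apply]

theorem totalSigma_braid : C.totalSigma₁₂ * (C.totalSigma₂₃ * C.totalSigma₁₂)
    = C.totalSigma₂₃ * (C.totalSigma₁₂ * C.totalSigma₂₃) := by
  refine C.total_ext fun a₁ a₂ a₃ 𝒴 => ?_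
  simp only [Module.End.mul_apply]
  rw [totalSigma₁₂_incl, C.totalSigma₂₃_incl (C.dual_dual a₃) rfl, totalSigma₁₂_incl,
    C.totalSigma₂₃_incl (C.dual_dual a₃) rfl, totalSigma₁₂_incl,
    C.totalSigma₂₃_incl rfl rfl, sigma_braid]

end Representatives

end Action

theorem proposition1p1 {V : Type u} [AddCommGroup V] [Module ℂ V] (X : VOA V)
    (hX : X.StandingAssumptions) :
    Nonempty (Representatives X) ∧
    ∀ C : Representatives X,
      ∃! ρ : Representation ℂ (Equiv.Perm (Fin 3)) C.total,
        (∀ (a₁ a₂ a₃ : IrrClass X) (𝒴 : C.space a₁ a₂ a₃),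
          ∃ 𝒵 : C.space a₂ a₁ a₃, C.IsSigma₁₂ 𝒴 𝒵 ∧
            ρ (Equiv.swap 0 1) (C.incl a₁ a₂ a₃ 𝒴) = C.incl a₂ a₁ a₃ 𝒵) ∧
        (∀ (a₁ a₂ a₃ : IrrClass X) (𝒴 : C.space a₁ a₂ a₃),
          ∃ 𝒵 : C.space a₁ (C.dual a₃) (C.dual a₂), C.IsSigma₂₃ 𝒴 𝒵 ∧
            ρ (Equiv.swap 1 2) (C.incl a₁ a₂ a₃ 𝒴) = C.incl a₁ (C.dual a₃) (C.dual a₂) 𝒵) := by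
  refine ⟨exists_representatives X, fun C => ?_⟩
  obtain ⟨ρ, hρ₁, hρ₂⟩ := exists_monoidHom_perm_fin_three C.totalSigma₁₂_mul_self
    C.totalSigma₂₃_mul_self C.totalSigma_braid
  refine ⟨ρ, ⟨fun a₁ a₂ a₃ 𝒴 => ⟨_, C.isSigma₁₂_sigma₁₂ 𝒴, ?_⟩,
    fun a₁ a₂ a₃ 𝒴 => ⟨_, C.isSigma₂₃Of_sigma₂₃ (C.dual_dual a₃) rfl 𝒴, ?_⟩⟩, ?_⟩
  · rw [hρ₁, C.totalSigma₁₂_incl]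
  · rw [hρ₂, C.totalSigma₂₃_incl (C.dual_dual a₃) rfl]
  · rintro ρ' ⟨h₁, h₂⟩
    -- Agreement on the two transpositions suffices, and on each summand the value of a
    -- transposition is forced by its defining formula.
    refine monoidHom_perm_fin_three_ext ?_ ?_
    · refine C.total_ext fun a₁ a₂ a₃ 𝒴 => ?_
      obtain ⟨𝒵, h𝒵, he⟩ := h₁ a₁ a₂ a₃ 𝒴
      rw [he, hρ₁, C.totalSigma₁₂_incl, h𝒵.eq (C.isSigma₁₂_sigma₁₂ 𝒴)]
    · refine C.total_ext fun a₁ a₂ a₃ 𝒴 => ?_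
      obtain ⟨𝒵, h𝒵, he⟩ := h₂ a₁ a₂ a₃ 𝒴
      have h𝒵' : C.IsSigma₂₃Of (C.dual_dual a₃) rfl 𝒴 𝒵 := h𝒵
      rw [he, hρ₂, C.totalSigma₂₃_incl (C.dual_dual a₃) rfl,
        h𝒵'.eq (C.isSigma₂₃Of_sigma₂₃ (C.dual_dual a₃) rfl 𝒴)]
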